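/- Let $0<\kappa<1$, $0<\gamma<\tfrac12$, $0<g<\tfrac{\gamma}{64}$, and let $f:\mathbb R^3\to\mathbb R$ be measurable with $|f|\le 1$ almost everywhere. Put $\rho_n=\kappa\gamma^n$, $B_n=\{k\in\mathbb R^3: |k|<\rho_n\}$, $\omega(k)=|k|$ and $$G(k)=g\,\frac{\mathbf 1_{\{|k|<\kappa\}}}{4\pi\sqrt{|k|}}\,f(k)\,\sigma_1 ,\qquad G_n=\mathbf 1_{\mathbb R^3\setminus B_n}G,\qquad \omega_n=\mathbf 1_{\mathbb R^3\setminus B_n}\,\omega,\qquad \widetilde\omega_n=\mathbf 1_{B_n\setminus B_{n+1}}\,\omega ,$$ where $\sigma_1=\begin{pmatrix}0&1\\1&0\end{pmatrix}$ and $\sigma_3=\begin{pmatrix}1&0\\0&-1\end{pmatrix}$. Let $\mathcal F[\mathfrak h]$ denote the bosonic Fock space over $\mathfrak h$, with creation and annihilation operators $a^*(k),a(k)$, and let $H_{\rm ph}(w)=d\Gamma(w)$ be the second quantization of multiplication by $w$. On $\mathcal H_n=\mathbb C^2\otimes\mathcal F[L^2(\mathbb R^3\setminus B_n)]$ consider $$H_n=H_{\rm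 at}+\Phi(G_n)+H_{\rm ph}(\omega_n),\qquad H_{\rm at}=\begin{pmatrix}2&0\\0&0\end{pmatrix},\qquad \Phi(G_n)=\int \big[G_n(k)\otimes a^*(k)+G_n(k)^*\otimes a(k)\big]\,dk ,$$ and on $\mathcal H_{n+1}=\mathcal H_n\otimes\mathcal F[L^2(B_n\setminus B_{n+1})]$ consider $\widetilde H_n=H_n\otimes \mathbf 1+\mathbf 1\otimes H_{\rm ph}(\widetilde\omega_n)$. Let $E_n=\inf\sigma(H_n)$, $\Gamma_n=\{z\in\mathbb C:|z-E_n|=\tfrac18\rho_n\}$ (positively oriented), and $$P_n=\frac{-1}{2\pi i}\int_{\Gamma_n}\frac{dz}{H_n-z},\qquad \widetilde P_n=\frac{-1}{2\pi i}\int_{\Gamma_{n+1}}\frac{dz}{\widetilde H_n-z}.$$ Let $\mathcal S=\sigma_3(-1)^{\mathcal N_{\rm ph}}$ on $\mathcal H_n$, where $\mathcal N_{\rm ph}=d\Gamma(\mathbf 1)$ is the photon number operator. Then for every integer $n\ge 0$: $\mathcal S$ commutes with $H_n$ (it maps the domain of $H_n$ into itself and $H_n\mathcal S\psi=\mathcal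 S H_n\psi$ there) and $\mathcal S\sigma_1=-\sigma_1\mathcal S$; the circle $\Gamma_n$ lies in the resolvent set of $H_n$, the circle $\Gamma_{n+1}$ lies in the resolvent set of $\widetilde H_n$, and $P_n$ and $\widetilde P_n$ are rank-one orthogonal projections; and $$P_n\,\sigma_1\,P_n=0,\qquad \widetilde P_n\,\sigma_1\,\widetilde P_n=0 .$$ -/

import Mathlib

open MeasureTheory Complex
open scoped ENNReal InnerProductSpace

noncomputable section

namespace SpinBoson

/-! ### Bosonic Fock space over `L²(A)`, `A ⊆ ℝ³` -/

/-- The momentum space `ℝ³`. -/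
abbrev Momentum : Type := EuclideanSpace ℝ (Fin 3)

/-- Lebesgue measure on `A ^ ℓ`, viewed as a measure on `(ℝ³) ^ ℓ`. -/
abbrev configMeasure (A : Set Momentum) (ℓ : ℕ) : Measure (Fin ℓ → Momentum) :=
  Measure.pi fun _ => volume.restrict A

theorem measurePreserving_perm (A : Set Momentum) {ℓ : ℕ} (σ : Equiv.Perm (Fin ℓ)) :
    MeasurePreserving (fun k : Fin ℓ → Momentum => k ∘ σ)
      (configMeasure A ℓ) (configMeasure A ℓ) := by
  have h := measurePreserving_piCongrLeft (fun _ : Fin ℓ => volume.restrict A) σ.symm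
  convert h using 1
  ext k i
  have := MeasurableEquiv.piCongrLeft_apply_apply (β := fun _ : Fin ℓ => Momentum)
    σ.symm k (σ i)
  simp only [Equiv.symm_apply_apply] at this
  simp [this]

/-- Deleting one of the `ℓ + 1` momenta. -/
theorem quasiMeasurePreserving_succAbove (A : Set Momentum) {ℓ : ℕ} (i : Fin (ℓ + 1)) :
    Measure.QuasiMeasurePreserving
      (fun (k : Fin (ℓ + 1) → Momentum) (j : Fin ℓ) => k (i.succAbove j))
      (configMeasure A (ℓ + 1)) (configMeasure A ℓ) :=
  (Measure.quasiMeasurePreserving_snd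
    (μ := (volume.restrict A : Measure Momentum)) (ν := configMeasure A ℓ)).comp
    (measurePreserving_piFinSuccAbove
      (fun _ : Fin (ℓ + 1) => (volume.restrict A : Measure Momentum)) i).quasiMeasurePreserving

/-- The `ℓ`-fold symmetric tensor power of `L²(A)`: the square integrable wave functions
`ψ(k₁, …, k_ℓ)` on `A ^ ℓ` that are invariant under permutations of the momenta. -/
def symmSubspace (A : Set Momentum) (ℓ : ℕ) : Submodule ℂ (Lp ℂ 2 (configMeasure A ℓ)) where
  carrier := {ψ | ∀ σ : Equiv.Perm (Fin ℓ), (fun k => ψ (k ∘ σ)) =ᵐ[configMeasure A ℓ] ψ}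
  zero_mem' := by
    intro σ
    have h0 := Lp.coeFn_zero ℂ 2 (configMeasure A ℓ)
    have h1 := (measurePreserving_perm A σ).quasiMeasurePreserving.ae h0
    filter_upwards [h0, h1] with k hk hk'
    rw [hk, hk', Pi.zero_apply, Pi.zero_apply]
  add_mem' := by
    intro ψ φ hψ hφ σ
    have h0 := Lp.coeFn_add ψ φ
    have h1 := (measurePreserving_perm A σ).quasiMeasurePreserving.ae h0
    filter_upwards [h0, h1, hψ σ, hφ σ] with k hk hk' h2 h3
    rw [hk, hk', Pi.add_apply, Pi.add_apply, h2, h3]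
  smul_mem' := by
    intro c ψ hψ σ
    have h0 := Lp.coeFn_smul c ψ
    have h1 := (measurePreserving_perm A σ).quasiMeasurePreserving.ae h0
    filter_upwards [h0, h1, hψ σ] with k hk hk' h2
    rw [hk, hk', Pi.smul_apply, Pi.smul_apply, h2]

theorem isClosed_symmSubspace (A : Set Momentum) (ℓ : ℕ) :
    IsClosed (symmSubspace A ℓ : Set (Lp ℂ 2 (configMeasure A ℓ))) := by
  have : (symmSubspace A ℓ : Set (Lp ℂ 2 (configMeasure A ℓ))) =
      ⋂ σ : Equiv.Perm (Fin ℓ),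
        {ψ | Lp.compMeasurePreserving _ (measurePreserving_perm A σ) ψ = ψ} := by
    ext ψ
    simp only [SetLike.mem_coe, Set.mem_iInter, Set.mem_ofPred_eq]
    refine forall_congr' fun σ => ?_
    have h := Lp.coeFn_compMeasurePreserving ψ (measurePreserving_perm A σ)
    constructor
    · intro hψ
      exact Lp.ext (h.trans hψ)
    · intro hψ
      rw [hψ] at h
      exact h.symm
  rw [this]
  exact isClosed_iInter fun σ => isClosed_eq
    (Lp.isometry_compMeasurePreserving (measurePreserving_perm A σ)).continuous continuous_id

instance (A : Set Momentum) (ℓ : ℕ) : CompleteSpace (symmSubspace A ℓ) :=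
  (isClosed_symmSubspace A ℓ).completeSpace_coe

/-- The bosonic Fock space `𝓕[L²(A)]`: the Hilbert space direct sum over `ℓ ∈ ℕ` of the
`ℓ`-photon spaces (the `0`-photon space is `ℂ`). -/
abbrev Fock (A : Set Momentum) : Type := lp (fun ℓ : ℕ => symmSubspace A ℓ) 2

/-- The `ℓ`-photon wave function of a Fock vector. -/
def wave {A : Set Momentum} (ψ : Fock A) (ℓ : ℕ) : (Fin ℓ → Momentum) → ℂ :=
  ((ψ ℓ : symmSubspace A ℓ) : Lp ℂ 2 (configMeasure A ℓ))

theorem wave_zero (A : Set Momentum) (ℓ : ℕ) :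
    wave (0 : Fock A) ℓ =ᵐ[configMeasure A ℓ] 0 :=
  Lp.coeFn_zero ℂ 2 (configMeasure A ℓ)

theorem wave_add {A : Set Momentum} (ψ φ : Fock A) (ℓ : ℕ) :
    wave (ψ + φ) ℓ =ᵐ[configMeasure A ℓ] wave ψ ℓ + wave φ ℓ :=
  Lp.coeFn_add _ _

theorem wave_smul {A : Set Momentum} (c : ℂ) (ψ : Fock A) (ℓ : ℕ) :
    wave (c • ψ) ℓ =ᵐ[configMeasure A ℓ] c • wave ψ ℓ :=
  Lp.coeFn_smul c _

theorem wave_ext {A : Set Momentum} {ψ φ : Fock A}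
    (h : ∀ ℓ, wave ψ ℓ =ᵐ[configMeasure A ℓ] wave φ ℓ) : ψ = φ := by
  apply lp.ext
  funext ℓ
  exact Subtype.ext (Lp.ext (h ℓ))

/-! ### Second quantized operators on Fock space

Each operator is given by its graph, with its maximal domain: a Fock vector `ψ` is in the domain
when the displayed formula produces a Fock vector. -/

/-- Graph of `dΓ(w)`, the second quantization of multiplication by `w`:
`(dΓ(w) ψ)_ℓ (k₁, …, k_ℓ) = (w(k₁) + ⋯ + w(k_ℓ)) ψ_ℓ(k₁, …, k_ℓ)`. -/
def dGammaGraph (A : Set Momentum) (w : Momentum → ℝ) : Submodule ℂ (Fock A × Fock A) where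
  carrier := {p | ∀ ℓ, ∀ᵐ k ∂configMeasure A ℓ,
    wave p.2 ℓ k = ((∑ i, w (k i) : ℝ) : ℂ) * wave p.1 ℓ k}
  zero_mem' := by
    intro ℓ
    filter_upwards [wave_zero A ℓ] with k hk
    simp [hk]
  add_mem' := by
    intro p q hp hq ℓ
    filter_upwards [hp ℓ, hq ℓ, wave_add p.1 q.1 ℓ, wave_add p.2 q.2 ℓ] with k h1 h2 h3 h4
    simp only [Prod.fst_add, Prod.snd_add, h3, h4, Pi.add_apply, h1, h2]
    ring
  smul_mem' := by
    intro c p hp ℓ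
    filter_upwards [hp ℓ, wave_smul c p.1 ℓ, wave_smul c p.2 ℓ] with k h1 h3 h4
    simp only [Prod.smul_fst, Prod.smul_snd, h3, h4, Pi.smul_apply, h1, smul_eq_mul]
    ring

theorem dGammaGraph_functional (A : Set Momentum) (w : Momentum → ℝ) :
    ∀ p ∈ dGammaGraph A w, p.1 = 0 → p.2 = 0 := by
  intro p hp h0
  refine wave_ext fun ℓ => ?_
  filter_upwards [hp ℓ, wave_zero A ℓ] with k h1 h2
  rw [h1, h0, h2]
  simp

/-- `H_ph(w) = dΓ(w)` on `𝓕[L²(A)]`. -/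
def dGamma (A : Set Momentum) (w : Momentum → ℝ) : Fock A →ₗ.[ℂ] Fock A :=
  (dGammaGraph A w).toLinearPMap

/-- Graph of the creation operator `a*(h) = ∫ h(k) a*(k) dk`: `(a*(h) ψ)₀ = 0` and
`(a*(h) ψ)_{ℓ+1}(k₀, …, k_ℓ) = (ℓ+1)^{-1/2} ∑ᵢ h(kᵢ) ψ_ℓ(k₀, …, (omit kᵢ), …, k_ℓ)`. -/
def creationGraph (A : Set Momentum) (h : Momentum → ℂ) : Submodule ℂ (Fock A × Fock A) where
  carrier := {p | (∀ᵐ k ∂configMeasure A 0, wave p.2 0 k = 0) ∧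
    ∀ ℓ, ∀ᵐ k ∂configMeasure A (ℓ + 1), wave p.2 (ℓ + 1) k =
      ((Real.sqrt (ℓ + 1))⁻¹ : ℝ) *
        ∑ i : Fin (ℓ + 1), h (k i) * wave p.1 ℓ (fun j => k (i.succAbove j))}
  zero_mem' := by
    refine ⟨wave_zero A 0, fun ℓ => ?_⟩
    have h1 := ae_all_iff.2 fun i : Fin (ℓ + 1) =>
      (quasiMeasurePreserving_succAbove A i).ae (wave_zero A ℓ)
    filter_upwards [wave_zero A (ℓ + 1), h1] with k hk hk'
    simp [hk, hk']
  add_mem' := by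
    intro p q hp hq
    refine ⟨?_, fun ℓ => ?_⟩
    · filter_upwards [hp.1, hq.1, wave_add p.2 q.2 0] with k h1 h2 h3
      simp [h1, h2, h3]
    · have h1 := ae_all_iff.2 fun i : Fin (ℓ + 1) =>
        (quasiMeasurePreserving_succAbove A i).ae (wave_add p.1 q.1 ℓ)
      filter_upwards [hp.2 ℓ, hq.2 ℓ, wave_add p.2 q.2 (ℓ + 1), h1] with k h2 h3 h4 h5
      simp only [Prod.fst_add, Prod.snd_add, h4, Pi.add_apply, h2, h3, h5, mul_add,
        Finset.sum_add_distrib]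
  smul_mem' := by
    intro c p hp
    refine ⟨?_, fun ℓ => ?_⟩
    · filter_upwards [hp.1, wave_smul c p.2 0] with k h1 h3
      simp [h1, h3]
    · have h1 := ae_all_iff.2 fun i : Fin (ℓ + 1) =>
        (quasiMeasurePreserving_succAbove A i).ae (wave_smul c p.1 ℓ)
      filter_upwards [hp.2 ℓ, wave_smul c p.2 (ℓ + 1), h1] with k h2 h4 h5
      simp only [Prod.smul_fst, Prod.smul_snd, h4, Pi.smul_apply, h2, h5, smul_eq_mul,
        mul_left_comm _ c, ← Finset.mul_sum]

theorem creationGraph_functional (A : Set Momentum) (h : Momentum → ℂ) :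
    ∀ p ∈ creationGraph A h, p.1 = 0 → p.2 = 0 := by
  intro p hp h0
  refine wave_ext fun ℓ => ?_
  cases ℓ with
  | zero =>
    filter_upwards [hp.1, wave_zero A 0] with k h1 h2
    rw [h1, h2]; rfl
  | succ ℓ =>
    have h1 := ae_all_iff.2 fun i : Fin (ℓ + 1) =>
      (quasiMeasurePreserving_succAbove A i).ae (wave_zero A ℓ)
    filter_upwards [hp.2 ℓ, wave_zero A (ℓ + 1), h1] with k h2 h3 h4
    rw [h2, h0, h3]
    simp [h4]

/-- The creation operator `a*(h)` on `𝓕[L²(A)]`. -/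
def creation (A : Set Momentum) (h : Momentum → ℂ) : Fock A →ₗ.[ℂ] Fock A :=
  (creationGraph A h).toLinearPMap

/-- Prepending a momentum. -/
theorem ae_ae_cons {A : Set Momentum} {ℓ : ℕ} {p : (Fin (ℓ + 1) → Momentum) → Prop}
    (hp : ∀ᵐ k ∂configMeasure A (ℓ + 1), p k) :
    ∀ᵐ k' ∂configMeasure A ℓ, ∀ᵐ q ∂(volume.restrict A : Measure Momentum),
      p (Fin.cons q k') := by
  have h1 := ((measurePreserving_piFinSuccAbove
      (fun _ : Fin (ℓ + 1) => (volume.restrict A : Measure Momentum)) 0).symm).quasiMeasurePreserving.ae hp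
  have h2 := Measure.ae_ae_of_ae_prod
    ((Measure.measurePreserving_swap (μ := configMeasure A ℓ)
      (ν := (volume.restrict A : Measure Momentum))).quasiMeasurePreserving.ae h1)
  filter_upwards [h2] with k' hk'
  filter_upwards [hk'] with q hq
  simpa [MeasurableEquiv.piFinSuccAbove_symm_apply, Fin.insertNthEquiv] using hq

/-- Graph of the annihilation operator `a(h) = ∫ conj h(k) a(k) dk`:
`(a(h) ψ)_ℓ (k₁, …, k_ℓ) = (ℓ+1)^{1/2} ∫_A conj h(q) ψ_{ℓ+1}(q, k₁, …, k_ℓ) dq`. -/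
def annihilationGraph (A : Set Momentum) (h : Momentum → ℂ) :
    Submodule ℂ (Fock A × Fock A) where
  carrier := {p | ∀ ℓ, ∀ᵐ k ∂configMeasure A ℓ,
    IntegrableOn (fun q => star (h q) * wave p.1 (ℓ + 1) (Fin.cons q k)) A ∧
    wave p.2 ℓ k =
      (Real.sqrt (ℓ + 1) : ℝ) * ∫ q in A, star (h q) * wave p.1 (ℓ + 1) (Fin.cons q k)}
  zero_mem' := by
    intro ℓ
    filter_upwards [wave_zero A ℓ, ae_ae_cons (wave_zero A (ℓ + 1))] with k hk hk'
    have h1 : (fun q => star (h q) * wave (0 : Fock A) (ℓ + 1) (Fin.cons q k))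
        =ᵐ[volume.restrict A] fun _ => 0 := by
      filter_upwards [hk'] with q hq
      simp [hq]
    refine ⟨(integrable_zero _ _ _).congr h1.symm, ?_⟩
    simp only [Prod.fst_zero, Prod.snd_zero]
    rw [integral_congr_ae h1, hk]
    simp
  add_mem' := by
    intro p q hp hq ℓ
    filter_upwards [hp ℓ, hq ℓ, wave_add p.2 q.2 ℓ, ae_ae_cons (wave_add p.1 q.1 (ℓ + 1))]
      with k h1 h2 h3 h4
    have h5 : (fun r => star (h r) * wave (p.1 + q.1) (ℓ + 1) (Fin.cons r k))
        =ᵐ[volume.restrict A] fun r => star (h r) * wave p.1 (ℓ + 1) (Fin.cons r k) +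
          star (h r) * wave q.1 (ℓ + 1) (Fin.cons r k) := by
      filter_upwards [h4] with r hr
      rw [hr, Pi.add_apply, mul_add]
    refine ⟨(h1.1.add h2.1).congr h5.symm, ?_⟩
    simp only [Prod.fst_add, Prod.snd_add]
    rw [integral_congr_ae h5, integral_add h1.1 h2.1, h3, Pi.add_apply, h1.2, h2.2, mul_add]
  smul_mem' := by
    intro c p hp ℓ
    filter_upwards [hp ℓ, wave_smul c p.2 ℓ, ae_ae_cons (wave_smul c p.1 (ℓ + 1))]
      with k h1 h3 h4
    have h5 : (fun r => star (h r) * wave (c • p.1) (ℓ + 1) (Fin.cons r k))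
        =ᵐ[volume.restrict A] fun r => c * (star (h r) * wave p.1 (ℓ + 1) (Fin.cons r k)) := by
      filter_upwards [h4] with r hr
      rw [hr, Pi.smul_apply, smul_eq_mul, mul_left_comm]
    refine ⟨(h1.1.const_mul c).congr h5.symm, ?_⟩
    simp only [Prod.smul_fst, Prod.smul_snd]
    rw [integral_congr_ae h5, integral_const_mul, h3, Pi.smul_apply, h1.2, smul_eq_mul,
      mul_left_comm]

theorem annihilationGraph_functional (A : Set Momentum) (h : Momentum → ℂ) :
    ∀ p ∈ annihilationGraph A h, p.1 = 0 → p.2 = 0 := by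
  intro p hp h0
  refine wave_ext fun ℓ => ?_
  filter_upwards [hp ℓ, wave_zero A ℓ, ae_ae_cons (wave_zero A (ℓ + 1))] with k h1 h2 h3
  have h5 : (fun r => star (h r) * wave p.1 (ℓ + 1) (Fin.cons r k))
      =ᵐ[volume.restrict A] fun _ => 0 := by
    filter_upwards [h3] with r hr
    rw [h0, hr]; simp
  rw [h1.2, h2, integral_congr_ae h5]
  simp

/-- The annihilation operator `a(h)` on `𝓕[L²(A)]`. -/
def annihilation (A : Set Momentum) (h : Momentum → ℂ) : Fock A →ₗ.[ℂ] Fock A :=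
  (annihilationGraph A h).toLinearPMap

theorem memℓp_parity {A : Set Momentum} (ψ : Fock A) :
    Memℓp (fun ℓ : ℕ => (-1 : ℂ) ^ ℓ • ψ ℓ) 2 := by
  have h := (lp.memℓp ψ).summable (by norm_num)
  refine memℓp_gen (h.congr fun ℓ => ?_)
  rw [norm_smul, norm_pow, norm_neg, norm_one, one_pow, one_mul]

/-- The operator `(-1)^{N_ph}` on `𝓕[L²(A)]`; it is multiplication by `(-1)^ℓ` on the `ℓ`-photon
space, the eigenspace of the photon number operator `N_ph = dΓ(1)` for the eigenvalue `ℓ`. -/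
def parity (A : Set Momentum) : Fock A →ₗ[ℂ] Fock A where
  toFun ψ := ⟨fun ℓ => (-1 : ℂ) ^ ℓ • ψ ℓ, memℓp_parity ψ⟩
  map_add' := by
    intro ψ φ
    ext1; funext ℓ
    exact smul_add _ _ _
  map_smul' := by
    intro c ψ
    ext1; funext ℓ
    exact smul_comm ((-1 : ℂ) ^ ℓ) c (ψ ℓ)

/-! ### The atom-photon space `ℂ² ⊗ 𝓕[L²(A)]` -/

/-- `ℂ² ⊗ 𝓕[L²(A)]`, realized as the Hilbert space of pairs of Fock vectors. -/
abbrev AtomPhoton (A : Set Momentum) : Type := PiLp 2 fun _ : Fin 2 => Fock A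

/-- `M ⊗ 1` for a `2 × 2` matrix `M`. -/
def matrixOp (A : Set Momentum) (M : Matrix (Fin 2) (Fin 2) ℂ) :
    AtomPhoton A →L[ℂ] AtomPhoton A where
  toFun ψ := WithLp.toLp 2 fun i => ∑ j, M i j • ψ j
  map_add' := by
    intro ψ φ
    ext1 i
    simp [smul_add, Finset.sum_add_distrib]
  map_smul' := by
    intro c ψ
    ext1 i
    simp [smul_comm c]
  cont := by fun_prop

/-- `1 ⊗ T` for an operator `T` on Fock space, with domain `ℂ² ⊗ D(T)`. -/
def photonOp (A : Set Momentum) (T : Fock A →ₗ.[ℂ] Fock A) :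
    AtomPhoton A →ₗ.[ℂ] AtomPhoton A where
  domain :=
    { carrier := {ψ | ∀ i, ψ i ∈ T.domain}
      zero_mem' := fun _ => T.domain.zero_mem
      add_mem' := fun hψ hφ i => T.domain.add_mem (hψ i) (hφ i)
      smul_mem' := fun c _ hψ i => T.domain.smul_mem c (hψ i) }
  toFun :=
    { toFun := fun ψ => WithLp.toLp 2 fun i => T ⟨ψ.1 i, ψ.2 i⟩
      map_add' := by
        intro ψ φ
        ext1 i
        exact T.map_add ⟨ψ.1 i, ψ.2 i⟩ ⟨φ.1 i, φ.2 i⟩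
      map_smul' := by
        intro c ψ
        ext1 i
        exact T.map_smul c ⟨ψ.1 i, ψ.2 i⟩ }

/-- The Pauli matrix `σ₁`. -/
def sigma1 : Matrix (Fin 2) (Fin 2) ℂ := !![0, 1; 1, 0]

/-- The Pauli matrix `σ₃`. -/
def sigma3 : Matrix (Fin 2) (Fin 2) ℂ := !![1, 0; 0, -1]

/-- The Hamiltonian `H_at` of the two-level atom. -/
def atomMatrix : Matrix (Fin 2) (Fin 2) ℂ := !![2, 0; 0, 0]

/-- The field operator `Φ(G) = ∫ (G(k) ⊗ a*(k) + G(k)* ⊗ a(k)) dk` for `G(k) = h(k) M`, that is,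
`M ⊗ a*(h) + M* ⊗ a(h)`, on the intersection of the two domains. -/
def fieldOp (A : Set Momentum) (M : Matrix (Fin 2) (Fin 2) ℂ) (h : Momentum → ℂ) :
    AtomPhoton A →ₗ.[ℂ] AtomPhoton A :=
  (matrixOp A M).toLinearMap.compPMap (photonOp A (creation A h)) +
    (matrixOp A M.conjTranspose).toLinearMap.compPMap (photonOp A (annihilation A h))

/-- The operator `S = σ₃ (-1)^{N_ph}` on `ℂ² ⊗ 𝓕[L²(A)]`. -/
def symmetryOp (A : Set Momentum) : AtomPhoton A →ₗ[ℂ] AtomPhoton A :=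
  (matrixOp A sigma3).toLinearMap ∘ₗ
    { toFun := fun ψ => WithLp.toLp 2 fun i => parity A (ψ i)
      map_add' := by
        intro ψ φ
        ext1 i
        exact map_add (parity A) (ψ i) (φ i)
      map_smul' := by
        intro c ψ
        ext1 i
        exact map_smul (parity A) c (ψ i) }

/-! ### Resolvents, spectra and Riesz projections of unbounded operators -/

section Spectral

variable {E : Type*} [NormedAddCommGroup E] [NormedSpace ℂ E]

/-- `R` is the bounded everywhere defined two-sided inverse of `T - z`. -/
def IsResolvent (T : E →ₗ.[ℂ] E) (z : ℂ) (R : E →L[ℂ] E) : Prop :=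
  (∀ ψ : E, ∃ h : R ψ ∈ T.domain, T ⟨R ψ, h⟩ - z • R ψ = ψ) ∧
    ∀ ψ : T.domain, R (T ψ - z • (ψ : E)) = ψ

/-- The resolvent set of an unbounded operator. -/
def resolventSet (T : E →ₗ.[ℂ] E) : Set ℂ := {z | ∃ R : E →L[ℂ] E, IsResolvent T z R}

open Classical in
/-- The resolvent `(T - z)⁻¹` for `z` in the resolvent set (and `0` otherwise). -/
def resolventOp (T : E →ₗ.[ℂ] E) (z : ℂ) : E →L[ℂ] E :=
  if h : ∃ R : E →L[ℂ] E, IsResolvent T z R then h.choose else 0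

/-- The infimum of the (real) spectrum. -/
def spectralInf (T : E →ₗ.[ℂ] E) : ℝ := sInf {x : ℝ | (x : ℂ) ∉ resolventSet T}

/-- `(-1 / (2πi)) ∫_{|z - c| = r} (T - z)⁻¹ dz`, the circle being positively oriented. -/
def rieszProjection (T : E →ₗ.[ℂ] E) (c : ℂ) (r : ℝ) : E →L[ℂ] E :=
  (-1 / (2 * (Real.pi : ℂ) * I)) • ∮ z in C(c, r), resolventOp T z

end Spectral

/-- `P` is the rank-one orthogonal projection `|φ⟩⟨φ|` for some unit vector `φ`. -/
def IsRankOneProjection {E : Type*} [NormedAddCommGroup E] [InnerProductSpace ℂ E]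
    (P : E →L[ℂ] E) : Prop :=
  ∃ φ : E, ‖φ‖ = 1 ∧ ∀ ψ : E, P ψ = ⟪φ, ψ⟫_ℂ • φ

/-- `S T = T S` for an everywhere defined operator `S` and an unbounded operator `T`:
`S` maps the domain of `T` to itself and `T S ψ = S T ψ` on that domain. -/
def CommutesWith {E : Type*} [NormedAddCommGroup E] [NormedSpace ℂ E]
    (S : E →ₗ[ℂ] E) (T : E →ₗ.[ℂ] E) : Prop :=
  ∀ ψ : T.domain, ∃ h : S ψ ∈ T.domain, T ⟨S ψ, h⟩ = S (T ψ)

/-! ### The infrared regularized spin-boson Hamiltonians -/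

/-- The infrared cutoff `ρ_n = κ γⁿ`. -/
def rho (κ γ : ℝ) (n : ℕ) : ℝ := κ * γ ^ n

/-- The ball `B_n = {k : |k| < ρ_n}`. -/
def irBall (κ γ : ℝ) (n : ℕ) : Set Momentum := {k | ‖k‖ < rho κ γ n}

/-- The scalar coupling function `g Λ(k) f(k) / (4π √|k|)`, `Λ = 1_{|k| < κ}`;
the coupling function `G` is this function times `σ₁`. -/
def coupling (κ g : ℝ) (f : Momentum → ℝ) (k : Momentum) : ℂ :=
  ((g * ({k : Momentum | ‖k‖ < κ}.indicator 1 k / (4 * Real.pi * Real.sqrt ‖k‖)) * f k : ℝ) : ℂ)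

/-- `H_at + Φ(G_n) + H_ph(ω_n)` on `ℂ² ⊗ 𝓕[L²(A)]`, where `G_n = 1_{ℝ³ \ B_n} G` and
`ω_n = 1_{ℝ³ \ B_n} |k|`. For `A = ℝ³ \ B_n` this is `H_n`. For `A = ℝ³ \ B_{n+1}` it is `H_n ⊗ 1`
in `(ℂ² ⊗ 𝓕[L²(ℝ³ \ B_n)]) ⊗ 𝓕[L²(B_n \ B_{n+1})] = ℂ² ⊗ 𝓕[L²(A)]`. -/
def cutoffHamiltonian (A : Set Momentum) (κ γ g : ℝ) (f : Momentum → ℝ) (n : ℕ) :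
    AtomPhoton A →ₗ.[ℂ] AtomPhoton A :=
  (matrixOp A atomMatrix).toLinearMap.toPMap ⊤ +
    fieldOp A sigma1 ((irBall κ γ n)ᶜ.indicator (coupling κ g f)) +
    photonOp A (dGamma A ((irBall κ γ n)ᶜ.indicator fun k => ‖k‖))

/-- The space `ℋ_n = ℂ² ⊗ 𝓕[L²(ℝ³ \ B_n)]`. -/
abbrev HilbertN (κ γ : ℝ) (n : ℕ) : Type := AtomPhoton (irBall κ γ n)ᶜ

/-- The Hamiltonian `H_n` on `ℋ_n`. -/
def hamiltonian (κ γ g : ℝ) (f : Momentum → ℝ) (n : ℕ) :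
    HilbertN κ γ n →ₗ.[ℂ] HilbertN κ γ n :=
  cutoffHamiltonian (irBall κ γ n)ᶜ κ γ g f n

/-- The Hamiltonian `H̃_n = H_n ⊗ 1 + 1 ⊗ H_ph(ω̃_n)` on `ℋ_{n+1}`, where
`ω̃_n = 1_{B_n \ B_{n+1}} |k|`. -/
def hamiltonianTilde (κ γ g : ℝ) (f : Momentum → ℝ) (n : ℕ) :
    HilbertN κ γ (n + 1) →ₗ.[ℂ] HilbertN κ γ (n + 1) :=
  cutoffHamiltonian (irBall κ γ (n + 1))ᶜ κ γ g f n +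
    photonOp _ (dGamma _ ((irBall κ γ n \ irBall κ γ (n + 1)).indicator fun k => ‖k‖))

/-- `E_n = inf σ(H_n)`. -/
def energy (κ γ g : ℝ) (f : Momentum → ℝ) (n : ℕ) : ℝ := spectralInf (hamiltonian κ γ g f n)

/-- The circle `Γ_n = {z : |z - E_n| = ρ_n / 8}`. -/
def contour (κ γ g : ℝ) (f : Momentum → ℝ) (n : ℕ) : Set ℂ :=
  Metric.sphere (energy κ γ g f n : ℂ) (rho κ γ n / 8)

/-- `P_n = (-1 / (2πi)) ∫_{Γ_n} (H_n - z)⁻¹ dz`. -/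
def projP (κ γ g : ℝ) (f : Momentum → ℝ) (n : ℕ) : HilbertN κ γ n →L[ℂ] HilbertN κ γ n :=
  rieszProjection (hamiltonian κ γ g f n) (energy κ γ g f n) (rho κ γ n / 8)

/-- `P̃_n = (-1 / (2πi)) ∫_{Γ_{n+1}} (H̃_n - z)⁻¹ dz`. -/
def projPTilde (κ γ g : ℝ) (f : Momentum → ℝ) (n : ℕ) :
    HilbertN κ γ (n + 1) →L[ℂ] HilbertN κ γ (n + 1) :=
  rieszProjection (hamiltonianTilde κ γ g f n) (energy κ γ g f (n + 1)) (rho κ γ (n + 1) / 8)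

/-- `σ₁` as an operator on `ℋ_n`. -/
def sigma1Op (κ γ : ℝ) (n : ℕ) : HilbertN κ γ n →L[ℂ] HilbertN κ γ n := matrixOp _ sigma1

end SpinBoson

end

open SpinBoson

open MeasureTheory Complex
open scoped ENNReal InnerProductSpace
noncomputable section
namespace SpinBoson

/-! ### Resolvents of unbounded operators -/

section Resolvent

variable {E : Type*} [NormedAddCommGroup E] [NormedSpace ℂ E] {T : E →ₗ.[ℂ] E} {z w : ℂ}

/-! The operator S is unitary, commutes with the Hamiltonian and anticommutes with σ₁. If φ is a
unit vector spanning a simple eigenspace, then Sφ = aφ with |a| = 1, hence ⟨φ, σ₁φ⟩ = ⟨Sφ, Sσ₁φ⟩ =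
-⟨Sφ, σ₁Sφ⟩ = -⟨φ, σ₁φ⟩ = 0 (`HasGroundState.projection_comp_eq_zero`). The real work is to show
that H_n and H̃_n have a simple lowest eigenvalue with a gap larger than the circles require.

The gap comes from an induction on n, run on one fixed Fock space over a set A bounded away from
zero momentum; there the photons in S = B_n are still free. The induction hypothesis `GroundData` is
the form inequality H ≥ e + dΓ(1_S ω) + δ(P_S - |φ⟩⟨φ|), together with its version for δ = 0, where
P_S projects onto the vectors without photons in S. For n = 0 there is no coupling at all, because G
is supported in B_0 (`exists_groundData_decoupled`).

In the induction step the coupling h' to the shell S \ S' is switched on, where photon energies are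
at least r. For unit vectors |⟨Φ(h')⟩| ≤ 2‖h'‖⟨N⟩^{1/2}, with N the number of shell photons, so part
of the field energy of the shell absorbs the coupling up to a constant τ (`Shell.lower_bound`). With
P_{S'} ≤ P_S + N this gives H' + r(1 - P_{S'}) + (r/2)|φ⟩⟨φ| ≥ e - τ + r/2, while φ is a trial
vector of energy e. An operator that a positive rank-one term lifts above c, but which has a trial
energy below c, has a simple lowest eigenvalue below c and all else above c
(`exists_hasGroundState`). Its eigenvector turns out to have no photons in S', so it is an
eigenvector of H' (`Shell.exists_eigenvector`). Lower bounds extend to vectors with photons in S' by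
the pull-through formula: H' - dΓ(1_{S'} ω) commutes with a(q) for q in S' (`sector_lower_bound`,
`lower_of_sector`). The induction closes with r = ρ_{n+1}, τ = ρ_{n+1}/16 and δ = ρ_n/4
(`exists_groundData_succ`).

Adding δ|φ⟩⟨φ| to T moves its lowest eigenvalue to e + δ, which identifies the singular part of the
resolvent inside the circle and hence the Riesz projection (`HasGroundState.rieszProjection_eq`).
The circle for H̃_n is centred at the ground state energy of H_{n+1}, not of H̃_n; the two energies
differ by at most τ, half the radius. -/

theorem IsResolvent.unique {R R' : E →L[ℂ] E} (h : IsResolvent T z R) (h' : IsResolvent T z R') :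
    R = R' := by
  ext ψ
  obtain ⟨hd, he⟩ := h.1 ψ
  have := h'.2 ⟨R ψ, hd⟩
  rw [he] at this
  exact this.symm

theorem isResolvent_resolventOp (hz : z ∈ resolventSet T) : IsResolvent T z (resolventOp T z) := by
  have h : ∃ R : E →L[ℂ] E, IsResolvent T z R := hz
  rw [resolventOp, dif_pos h]
  exact h.choose_spec

theorem IsResolvent.eq_resolventOp {R : E →L[ℂ] E} (h : IsResolvent T z R) :
    resolventOp T z = R :=
  (isResolvent_resolventOp ⟨R, h⟩).unique h

/-- Since (T - w)B = C, the operator B C⁻¹ is a right inverse of T - w. That B reaches the whole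
domain makes it a left inverse as well, with no separate injectivity argument. -/
theorem isResolvent_of_factor {B C : E →L[ℂ] E} (hC : IsUnit C)
    (h1 : ∀ φ, ∃ h : B φ ∈ T.domain, T ⟨B φ, h⟩ - w • B φ = C φ)
    (h2 : ∀ ψ : T.domain, ∃ φ, B φ = ψ) : IsResolvent T w (B * Ring.inverse C) := by
  have e1 : ∀ φ, C (Ring.inverse C φ) = φ := fun φ =>
    congrArg (fun X : E →L[ℂ] E => X φ) (Ring.mul_inverse_cancel C hC)
  have e2 : ∀ φ, Ring.inverse C (C φ) = φ := fun φ =>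
    congrArg (fun X : E →L[ℂ] E => X φ) (Ring.inverse_mul_cancel C hC)
  refine ⟨fun ψ => ?_, fun ψ => ?_⟩
  · obtain ⟨h, he⟩ := h1 (Ring.inverse C ψ)
    refine ⟨h, ?_⟩
    rw [e1] at he
    exact he
  · obtain ⟨φ, hφ⟩ := h2 ψ
    obtain ⟨h, he⟩ := h1 φ
    have h3 : (⟨B φ, h⟩ : T.domain) = ψ := Subtype.ext hφ
    rw [h3, hφ] at he
    rw [he, mul_apply_eq_comp, e2, hφ]

/-- This is the first resolvent identity (T - w)B = 1 - (w - z)B, which holds on all of E. -/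
theorem IsResolvent.of_isUnit {B : E →L[ℂ] E} (hB : IsResolvent T z B)
    (hu : IsUnit (1 - (w - z) • B)) :
    IsResolvent T w (B * Ring.inverse (1 - (w - z) • B)) := by
  refine isResolvent_of_factor hu (fun φ => ?_) fun ψ => ⟨_, hB.2 ψ⟩
  obtain ⟨h, he⟩ := hB.1 φ
  refine ⟨h, ?_⟩
  simp only [sub_apply, one_apply_eq_self,
    smul_apply]
  conv_rhs => enter [1]; rw [← he]
  module

/-- Near z the resolvent is B (1 - (w - z)B)⁻¹ with a fixed B, and inversion is holomorphic on the
open set of units. -/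
theorem differentiableAt_resolventOp [CompleteSpace E] (hz : z ∈ resolventSet T) :
    DifferentiableAt ℂ (resolventOp T) z := by
  have hB := isResolvent_resolventOp hz
  set B := resolventOp T z
  have hd : DifferentiableAt ℂ (fun w : ℂ => (1 : E →L[ℂ] E) - (w - z) • B) z := by fun_prop
  have h1 : IsUnit ((1 : E →L[ℂ] E) - (z - z) • B) := by simp
  have hev : ∀ᶠ w in nhds z, IsUnit ((1 : E →L[ℂ] E) - (w - z) • B) :=
    hd.continuousAt.eventually_mem (Units.isOpen.mem_nhds h1)
  have hD : DifferentiableAt ℂ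
      (fun w : ℂ => B * Ring.inverse ((1 : E →L[ℂ] E) - (w - z) • B)) z :=
    (differentiableAt_const B).mul (hd.inverse h1)
  refine hD.congr_of_eventuallyEq ?_
  filter_upwards [hev] with w hw
  exact (hB.of_isUnit hw).eq_resolventOp

end Resolvent

/-! ### Semibounded self-adjoint operators -/

section SelfAdjoint

variable {E : Type*} [NormedAddCommGroup E] [InnerProductSpace ℂ E]
  {T : E →ₗ.[ℂ] E} {c : ℝ} {z : ℂ}

/-- A symmetric operator having a real number in its resolvent set; such an operator is
self-adjoint. -/
structure IsSelfAdj (T : E →ₗ.[ℂ] E) : Prop where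
  symm : ∀ ψ φ : T.domain, ⟪T ψ, (φ : E)⟫_ℂ = ⟪(ψ : E), T φ⟫_ℂ
  real_mem : ∃ x : ℝ, (x : ℂ) ∈ resolventSet T

/-- The quadratic form of `T` is bounded below by `c`. -/
def FormGE (T : E →ₗ.[ℂ] E) (c : ℝ) : Prop :=
  ∀ ψ : T.domain, c * ‖(ψ : E)‖ ^ 2 ≤ (⟪(ψ : E), T ψ⟫_ℂ).re

theorem FormGE.norm_le (h : FormGE T c) (z : ℂ) (ψ : T.domain) :
    (c - z.re) * ‖(ψ : E)‖ ≤ ‖T ψ - z • (ψ : E)‖ := by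
  rcases eq_or_ne ‖(ψ : E)‖ 0 with h0 | h0
  · rw [h0, mul_zero]; exact norm_nonneg _
  have h1 := h ψ
  have h2 : (⟪(ψ : E), T ψ - z • (ψ : E)⟫_ℂ).re =
      (⟪(ψ : E), T ψ⟫_ℂ).re - z.re * ‖(ψ : E)‖ ^ 2 := by
    rw [inner_sub_right, inner_smul_right, inner_self_eq_norm_sq_to_K]
    simp [← ofReal_pow]
  have h3 : (⟪(ψ : E), T ψ - z • (ψ : E)⟫_ℂ).re ≤ ‖(ψ : E)‖ * ‖T ψ - z • (ψ : E)‖ :=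
    (re_le_norm _).trans (norm_inner_le_norm _ _)
  have h4 : 0 < ‖(ψ : E)‖ := lt_of_le_of_ne (norm_nonneg _) (Ne.symm h0)
  refine le_of_mul_le_mul_left ?_ h4
  nlinarith

theorem IsResolvent.norm_le {R : E →L[ℂ] E} (hR : IsResolvent T z R) (h : FormGE T c)
    (φ : E) : (c - z.re) * ‖R φ‖ ≤ ‖φ‖ := by
  obtain ⟨hd, he⟩ := hR.1 φ
  have := h.norm_le z ⟨R φ, hd⟩
  rwa [he] at this

/-- The adjoint of (T - z)⁻¹ is the resolvent at the conjugate point: write each vector as T - z or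
T - z̄ applied to its resolvent and use the symmetry of T. -/
theorem IsResolvent.inner_left {z' : ℂ} {R R' : E →L[ℂ] E} (hT : IsSelfAdj T)
    (hR : IsResolvent T z R) (hR' : IsResolvent T z' R')
    (hz : z' = (starRingEnd ℂ) z) (φ ψ : E) :
    ⟪R φ, ψ⟫_ℂ = ⟪φ, R' ψ⟫_ℂ := by
  obtain ⟨hd, he⟩ := hR.1 φ
  obtain ⟨hd', he'⟩ := hR'.1 ψ
  have h := hT.symm ⟨R φ, hd⟩ ⟨R' ψ, hd'⟩
  conv_lhs => rw [← he']
  conv_rhs => rw [← he]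
  rw [inner_sub_left, inner_sub_right, h, inner_smul_left, inner_smul_right, hz]

/-- The sum of an unbounded operator and a bounded one. -/
def perturb (T : E →ₗ.[ℂ] E) (K : E →L[ℂ] E) : E →ₗ.[ℂ] E where
  domain := T.domain
  toFun := T.toFun + K.toLinearMap ∘ₗ T.domain.subtype

theorem perturb_apply (K : E →L[ℂ] E) (ψ : T.domain) :
    perturb T K ψ = T ψ + K ψ := rfl

/-- The rank-one operator `t |χ⟩⟨χ|`. -/
def rankOneOp (t : ℝ) (χ : E) : E →L[ℂ] E := (t : ℂ) • (innerSL ℂ χ).smulRight χ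

theorem rankOneOp_apply (t : ℝ) (χ ψ : E) : rankOneOp t χ ψ = ((t : ℂ) * ⟪χ, ψ⟫_ℂ) • χ := by
  rw [mul_smul]
  rfl

theorem rankOneOp_symm (t : ℝ) (χ φ ψ : E) :
    ⟪rankOneOp t χ φ, ψ⟫_ℂ = ⟪φ, rankOneOp t χ ψ⟫_ℂ := by
  rw [rankOneOp_apply, rankOneOp_apply, inner_smul_left, inner_smul_right, map_mul,
    inner_conj_symm, conj_ofReal]
  ring

theorem inner_rankOneOp_re (t : ℝ) (χ ψ : E) :
    (⟪ψ, rankOneOp t χ ψ⟫_ℂ).re = t * ‖⟪χ, ψ⟫_ℂ‖ ^ 2 := by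
  rw [rankOneOp_apply, inner_smul_right, ← inner_conj_symm ψ χ, mul_assoc, mul_conj,
    normSq_eq_norm_sq, ← ofReal_mul, ofReal_re]

variable [CompleteSpace E]

/-- Boundedness below makes C injective with closed range. The orthogonal complement of the range is
the kernel of the adjoint C', which is trivial. -/
theorem isUnit_of_norm_le {C C' : E →L[ℂ] E} {K : ℝ}
    (hadj : ∀ φ ψ, ⟪C φ, ψ⟫_ℂ = ⟪φ, C' ψ⟫_ℂ) (h : ∀ φ, ‖φ‖ ≤ K * ‖C φ‖)
    (h' : ∀ φ, C' φ = 0 → φ = 0) : IsUnit C := by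
  have hanti : AntilipschitzWith K.toNNReal C :=
    ContinuousLinearMap.antilipschitz_of_bound C fun φ =>
      (h φ).trans (mul_le_mul_of_nonneg_right (Real.le_coe_toNNReal K) (norm_nonneg _))
  have hclosed : IsClosed (LinearMap.range C.toLinearMap : Set E) := by
    have := hanti.isClosed_range C.uniformContinuous
    rwa [show Set.range C = (LinearMap.range C.toLinearMap : Set E) from rfl] at this
  have hrange : LinearMap.range C.toLinearMap = ⊤ := by
    have : CompleteSpace (LinearMap.range C.toLinearMap) := hclosed.completeSpace_coe
    rw [← Submodule.orthogonal_eq_bot_iff, Submodule.eq_bot_iff]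
    intro φ hφ
    apply h'
    have : ∀ ψ, ⟪ψ, C' φ⟫_ℂ = 0 := fun ψ => by
      rw [← hadj]
      exact hφ (C ψ) ⟨ψ, rfl⟩
    exact inner_self_eq_zero.1 (this (C' φ))
  rw [ContinuousLinearMap.isUnit_iff_bijective]
  exact ⟨hanti.injective, LinearMap.range_eq_top.1 hrange⟩

/-- With B = (T - x)⁻¹ for the given real x, invertibility of T - z reduces to that of the bounded
operator 1 - (z - x)B = (T - z)B. Its adjoint is the same expression at z̄, and the form bound
controls both. -/
theorem IsSelfAdj.mem_resolventSet (hT : IsSelfAdj T) (h : FormGE T c) (hz : z.re < c) :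
    z ∈ resolventSet T := by
  obtain ⟨x, B, hB⟩ := hT.real_mem
  have hc : 0 < c - z.re := by linarith
  -- The bound depends on w only through its real part, so one estimate serves both z and z̄.
  have key : ∀ w : ℂ, w.re = z.re → ∀ φ,
      ‖φ‖ ≤ (1 + ‖w - x‖ / (c - z.re)) * ‖((1 : E →L[ℂ] E) - (w - x) • B) φ‖ := by
    intro w hw φ
    obtain ⟨hd, he⟩ := hB.1 φ
    have h1 := h.norm_le w ⟨B φ, hd⟩
    have h2 : T ⟨B φ, hd⟩ - w • B φ = ((1 : E →L[ℂ] E) - (w - x) • B) φ := by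
      simp only [sub_apply, one_apply_eq_self,
        smul_apply]
      conv_rhs => enter [1]; rw [← he]
      module
    rw [h2, hw] at h1
    set X := ((1 : E →L[ℂ] E) - (w - x) • B) φ with hX
    have h3 : φ = X + (w - x) • B φ := by
      simp [hX]
    have h4 : ‖φ‖ ≤ ‖X‖ + ‖w - x‖ * ‖B φ‖ := by
      conv_lhs => rw [h3]
      exact (norm_add_le _ _).trans (by rw [norm_smul])
    have h5 : ‖B φ‖ ≤ ‖X‖ / (c - z.re) := by
      rw [le_div_iff₀ hc]; linarith
    calc ‖φ‖ ≤ ‖X‖ + ‖w - x‖ * (‖X‖ / (c - z.re)) := by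
          linarith [mul_le_mul_of_nonneg_left h5 (norm_nonneg (w - x))]
      _ = _ := by ring
  have hu : IsUnit ((1 : E →L[ℂ] E) - (z - x) • B) := by
    refine isUnit_of_norm_le (C' := (1 : E →L[ℂ] E) - ((starRingEnd ℂ) z - x) • B) (fun φ ψ => ?_)
      (key z rfl) fun φ hφ => ?_
    · simp only [sub_apply, one_apply_eq_self,
        smul_apply, inner_sub_left, inner_sub_right, inner_smul_left,
        inner_smul_right]
      rw [hB.inner_left hT hB (by simp)]
      simp
    · have := key ((starRingEnd ℂ) z) (by simp) φ
      rw [hφ, norm_zero, mul_zero] at this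
      exact norm_le_zero_iff.1 this
  exact ⟨_, hB.of_isUnit hu⟩

theorem IsSelfAdj.perturb (hT : IsSelfAdj T) (h : FormGE T c) {K : E →L[ℂ] E}
    (hK : ∀ φ ψ, ⟪K φ, ψ⟫_ℂ = ⟪φ, K ψ⟫_ℂ) : IsSelfAdj (perturb T K) := by
  refine ⟨fun ψ φ => ?_, ?_⟩
  · change ⟪T ψ + K ψ, (φ : E)⟫_ℂ = ⟪(ψ : E), T φ + K φ⟫_ℂ
    rw [inner_add_left, inner_add_right, hK]
    exact congrArg (· + _) (hT.symm ψ φ)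
  -- At distance ‖K‖ + 1 below the form bound the resolvent R has norm at most 1/(‖K‖ + 1), so ‖KR‖
  -- < 1 and a Neumann series inverts (T + K - x)R = 1 + KR.
  · set x : ℝ := c - (‖K‖ + 1) with hx
    have hxc : ((x : ℂ)).re < c := by
      have := norm_nonneg K
      simp only [ofReal_re, hx]; linarith
    obtain ⟨R, hR⟩ := hT.mem_resolventSet h hxc
    have hn : ‖-(K * R)‖ < 1 := by
      rw [norm_neg]
      have hb : ‖K * R‖ ≤ ‖K‖ / (‖K‖ + 1) := by
        refine ContinuousLinearMap.opNorm_le_bound _ (by positivity) fun φ => ?_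
        have h1 := hR.norm_le h φ
        have h2 : c - ((x : ℂ)).re = ‖K‖ + 1 := by simp [hx]
        rw [h2] at h1
        have h3 : ‖R φ‖ ≤ ‖φ‖ / (‖K‖ + 1) := by
          rw [le_div_iff₀ (by positivity)]; linarith
        calc ‖K (R φ)‖ ≤ ‖K‖ * ‖R φ‖ := K.le_opNorm _
          _ ≤ ‖K‖ * (‖φ‖ / (‖K‖ + 1)) := by gcongr
          _ = _ := by ring
      refine hb.trans_lt ?_
      rw [div_lt_one (by positivity)]
      linarith
    refine ⟨x, _, isResolvent_of_factor (B := R) (isUnit_one_sub_of_norm_lt_one hn)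
      (fun φ => ?_) fun ψ => ⟨_, hR.2 ψ⟩⟩
    obtain ⟨hd, he⟩ := hR.1 φ
    refine ⟨hd, ?_⟩
    rw [show SpinBoson.perturb T K ⟨R φ, hd⟩ = T ⟨R φ, hd⟩ + K (R φ) from rfl]
    simp only [sub_neg_eq_add, add_apply, one_apply_eq_self,
      mul_apply_eq_comp]
    conv_rhs => enter [1]; rw [← he]
    module

end SelfAdjoint

end SpinBoson
end

open MeasureTheory Complex
open scoped ENNReal InnerProductSpace
noncomputable section
namespace SpinBoson

/-! ### Isolated ground states, rank-one perturbations and Riesz projections -/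

section GroundState

variable {E : Type*} [NormedAddCommGroup E] [InnerProductSpace ℂ E]
  {T : E →ₗ.[ℂ] E} {c : ℝ} {z : ℂ}

/-- `T` has the simple isolated lowest eigenvalue `e` with normalized eigenvector `φ`, and the rest
of its spectrum lies above `e + δ`. -/
structure HasGroundState (T : E →ₗ.[ℂ] E) (e δ : ℝ) (φ : T.domain) : Prop where
  norm_eq : ‖(φ : E)‖ = 1
  eigen : T φ = (e : ℂ) • (φ : E)
  gap : ∀ ψ : T.domain, e * ‖(ψ : E)‖ ^ 2 + δ * (‖(ψ : E)‖ ^ 2 - ‖⟪(φ : E), ψ⟫_ℂ‖ ^ 2) ≤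
    (⟪(ψ : E), T ψ⟫_ℂ).re

theorem HasGroundState.formGE {e δ : ℝ} {φ : T.domain} (h : HasGroundState T e δ φ)
    (hδ : 0 ≤ δ) : FormGE T e := by
  intro ψ
  have h1 := h.gap ψ
  have h2 : ‖⟪(φ : E), (ψ : E)⟫_ℂ‖ ≤ ‖(ψ : E)‖ := by
    have := norm_inner_le_norm (𝕜 := ℂ) (φ : E) (ψ : E)
    rwa [h.norm_eq, one_mul] at this
  have h3 := pow_le_pow_left₀ (norm_nonneg _) h2 2
  nlinarith

/-- The rank-one term δ|φ⟩⟨φ| lifts the only spectrum below e + δ. -/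
theorem HasGroundState.formGE_perturb {e δ : ℝ} {φ : T.domain} (h : HasGroundState T e δ φ) :
    FormGE (perturb T (rankOneOp δ (φ : E))) (e + δ) := by
  intro ψ
  change _ ≤ (⟪(ψ : E), T ψ + rankOneOp δ (φ : E) ψ⟫_ℂ).re
  rw [inner_add_right, add_re, inner_rankOneOp_re]
  have := h.gap ψ
  linarith

theorem HasGroundState.isRankOneProjection {e δ : ℝ} {φ : T.domain} (h : HasGroundState T e δ φ) :
    IsRankOneProjection (rankOneOp 1 (φ : E)) :=
  ⟨φ, h.norm_eq, fun ψ => by rw [rankOneOp_apply, ofReal_one, one_mul]⟩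

/-- If `S` is a unitary symmetry of `T` anticommuting with `B`, the ground state has vanishing
expectation of `B`. -/
theorem HasGroundState.projection_comp_eq_zero {e δ : ℝ} {φ : T.domain}
    (h : HasGroundState T e δ φ) (hδ : 0 < δ) {S : E →ₗ[ℂ] E} (hS : CommutesWith S T)
    (hSinner : ∀ ψ η, ⟪S ψ, S η⟫_ℂ = ⟪ψ, η⟫_ℂ) {B : E →L[ℂ] E} (hB : ∀ ψ, S (B ψ) = -B (S ψ)) :
    rankOneOp 1 (φ : E) ∘L B ∘L rankOneOp 1 (φ : E) = 0 := by
  have hφφ : ⟪(φ : E), (φ : E)⟫_ℂ = 1 := by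
    rw [inner_self_eq_norm_sq_to_K, h.norm_eq]; simp
  have hnS : ‖S (φ : E)‖ = 1 := by
    have h1 := hSinner (φ : E) φ
    rw [hφφ, inner_self_eq_norm_sq_to_K] at h1
    have h2 : ‖S (φ : E)‖ ^ 2 = 1 := by
      rw [← RCLike.ofReal_pow] at h1
      exact RCLike.ofReal_injective (K := ℂ) (h1.trans RCLike.ofReal_one.symm)
    nlinarith [norm_nonneg (S (φ : E))]
  obtain ⟨hd, he⟩ := hS φ
  have h1 := h.gap ⟨_, hd⟩
  rw [he, h.eigen, map_smul, inner_smul_right, hSinner, hφφ, hnS] at h1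
  set a := ⟪(φ : E), S (φ : E)⟫_ℂ with ha
  -- The vector Sφ is again a unit vector of energy e, so the gap inequality leaves no room for a
  -- component orthogonal to φ.
  have h2 : 1 ≤ ‖a‖ ^ 2 := by
    simp only [mul_one, ofReal_re] at h1
    nlinarith
  have h3 : S (φ : E) = a • (φ : E) := by
    have h4 : ‖S (φ : E) - a • (φ : E)‖ ^ 2 = 1 - ‖a‖ ^ 2 := by
      rw [← norm_neg, neg_sub, @norm_sub_sq ℂ, inner_smul_left, ← ha, norm_smul, h.norm_eq, hnS,
        mul_comm _ a, mul_conj, normSq_eq_norm_sq]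
      have h5 : RCLike.re ((‖a‖ ^ 2 : ℝ) : ℂ) = ‖a‖ ^ 2 := ofReal_re _
      rw [h5]
      ring
    have h5 : ‖S (φ : E) - a • (φ : E)‖ = 0 := by
      have := sq_nonneg ‖S (φ : E) - a • (φ : E)‖
      have h6 : ‖S (φ : E) - a • (φ : E)‖ ^ 2 = 0 := by linarith
      exact pow_eq_zero_iff two_ne_zero |>.1 h6
    exact sub_eq_zero.1 (norm_eq_zero.1 h5)
  -- Unitarity and anticommutation give ⟨φ, Bφ⟩ = ⟨Sφ, SBφ⟩ = -|a|²⟨φ, Bφ⟩, and 1 + |a|² is not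
  -- zero.
  have h4 : ⟪(φ : E), B φ⟫_ℂ = 0 := by
    have h5 := hSinner (φ : E) (B φ)
    rw [hB, h3, map_smul, inner_neg_right, inner_smul_left, inner_smul_right] at h5
    have h6 : (starRingEnd ℂ) a * a = ((‖a‖ ^ 2 : ℝ) : ℂ) := by
      rw [mul_comm, mul_conj, normSq_eq_norm_sq]
    rw [← mul_assoc, h6] at h5
    have h7 : ((1 + ‖a‖ ^ 2 : ℝ) : ℂ) * ⟪(φ : E), B φ⟫_ℂ = 0 := by
      rw [ofReal_add, add_mul, ofReal_one, one_mul]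
      nth_rewrite 1 [← h5]
      ring
    refine (mul_eq_zero.1 h7).resolve_left ?_
    exact_mod_cast (by positivity : (1 + ‖a‖ ^ 2 : ℝ) ≠ 0)
  ext ψ
  simp only [ContinuousLinearMap.comp_apply, rankOneOp_apply, map_smul, h4,
    mul_zero, smul_zero, zero_smul, zero_apply]

theorem norm_sq_add_of_orthogonal {φ η : E} (h : ⟪φ, η⟫_ℂ = 0) (a b : ℂ) :
    ‖a • φ + b • η‖ ^ 2 = ‖a‖ ^ 2 * ‖φ‖ ^ 2 + ‖b‖ ^ 2 * ‖η‖ ^ 2 := by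
  have : ⟪a • φ, b • η⟫_ℂ = 0 := by rw [inner_smul_left, inner_smul_right, h]; simp
  rw [sq, norm_add_sq_eq_norm_sq_add_norm_sq_of_inner_eq_zero _ _ this, norm_smul, norm_smul]
  ring

theorem inner_eigen_add (hT : IsSelfAdj T) {e : ℝ} {φ η : T.domain}
    (hφ : T φ = (e : ℂ) • (φ : E)) (h : ⟪(φ : E), η⟫_ℂ = 0) (a b : ℂ) :
    (⟪((a • φ + b • η : T.domain) : E), T (a • φ + b • η)⟫_ℂ).re =
      ‖a‖ ^ 2 * (e * ‖(φ : E)‖ ^ 2) + ‖b‖ ^ 2 * (⟪(η : E), T η⟫_ℂ).re := by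
  have h1 : ⟪(φ : E), T η⟫_ℂ = 0 := by
    rw [← hT.symm, hφ, inner_smul_left, h, mul_zero]
  have h2 : ⟪(η : E), (φ : E)⟫_ℂ = 0 := by rw [← inner_conj_symm, h, map_zero]
  rw [T.map_add, T.map_smul, T.map_smul, hφ, Submodule.coe_add, Submodule.coe_smul,
    Submodule.coe_smul]
  simp only [inner_add_left, inner_add_right, inner_smul_left, inner_smul_right, h1, h2,
    inner_self_eq_norm_sq_to_K, mul_zero, add_zero, zero_add]
  have h3 : ∀ x : ℂ, (‖x‖ : ℂ) ^ 2 = x * (starRingEnd ℂ) x := fun x => by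
    rw [mul_conj, normSq_eq_norm_sq, ofReal_pow]
  trans (((‖a‖ ^ 2 * (e * ‖(φ : E)‖ ^ 2) : ℝ) : ℂ) +
    ((‖b‖ ^ 2 : ℝ) : ℂ) * ⟪(η : E), T η⟫_ℂ).re
  · congr 1
    push_cast
    rw [h3, h3]
    simp only [coe_algebraMap]
    ring
  · rw [add_re, ofReal_re, re_ofReal_mul]

/-- The form of T - e is nonnegative at ψ - t m v, where m = ⟨χ, ψ⟩ and v solves (T - e)v = χ;
expanding the square gives the claim. It bounds ⟨χ, v⟩ from below in terms of a trial vector ψ. -/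
theorem inner_solution_le (hT : IsSelfAdj T) {e t : ℝ} (h : FormGE T e) {v : T.domain} {χ : E}
    (hv : T v - (e : ℂ) • (v : E) = χ) (ψ : T.domain) :
    t * ‖⟪χ, (ψ : E)⟫_ℂ‖ ^ 2 * (2 - t * (⟪χ, (v : E)⟫_ℂ).re) ≤
      (⟪(ψ : E), T ψ⟫_ℂ).re - e * ‖(ψ : E)‖ ^ 2 := by
  set m := ⟪χ, (ψ : E)⟫_ℂ with hm
  have shift : ∀ y : T.domain, (⟪(y : E), T y - (e : ℂ) • (y : E)⟫_ℂ).re =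
      (⟪(y : E), T y⟫_ℂ).re - e * ‖(y : E)‖ ^ 2 := fun y => by
    rw [inner_sub_right, inner_smul_right, inner_self_eq_norm_sq_to_K]
    simp [← ofReal_pow]
  have hvψ : ⟪(v : E), T ψ - (e : ℂ) • (ψ : E)⟫_ℂ = m := by
    rw [hm, ← hv, inner_sub_right, inner_sub_left, inner_smul_right, inner_smul_left,
      conj_ofReal, hT.symm]
  have hψχ : ⟪(ψ : E), χ⟫_ℂ = (starRingEnd ℂ) m := by rw [hm, inner_conj_symm]
  have hy := h (ψ - ((t : ℂ) * m) • v)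
  have h1 : T (ψ - ((t : ℂ) * m) • v) - (e : ℂ) • ((ψ - ((t : ℂ) * m) • v : T.domain) : E) =
      (T ψ - (e : ℂ) • (ψ : E)) - ((t : ℂ) * m) • χ := by
    rw [T.map_sub, T.map_smul, ← hv, Submodule.coe_sub, Submodule.coe_smul]
    module
  have h2 := shift (ψ - ((t : ℂ) * m) • v)
  have h3 : m * (starRingEnd ℂ) m = ((‖m‖ ^ 2 : ℝ) : ℂ) := by rw [mul_conj, normSq_eq_norm_sq]
  rw [h1, Submodule.coe_sub, Submodule.coe_smul, inner_sub_left, inner_sub_right _ _ (_ • χ),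
    inner_sub_right _ _ (_ • χ), inner_smul_left, inner_smul_left, inner_smul_right,
    inner_smul_right, hvψ, hψχ, map_mul, conj_ofReal,
    show (t : ℂ) * m * (starRingEnd ℂ) m = ((t * ‖m‖ ^ 2 : ℝ) : ℂ) by
      rw [mul_assoc, h3, ofReal_mul],
    show (t : ℂ) * (starRingEnd ℂ) m * m = ((t * ‖m‖ ^ 2 : ℝ) : ℂ) by
      rw [mul_assoc, mul_comm _ m, h3, ofReal_mul],
    show (t : ℂ) * (starRingEnd ℂ) m * ((t : ℂ) * m * ⟪(v : E), χ⟫_ℂ) =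
      ((t * (t * ‖m‖ ^ 2) : ℝ) : ℂ) * ⟪(v : E), χ⟫_ℂ by
      rw [ofReal_mul t, ofReal_mul t, ← h3]; ring] at h2
  simp only [sub_re, ofReal_re, re_ofReal_mul] at h2
  rw [shift ψ, ← inner_conj_symm (v : E) χ, conj_re] at h2
  rw [Submodule.coe_sub, Submodule.coe_smul] at hy
  nlinarith

variable [CompleteSpace E]

/-- A Birman–Schwinger argument. With T' = T + t|χ⟩⟨χ| ≥ c, a real e < c is an eigenvalue of T with
eigenvector v = (T' - e)⁻¹χ as soon as t⟨χ, (T' - e)⁻¹χ⟩ = 1. The intermediate value theorem yields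
such an e ≤ e₀. -/
theorem exists_hasGroundState (hT : IsSelfAdj T) {χ : E} {t e₀ : ℝ} (ht : 0 < t)
    (hform : ∀ ψ : T.domain,
      c * ‖(ψ : E)‖ ^ 2 ≤ (⟪(ψ : E), T ψ⟫_ℂ).re + t * ‖⟪χ, (ψ : E)⟫_ℂ‖ ^ 2)
    (χ₀ : T.domain) (hχ₀ : (χ₀ : E) ≠ 0)
    (he₀ : (⟪(χ₀ : E), T χ₀⟫_ℂ).re ≤ e₀ * ‖(χ₀ : E)‖ ^ 2) (hc : e₀ < c) :
    ∃ e ≤ e₀, ∃ φ : T.domain, HasGroundState T e (c - e) φ := by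
  -- A crude bound on T itself, from Cauchy–Schwarz on the rank-one term; it makes the perturbation
  -- theorem for self-adjointness applicable.
  have hlow : FormGE T (c - t * ‖χ‖ ^ 2) := by
    intro ψ
    have h1 := hform ψ
    have h2 : ‖⟪χ, (ψ : E)⟫_ℂ‖ ^ 2 ≤ (‖χ‖ * ‖(ψ : E)‖) ^ 2 :=
      pow_le_pow_left₀ (norm_nonneg _) (norm_inner_le_norm _ _) 2
    have h3 := mul_le_mul_of_nonneg_left h2 ht.le
    nlinarith
  set T' := perturb T (rankOneOp t χ) with hT'def
  have hT' : IsSelfAdj T' := hT.perturb hlow (rankOneOp_symm t χ)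
  have hform' : FormGE T' c := by
    intro ψ
    change _ ≤ (⟪(ψ : E), T ψ + rankOneOp t χ ψ⟫_ℂ).re
    rw [inner_add_right, add_re, inner_rankOneOp_re]
    exact hform ψ
  have hmem : ∀ x : ℝ, x < c → (x : ℂ) ∈ resolventSet T' := fun x hx =>
    hT'.mem_resolventSet hform' (by simpa using hx)
  have hres : ∀ x : ℝ, x < c → IsResolvent T' x (resolventOp T' x) := fun x hx =>
    isResolvent_resolventOp (hmem x hx)
  have hreal : ∀ x : ℝ, x < c → (⟪χ, resolventOp T' x χ⟫_ℂ : ℂ) =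
      ((⟪χ, resolventOp T' x χ⟫_ℂ).re : ℂ) := by
    intro x hx
    have h := (hres x hx).inner_left hT' (hres x hx) (by simp) χ χ
    rw [← inner_conj_symm] at h
    exact (conj_eq_iff_re.1 h).symm
  set F : ℝ → ℝ := fun x => t * (⟪χ, resolventOp T' x χ⟫_ℂ).re with hF
  have hcont : ContinuousOn F (Set.Icc (e₀ - t * ‖χ‖ ^ 2) e₀) := by
    intro x hx
    have h1 : ContinuousAt (resolventOp T') (x : ℂ) :=
      (differentiableAt_resolventOp (hmem x (hx.2.trans_lt hc))).continuousAt
    have h2 : ContinuousAt (fun y : ℝ => resolventOp T' (y : ℂ)) x :=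
      ContinuousAt.comp (f := fun y : ℝ => (y : ℂ)) h1 continuous_ofReal.continuousAt
    have h3 : ContinuousAt (fun y : ℝ => resolventOp T' (y : ℂ) χ) x :=
      h2.clm_apply continuousAt_const
    have h4 : ContinuousAt (fun y : ℝ => ⟪χ, resolventOp T' (y : ℂ) χ⟫_ℂ) x :=
      ContinuousAt.inner (𝕜 := ℂ) continuousAt_const h3
    exact (continuousAt_const.mul (continuous_re.continuousAt.comp h4)).continuousWithinAt
  -- The left end point is chosen so that its distance to c is at least t‖χ‖², whence the resolvent
  -- bound gives F ≤ 1.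
  have hlo : F (e₀ - t * ‖χ‖ ^ 2) ≤ 1 := by
    set x := e₀ - t * ‖χ‖ ^ 2 with hx
    have hpos : 0 ≤ t * ‖χ‖ ^ 2 := by positivity
    have hxc : x < c := by linarith
    have h1 := (hres x hxc).norm_le hform' χ
    rw [ofReal_re] at h1
    have h2 : (⟪χ, resolventOp T' x χ⟫_ℂ).re ≤ ‖χ‖ * ‖resolventOp T' x χ‖ :=
      (re_le_norm _).trans (norm_inner_le_norm _ _)
    have h3 : F x ≤ t * ‖χ‖ * ‖resolventOp T' x χ‖ := by
      rw [hF, mul_assoc]; exact mul_le_mul_of_nonneg_left h2 ht.le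
    refine h3.trans ?_
    rcases eq_or_ne ‖χ‖ 0 with h0 | h0
    · rw [h0]; simp
    · have h4 : 0 < ‖χ‖ := lt_of_le_of_ne (norm_nonneg _) (Ne.symm h0)
      have h5 : t * ‖χ‖ ^ 2 * ‖resolventOp T' x χ‖ ≤ ‖χ‖ :=
        (mul_le_mul_of_nonneg_right (by linarith) (norm_nonneg _)).trans h1
      refine le_of_mul_le_mul_left ?_ h4
      nlinarith
  -- Otherwise `inner_solution_le` at the trial vector would give t|⟨χ, χ₀⟩|²(2 - F) ≤ t|⟨χ, χ₀⟩|²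
  -- with F < 1, and t|⟨χ, χ₀⟩|² > 0 because e₀ < c.
  have hhi : 1 ≤ F e₀ := by
    by_contra! hlt
    obtain ⟨hd, hv⟩ := (hres e₀ hc).1 χ
    have h1 := inner_solution_le (t := t) hT' (fun ψ => (mul_le_mul_of_nonneg_right hc.le
      (sq_nonneg _)).trans (hform' ψ)) (v := ⟨_, hd⟩) hv χ₀
    have h2 : (⟪(χ₀ : E), T' χ₀⟫_ℂ).re = (⟪(χ₀ : E), T χ₀⟫_ℂ).re + t * ‖⟪χ, (χ₀ : E)⟫_ℂ‖ ^ 2 := by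
      change (⟪(χ₀ : E), T χ₀ + rankOneOp t χ χ₀⟫_ℂ).re = _
      rw [inner_add_right, add_re, inner_rankOneOp_re]
    have h3 := hform χ₀
    have h4 : 0 < ‖(χ₀ : E)‖ ^ 2 := by positivity
    rw [h2] at h1
    change t * ‖⟪χ, (χ₀ : E)⟫_ℂ‖ ^ 2 * (2 - F e₀) ≤ _ at h1
    have h5 : 0 < (c - e₀) * ‖(χ₀ : E)‖ ^ 2 := mul_pos (by linarith) h4
    have h6 : 0 < t * ‖⟪χ, (χ₀ : E)⟫_ℂ‖ ^ 2 := by linarith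
    nlinarith
  obtain ⟨e, he, hFe⟩ := intermediate_value_Icc
    (by have : 0 ≤ t * ‖χ‖ ^ 2 := by positivity
        linarith) hcont ⟨hlo, hhi⟩
  have hec : e < c := he.2.trans_lt hc
  obtain ⟨hd, hv⟩ := (hres e hec).1 χ
  set v : T.domain := ⟨resolventOp T' e χ, hd⟩ with hvdef
  have hχv : (t : ℂ) * ⟪χ, (v : E)⟫_ℂ = 1 := by
    change (t : ℂ) * ⟪χ, resolventOp T' e χ⟫_ℂ = 1
    rw [hreal e hec, ← ofReal_mul]
    exact_mod_cast hFe
  have hTv : T v = (e : ℂ) • (v : E) := by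
    have h1 : T v + rankOneOp t χ v - (e : ℂ) • (v : E) = χ := hv
    rw [rankOneOp_apply, hχv, one_smul] at h1
    have h2 : T v - (e : ℂ) • (v : E) = 0 := by
      rw [← sub_eq_zero] at h1
      rw [← h1]; abel
    exact sub_eq_zero.1 h2
  have hv0 : (v : E) ≠ 0 := by
    intro h
    rw [h, inner_zero_right, mul_zero] at hχv
    exact zero_ne_one hχv
  have hvn : ‖(v : E)‖ ≠ 0 := norm_ne_zero_iff.2 hv0
  obtain ⟨φ, hφn, hφe, hβ⟩ : ∃ φ : T.domain, ‖(φ : E)‖ = 1 ∧ T φ = (e : ℂ) • (φ : E) ∧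
      ⟪χ, (φ : E)⟫_ℂ ≠ 0 := by
    refine ⟨((‖(v : E)‖⁻¹ : ℝ) : ℂ) • v, ?_, ?_, ?_⟩
    · rw [Submodule.coe_smul, norm_smul, norm_real, norm_inv, norm_norm, inv_mul_cancel₀ hvn]
    · rw [T.map_smul, hTv, Submodule.coe_smul, smul_comm]
    · rw [Submodule.coe_smul, inner_smul_right]
      refine mul_ne_zero (by simpa using hv0) fun h => ?_
      rw [h, mul_zero] at hχv
      exact zero_ne_one hχv
  -- The combination -αφ + βη is orthogonal to χ, so the rank-one term drops out of the hypothesis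
  -- there. The φ-part has energy e < c, hence the η-part must have energy at least c.
  have horth : ∀ η : T.domain, ⟪(φ : E), η⟫_ℂ = 0 → c * ‖(η : E)‖ ^ 2 ≤ (⟪(η : E), T η⟫_ℂ).re := by
    intro η hη
    set α := ⟪χ, (η : E)⟫_ℂ with hα
    set β := ⟪χ, (φ : E)⟫_ℂ with hβdef
    have h1 := hform ((-α) • φ + β • η)
    rw [inner_eigen_add hT hφe hη, Submodule.coe_add, Submodule.coe_smul, Submodule.coe_smul,
      norm_sq_add_of_orthogonal hη, inner_add_right, inner_smul_right, inner_smul_right, ← hα,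
      ← hβdef, hφn, neg_mul, mul_comm β α, neg_add_cancel, norm_zero, norm_neg] at h1
    have hβ2 : 0 < ‖β‖ ^ 2 := by positivity
    refine le_of_mul_le_mul_left ?_ hβ2
    have := mul_nonneg (sq_nonneg ‖α‖) (sub_nonneg.2 hec.le)
    nlinarith
  refine ⟨e, he.2, φ, hφn, hφe, fun ψ => ?_⟩
  set a := ⟪(φ : E), (ψ : E)⟫_ℂ with ha
  have hη : ⟪(φ : E), ((ψ - a • φ : T.domain) : E)⟫_ℂ = 0 := by
    rw [Submodule.coe_sub, Submodule.coe_smul, inner_sub_right, inner_smul_right,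
      inner_self_eq_norm_sq_to_K, hφn, ← ha]
    simp
  have hψ : ψ = a • φ + (1 : ℂ) • (ψ - a • φ) := by rw [one_smul]; abel
  have h1 := inner_eigen_add hT hφe hη a 1
  have h2 := norm_sq_add_of_orthogonal hη a 1
  rw [← Submodule.coe_smul, ← Submodule.coe_smul, ← Submodule.coe_add] at h2
  rw [← hψ] at h1 h2
  have h3 := horth _ hη
  rw [h1, h2, hφn]
  simp only [norm_one]
  nlinarith


/-- T and T' = T + δ|φ⟩⟨φ| agree on the orthogonal complement of φ, while on φ their eigenvalues are
e and e + δ. So the resolvents differ by the difference of two scalar resolvents times the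
projection. -/
theorem HasGroundState.resolvent_eq (hT : IsSelfAdj T) {e δ : ℝ} {φ : T.domain}
    (h : HasGroundState T e δ φ) (hδ : 0 < δ) (hz : z.re < e + δ) (hze : z ≠ e) :
    z ∈ resolventSet T ∧ z ∈ resolventSet (perturb T (rankOneOp δ (φ : E))) ∧
    resolventOp T z = resolventOp (perturb T (rankOneOp δ (φ : E))) z +
      ((e - z)⁻¹ - (e + δ - z)⁻¹) • rankOneOp 1 (φ : E) := by
  have hφφ : ⟪(φ : E), (φ : E)⟫_ℂ = 1 := by
    rw [inner_self_eq_norm_sq_to_K, h.norm_eq]; simp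
  have hlow := h.formGE hδ.le
  set T' := perturb T (rankOneOp δ (φ : E)) with hT'def
  have hT' : IsSelfAdj T' := hT.perturb hlow (rankOneOp_symm δ _)
  have hform' : FormGE T' (e + δ) := h.formGE_perturb
  have hz' : z ∈ resolventSet T' := hT'.mem_resolventSet hform' hz
  have hcz' : (starRingEnd ℂ) z ∈ resolventSet T' :=
    hT'.mem_resolventSet hform' (by simpa using hz)
  have hR := isResolvent_resolventOp hz'
  have hR' := isResolvent_resolventOp hcz'
  have hne : (e + δ - z : ℂ) ≠ 0 := fun h0 => by
    have := congrArg re h0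
    simp at this
    linarith
  have hne' : (e - z : ℂ) ≠ 0 := fun h0 => hze (sub_eq_zero.1 h0).symm
  have hφR : ∀ ψ : E, ⟪(φ : E), resolventOp T' z ψ⟫_ℂ = (e + δ - z)⁻¹ * ⟪(φ : E), ψ⟫_ℂ := by
    intro ψ
    obtain ⟨hd, he⟩ := hR.1 ψ
    have h1 : ⟪(φ : E), ψ⟫_ℂ = (e + δ - z) * ⟪(φ : E), resolventOp T' z ψ⟫_ℂ := by
      conv_lhs => rw [← he]
      rw [inner_sub_right, inner_smul_right]
      have h2 := hT'.symm φ ⟨_, hd⟩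
      rw [← h2, show T' φ = (e : ℂ) • (φ : E) + rankOneOp δ (φ : E) φ by
        rw [← h.eigen]; rfl, rankOneOp_apply, hφφ, mul_one, ← add_smul, inner_smul_left,
        map_add, conj_ofReal, conj_ofReal]
      ring
    rw [h1, inv_mul_cancel_left₀ hne]
  set k : ℂ := (e - z)⁻¹ - (e + δ - z)⁻¹ with hk
  have hkey : ∀ ψ, ∃ hd : (resolventOp T' z + k • rankOneOp 1 (φ : E)) ψ ∈ T.domain,
      T ⟨_, hd⟩ - z • (resolventOp T' z + k • rankOneOp 1 (φ : E)) ψ = ψ := by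
    intro ψ
    obtain ⟨hd, he⟩ := hR.1 ψ
    have hval : (resolventOp T' z + k • rankOneOp 1 (φ : E)) ψ =
        ((⟨_, hd⟩ + (k * ⟪(φ : E), ψ⟫_ℂ) • φ : T.domain) : E) := by
      rw [Submodule.coe_add, Submodule.coe_smul, add_apply, smul_apply, rankOneOp_apply, ofReal_one,
        one_mul, smul_smul]
    have hmem : (resolventOp T' z + k • rankOneOp 1 (φ : E)) ψ ∈ T.domain := by
      rw [hval]; exact Subtype.mem _
    refine ⟨hmem, ?_⟩
    have h0 : (⟨_, hmem⟩ : T.domain) = ⟨_, hd⟩ + (k * ⟪(φ : E), ψ⟫_ℂ) • φ := Subtype.ext hval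
    rw [h0, hval, T.map_add, T.map_smul, h.eigen, Submodule.coe_add, Submodule.coe_smul]
    have h1 : T ⟨_, hd⟩ + rankOneOp δ (φ : E) (resolventOp T' z ψ) - z • resolventOp T' z ψ = ψ := he
    rw [rankOneOp_apply, hφR] at h1
    have h2 : k * (e - z) = δ * (e + δ - z)⁻¹ := by
      rw [hk]; field_simp; ring
    have h3 : T ⟨_, hd⟩ + (k * ⟪(φ : E), ψ⟫_ℂ) • (e : ℂ) • (φ : E) -
        z • (resolventOp T' z ψ + (k * ⟪(φ : E), ψ⟫_ℂ) • (φ : E)) =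
        T ⟨_, hd⟩ + ((k * (e - z)) * ⟪(φ : E), ψ⟫_ℂ) • (φ : E) - z • resolventOp T' z ψ := by
      module
    rw [h2] at h3
    rw [h3]
    conv_rhs => rw [← h1]
    rw [mul_assoc]
  -- A vector in the kernel of T - z is orthogonal to φ since z ≠ e. The perturbation does not see
  -- it, so it lies in the kernel of the injective operator T' - z.
  have hinj : ∀ η : T.domain, T η - z • (η : E) = 0 → (η : E) = 0 := by
    intro η hη
    have h1 : T η = z • (η : E) := sub_eq_zero.1 hη
    have h2 := hT.symm φ η
    rw [h.eigen, h1, inner_smul_left, inner_smul_right, conj_ofReal] at h2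
    have h3 : ⟪(φ : E), (η : E)⟫_ℂ = 0 := by
      have : (e - z : ℂ) * ⟪(φ : E), (η : E)⟫_ℂ = 0 := by rw [sub_mul, h2, sub_self]
      exact (mul_eq_zero.1 this).resolve_left hne'
    have h4 : T' η - z • (η : E) = 0 := by
      change T η + rankOneOp δ (φ : E) η - z • (η : E) = 0
      rw [rankOneOp_apply, h3, h1]; simp
    have h5 := hR.2 η
    rw [h4, map_zero] at h5
    exact h5.symm
  have hres : IsResolvent T z (resolventOp T' z + k • rankOneOp 1 (φ : E)) := by
    refine ⟨hkey, fun ψ => ?_⟩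
    obtain ⟨hd, he⟩ := hkey (T ψ - z • (ψ : E))
    have h1 := hinj (⟨_, hd⟩ - ψ) (by
      rw [T.map_sub, Submodule.coe_sub, smul_sub, sub_sub_sub_comm, he, sub_self])
    rw [Submodule.coe_sub] at h1
    exact sub_eq_zero.1 h1
  exact ⟨⟨_, hres⟩, hz', hres.eq_resolventOp⟩

/-- The eigenvalue e is in the spectrum, and `HasGroundState.resolvent_eq` puts every real number
below it into the resolvent set. -/
theorem HasGroundState.spectralInf_eq (hT : IsSelfAdj T) {e δ : ℝ} {φ : T.domain}
    (h : HasGroundState T e δ φ) (hδ : 0 < δ) : spectralInf T = e := by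
  refine IsLeast.csInf_eq ⟨fun hmem => ?_, fun x hx => ?_⟩
  · have h1 := (isResolvent_resolventOp hmem).2 φ
    rw [h.eigen, sub_self, map_zero] at h1
    have := h.norm_eq
    rw [← h1, norm_zero] at this
    exact zero_ne_one this
  · by_contra! hlt
    refine hx (h.resolvent_eq hT hδ (z := (x : ℂ)) ?_ ?_).1
    · rw [ofReal_re]; linarith
    · exact fun h0 => hlt.ne (ofReal_injective h0)

/-- Since T' ≥ e + δ, both (T' - z)⁻¹ and (e + δ - z)⁻¹ are holomorphic on the closed disc and
integrate to zero. What remains of the resolvent is -(z - e)⁻¹|φ⟩⟨φ|, whose pole lies inside the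
circle. The centre c₀ need not be e; this is needed for H̃_n. -/
theorem HasGroundState.rieszProjection_eq (hT : IsSelfAdj T) {e δ c₀ r : ℝ} {φ : T.domain}
    (h : HasGroundState T e δ φ) (hr : |e - c₀| < r) (hδ : c₀ + r < e + δ) :
    Metric.sphere (c₀ : ℂ) r ⊆ resolventSet T ∧
      rieszProjection T c₀ r = rankOneOp 1 (φ : E) := by
  have hr0 : 0 < r := (abs_nonneg _).trans_lt hr
  have hδ0 : 0 < δ := by linarith [(abs_lt.1 hr).2]
  have hball : ∀ z ∈ Metric.closedBall (c₀ : ℂ) r, z.re < e + δ := by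
    intro z hz
    have h1 : |(z - c₀).re| ≤ r :=
      (abs_re_le_norm _).trans (by rwa [Metric.mem_closedBall, dist_eq] at hz)
    rw [sub_re, ofReal_re] at h1
    linarith [(abs_le.1 h1).2]
  have hebal : (e : ℂ) ∈ Metric.ball (c₀ : ℂ) r := by
    rw [Metric.mem_ball, dist_eq, ← ofReal_sub, norm_real]; exact hr
  have hsph : ∀ z ∈ Metric.sphere (c₀ : ℂ) r, z.re < e + δ ∧ z ≠ e := fun z hz =>
    ⟨hball z (Metric.sphere_subset_closedBall hz), fun h0 => by
      rw [h0] at hz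
      exact (Metric.mem_ball.1 hebal).ne hz⟩
  have hres := fun z hz => h.resolvent_eq hT hδ0 (hsph z hz).1 (hsph z hz).2
  refine ⟨fun z hz => (hres z hz).1, ?_⟩
  set T' := perturb T (rankOneOp δ (φ : E)) with hT'
  have hT'mem : ∀ z : ℂ, z.re < e + δ → z ∈ resolventSet T' := by
    intro z hz
    rcases eq_or_ne z e with h0 | h0
    · exact (hT.perturb (h.formGE hδ0.le) (rankOneOp_symm δ _)).mem_resolventSet h.formGE_perturb hz
    · exact (h.resolvent_eq hT hδ0 hz h0).2.1
  have hdiff : ∀ z ∈ Metric.closedBall (c₀ : ℂ) r, DifferentiableAt ℂ (resolventOp T') z :=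
    fun z hz => differentiableAt_resolventOp (hT'mem z (hball z hz))
  have hne : ∀ z ∈ Metric.closedBall (c₀ : ℂ) r, (e + δ - z : ℂ) ≠ 0 := fun z hz h0 => by
    have := congrArg re h0
    have h2 := hball z hz
    simp at this
    linarith
  have hdiff2 : ∀ z ∈ Metric.closedBall (c₀ : ℂ) r,
      DifferentiableAt ℂ (fun z : ℂ => resolventOp T' z -
        ((e + δ - z : ℂ)⁻¹) • rankOneOp 1 (φ : E)) z := fun z hz =>
    (hdiff z hz).sub ((DifferentiableAt.inv (by fun_prop) (hne z hz)).smul_const _)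
  have hcont : ContinuousOn (fun z : ℂ => resolventOp T' z -
        ((e + δ - z : ℂ)⁻¹) • rankOneOp 1 (φ : E)) (Metric.closedBall (c₀ : ℂ) r) := fun z hz =>
    (hdiff2 z hz).continuousAt.continuousWithinAt
  have hzero : (∮ z in C((c₀ : ℂ), r), (resolventOp T' z -
        ((e + δ - z : ℂ)⁻¹) • rankOneOp 1 (φ : E))) = 0 :=
    Complex.circleIntegral_eq_zero_of_differentiable_on_off_countable hr0.le Set.countable_empty
      hcont fun z hz => hdiff2 z (Metric.ball_subset_closedBall hz.1)
  have hcont2 : ContinuousOn (fun z : ℂ => (-(z - e)⁻¹) • rankOneOp 1 (φ : E))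
      (Metric.sphere (c₀ : ℂ) r) := by
    refine (((continuousOn_id.sub continuousOn_const).inv₀ fun z hz => ?_).neg).smul
      continuousOn_const
    exact sub_ne_zero.2 (hsph z hz).2
  have hint : (∮ z in C((c₀ : ℂ), r), resolventOp T z) =
      -(2 * Real.pi * I : ℂ) • rankOneOp 1 (φ : E) := by
    have h1 : (∮ z in C((c₀ : ℂ), r), resolventOp T z) =
        ∮ z in C((c₀ : ℂ), r), ((resolventOp T' z - ((e + δ - z : ℂ)⁻¹) • rankOneOp 1 (φ : E)) +
          (-(z - e)⁻¹) • rankOneOp 1 (φ : E)) := by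
      refine circleIntegral.integral_congr hr0.le fun z hz => ?_
      rw [(hres z hz).2.2, ← neg_sub (e : ℂ) z, inv_neg, neg_neg]
      module
    rw [h1, circleIntegral.integral_add
      ((hcont.mono Metric.sphere_subset_closedBall).circleIntegrable hr0.le)
      (hcont2.circleIntegrable hr0.le), hzero, zero_add,
      circleIntegral.integral_smul_const]
    congr 1
    rw [← circleIntegral.integral_sub_inv_of_mem_ball hebal]
    simp only [circleIntegral, smul_neg, intervalIntegral.integral_neg]
  rw [rieszProjection, hint, smul_smul]
  have hpi : (Real.pi : ℂ) ≠ 0 := ofReal_ne_zero.2 Real.pi_ne_zero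
  rw [show (-1 / (2 * (Real.pi : ℂ) * I)) * -(2 * Real.pi * I) = 1 by field_simp, one_smul]

end GroundState

end SpinBoson
end

open MeasureTheory Complex
open scoped ENNReal InnerProductSpace
noncomputable section
namespace SpinBoson

/-! ### Norms and inner products of Fock vectors in terms of wave functions -/

section FockBasics

variable {A : Set Momentum}

theorem aestronglyMeasurable_wave (ψ : Fock A) (ℓ : ℕ) :
    AEStronglyMeasurable (wave ψ ℓ) (configMeasure A ℓ) :=
  Lp.aestronglyMeasurable _

theorem memLp_wave (ψ : Fock A) (ℓ : ℕ) : MemLp (wave ψ ℓ) 2 (configMeasure A ℓ) :=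
  Lp.memLp _

theorem wave_comp_perm (ψ : Fock A) (ℓ : ℕ) (σ : Equiv.Perm (Fin ℓ)) :
    (fun k => wave ψ ℓ (k ∘ σ)) =ᵐ[configMeasure A ℓ] wave ψ ℓ :=
  (ψ ℓ).2 σ

theorem wave_neg (ψ : Fock A) (ℓ : ℕ) : wave (-ψ) ℓ =ᵐ[configMeasure A ℓ] -wave ψ ℓ :=
  Lp.coeFn_neg _

theorem wave_sub (ψ φ : Fock A) (ℓ : ℕ) :
    wave (ψ - φ) ℓ =ᵐ[configMeasure A ℓ] wave ψ ℓ - wave φ ℓ :=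
  Lp.coeFn_sub _ _

/-- The total mass of a family of wave functions. -/
def mass (A : Set Momentum) (F : ∀ ℓ : ℕ, (Fin ℓ → Momentum) → ℂ) : ℝ≥0∞ :=
  ∑' ℓ, ∫⁻ k, ‖F ℓ k‖ₑ ^ 2 ∂configMeasure A ℓ

theorem lintegral_enorm_sq {α : Type*} [MeasurableSpace α] (μ : Measure α) (f : α → ℂ) :
    ∫⁻ x, ‖f x‖ₑ ^ 2 ∂μ = eLpNorm f 2 μ ^ 2 := by
  rw [eLpNorm_eq_lintegral_rpow_enorm_toReal (by norm_num) (by norm_num)]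
  simp only [ENNReal.toReal_ofNat, ENNReal.rpow_ofNat, one_div]
  rw [← ENNReal.rpow_natCast, ← ENNReal.rpow_mul]
  norm_num

theorem mass_congr {F G : ∀ ℓ : ℕ, (Fin ℓ → Momentum) → ℂ}
    (h : ∀ ℓ, F ℓ =ᵐ[configMeasure A ℓ] G ℓ) : mass A F = mass A G := by
  refine tsum_congr fun ℓ => lintegral_congr_ae ?_
  filter_upwards [h ℓ] with k hk
  rw [hk]

theorem enorm_sq_apply (ψ : Fock A) (ℓ : ℕ) :
    ‖ψ ℓ‖ₑ ^ 2 = ∫⁻ k, ‖wave ψ ℓ k‖ₑ ^ 2 ∂configMeasure A ℓ := by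
  rw [lintegral_enorm_sq]
  congr 1
  exact Lp.enorm_def _

theorem enorm_sq_eq_mass (ψ : Fock A) : ‖ψ‖ₑ ^ 2 = mass A (wave ψ) := by
  have h : ‖ψ‖ ^ 2 = ∑' ℓ, ‖ψ ℓ‖ ^ 2 := by
    have := lp.norm_rpow_eq_tsum (p := 2) (by norm_num) ψ
    simpa using this
  have hs : Summable fun ℓ => ‖ψ ℓ‖ ^ 2 := by
    have := (lp.memℓp ψ).summable (by norm_num)
    simpa using this
  rw [mass, ← ofReal_norm, ← ENNReal.ofReal_pow (norm_nonneg _), h,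
    ENNReal.ofReal_tsum_of_nonneg (fun _ => sq_nonneg _) hs]
  refine tsum_congr fun ℓ => ?_
  rw [ENNReal.ofReal_pow (norm_nonneg _), ofReal_norm, enorm_sq_apply]

/-- A symmetric family of wave functions with finite mass defines a Fock vector. -/
theorem exists_fock {F : ∀ ℓ : ℕ, (Fin ℓ → Momentum) → ℂ}
    (hm : ∀ ℓ, AEStronglyMeasurable (F ℓ) (configMeasure A ℓ))
    (hs : ∀ ℓ (σ : Equiv.Perm (Fin ℓ)), (fun k => F ℓ (k ∘ σ)) =ᵐ[configMeasure A ℓ] F ℓ)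
    (hfin : mass A F ≠ ∞) : ∃ ψ : Fock A, ∀ ℓ, wave ψ ℓ =ᵐ[configMeasure A ℓ] F ℓ := by
  have hL : ∀ ℓ, MemLp (F ℓ) 2 (configMeasure A ℓ) := by
    refine fun ℓ => ⟨hm ℓ, ?_⟩
    have h1 := ENNReal.ne_top_of_tsum_ne_top hfin ℓ
    rw [lintegral_enorm_sq] at h1
    rw [lt_top_iff_ne_top]
    intro h2
    rw [h2] at h1
    exact h1 (by simp)
  have hcoe : ∀ ℓ, (hL ℓ).toLp (F ℓ) =ᵐ[configMeasure A ℓ] F ℓ := fun ℓ => (hL ℓ).coeFn_toLp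
  have hmem : ∀ ℓ, (hL ℓ).toLp (F ℓ) ∈ symmSubspace A ℓ := by
    intro ℓ σ
    have h1 := (measurePreserving_perm A σ).quasiMeasurePreserving.ae (hcoe ℓ)
    filter_upwards [h1, hcoe ℓ, hs ℓ σ] with k h2 h3 h4
    rw [h2, h3, h4]
  have hmemℓ : Memℓp (fun ℓ => (⟨_, hmem ℓ⟩ : symmSubspace A ℓ)) 2 := by
    refine memℓp_gen ?_
    have h1 : ∀ ℓ, ENNReal.ofReal (‖(⟨_, hmem ℓ⟩ : symmSubspace A ℓ)‖ ^ 2) =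
        ∫⁻ k, ‖F ℓ k‖ₑ ^ 2 ∂configMeasure A ℓ := fun ℓ => by
      rw [ENNReal.ofReal_pow (norm_nonneg _), ofReal_norm, lintegral_enorm_sq,
        ← eLpNorm_congr_ae (hcoe ℓ)]
      congr 1
      exact Lp.enorm_def _
    have h2 : ∑' ℓ, ENNReal.ofReal (‖(⟨_, hmem ℓ⟩ : symmSubspace A ℓ)‖ ^ 2) ≠ ∞ := by
      rw [tsum_congr h1]; exact hfin
    have h3 := ENNReal.summable_toReal h2
    refine h3.congr fun ℓ => ?_
    rw [ENNReal.toReal_ofReal (sq_nonneg _)]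
    simp
  exact ⟨⟨_, hmemℓ⟩, hcoe⟩

theorem hasSum_inner_wave (ψ φ : Fock A) :
    HasSum (fun ℓ => ∫ k, ⟪wave ψ ℓ k, wave φ ℓ k⟫_ℂ ∂configMeasure A ℓ) ⟪ψ, φ⟫_ℂ :=
  lp.hasSum_inner ψ φ

theorem integrable_inner_wave (ψ φ : Fock A) (ℓ : ℕ) :
    Integrable (fun k => ⟪wave ψ ℓ k, wave φ ℓ k⟫_ℂ) (configMeasure A ℓ) :=
  L2.integrable_inner _ _

/-! ### Multiplication operators on Fock space -/

/-- `χ` is obtained from `ψ` by multiplying the `ℓ`-photon wave function by `v ℓ`. -/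
def IsMul (v : ∀ ℓ : ℕ, (Fin ℓ → Momentum) → ℝ) (ψ χ : Fock A) : Prop :=
  ∀ ℓ, ∀ᵐ k ∂configMeasure A ℓ, wave χ ℓ k = (v ℓ k : ℂ) * wave ψ ℓ k

variable {v v' : ∀ ℓ : ℕ, (Fin ℓ → Momentum) → ℝ} {ψ ψ' χ χ' : Fock A}

theorem IsMul.unique (h : IsMul v ψ χ) (h' : IsMul v ψ χ') : χ = χ' :=
  wave_ext fun ℓ => by filter_upwards [h ℓ, h' ℓ] with k h1 h2; rw [h1, h2]

theorem IsMul.congr (h : IsMul v ψ χ) (hv : ∀ ℓ, v ℓ =ᵐ[configMeasure A ℓ] v' ℓ) :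
    IsMul v' ψ χ := fun ℓ => by
  filter_upwards [h ℓ, hv ℓ] with k h1 h2
  rw [h1, h2]

theorem IsMul.add (h : IsMul v ψ χ) (h' : IsMul v ψ' χ') : IsMul v (ψ + ψ') (χ + χ') := fun ℓ => by
  filter_upwards [h ℓ, h' ℓ, wave_add ψ ψ' ℓ, wave_add χ χ' ℓ] with k h1 h2 h3 h4
  rw [h3, h4, Pi.add_apply, Pi.add_apply, h1, h2, mul_add]

theorem IsMul.smul (h : IsMul v ψ χ) (c : ℂ) : IsMul v (c • ψ) (c • χ) := fun ℓ => by
  filter_upwards [h ℓ, wave_smul c ψ ℓ, wave_smul c χ ℓ] with k h1 h3 h4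
  rw [h3, h4, Pi.smul_apply, Pi.smul_apply, h1, smul_eq_mul, smul_eq_mul, mul_left_comm]

theorem IsMul.sub_coeff (h : IsMul v ψ χ) (h' : IsMul v' ψ χ') :
    IsMul (fun ℓ k => v ℓ k - v' ℓ k) ψ (χ - χ') := fun ℓ => by
  filter_upwards [h ℓ, h' ℓ, wave_sub χ χ' ℓ] with k h1 h2 h3
  rw [h3, Pi.sub_apply, h1, h2, ofReal_sub, sub_mul]

theorem IsMul.add_coeff (h : IsMul v ψ χ) (h' : IsMul v' ψ χ') :
    IsMul (fun ℓ k => v ℓ k + v' ℓ k) ψ (χ + χ') := fun ℓ => by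
  filter_upwards [h ℓ, h' ℓ, wave_add χ χ' ℓ] with k h1 h2 h3
  rw [h3, Pi.add_apply, h1, h2, ofReal_add, add_mul]

theorem IsMul.smul_coeff (h : IsMul v ψ χ) (c : ℝ) :
    IsMul (fun ℓ k => c * v ℓ k) ψ ((c : ℂ) • χ) := fun ℓ => by
  filter_upwards [h ℓ, wave_smul (c : ℂ) χ ℓ] with k h1 h3
  rw [h3, Pi.smul_apply, h1, smul_eq_mul, ofReal_mul, mul_assoc]

theorem IsMul.comp (h : IsMul v ψ χ) (h' : IsMul v' χ χ') :
    IsMul (fun ℓ k => v' ℓ k * v ℓ k) ψ χ' := fun ℓ => by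
  filter_upwards [h ℓ, h' ℓ] with k h1 h2
  rw [h2, h1, ofReal_mul, mul_assoc]

theorem isMul_one (ψ : Fock A) : IsMul (fun _ _ => 1) ψ ψ := fun ℓ => by
  filter_upwards with k
  simp

theorem IsMul.inner_comm (h : IsMul v ψ χ) (h' : IsMul v ψ' χ') : ⟪χ, ψ'⟫_ℂ = ⟪ψ, χ'⟫_ℂ := by
  rw [← (hasSum_inner_wave χ ψ').tsum_eq, ← (hasSum_inner_wave ψ χ').tsum_eq]
  refine tsum_congr fun ℓ => integral_congr_ae ?_
  filter_upwards [h ℓ, h' ℓ] with k h1 h2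
  rw [h1, h2, RCLike.inner_apply, RCLike.inner_apply, map_mul, conj_ofReal]
  ring

/-- Expectations of nonnegative multiplication operators become integrals in `ℝ≥0∞`, where sums and
integrals can be exchanged freely. -/
theorem IsMul.ofReal_inner (h : IsMul v ψ χ)
    (hv : ∀ ℓ, ∀ᵐ k ∂configMeasure A ℓ, 0 ≤ v ℓ k) :
    0 ≤ (⟪ψ, χ⟫_ℂ).re ∧ ENNReal.ofReal (⟪ψ, χ⟫_ℂ).re =
      ∑' ℓ, ∫⁻ k, ENNReal.ofReal (v ℓ k) * ‖wave ψ ℓ k‖ₑ ^ 2 ∂configMeasure A ℓ := by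
  have hpt : ∀ ℓ, ∀ᵐ k ∂configMeasure A ℓ,
      RCLike.re ⟪wave ψ ℓ k, wave χ ℓ k⟫_ℂ = v ℓ k * ‖wave ψ ℓ k‖ ^ 2 := fun ℓ => by
    filter_upwards [h ℓ] with k h1
    rw [h1, RCLike.inner_apply, mul_assoc, mul_conj, normSq_eq_norm_sq]
    change ((v ℓ k : ℂ) * ((‖wave ψ ℓ k‖ ^ 2 : ℝ) : ℂ)).re = _
    rw [re_ofReal_mul, ofReal_re]
  have hnn : ∀ ℓ, 0 ≤ᵐ[configMeasure A ℓ] fun k => RCLike.re ⟪wave ψ ℓ k, wave χ ℓ k⟫_ℂ :=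
    fun ℓ => by
      filter_upwards [hpt ℓ, hv ℓ] with k h1 h2
      rw [h1]
      exact mul_nonneg h2 (sq_nonneg _)
  have hsum : HasSum (fun ℓ => ∫ k, RCLike.re ⟪wave ψ ℓ k, wave χ ℓ k⟫_ℂ ∂configMeasure A ℓ)
      (⟪ψ, χ⟫_ℂ).re := by
    have h1 := hasSum_re (hasSum_inner_wave ψ χ)
    refine h1.congr_fun fun ℓ => ?_
    exact (integral_re (integrable_inner_wave ψ χ ℓ))
  have hnn' : ∀ ℓ, 0 ≤ ∫ k, RCLike.re ⟪wave ψ ℓ k, wave χ ℓ k⟫_ℂ ∂configMeasure A ℓ := fun ℓ =>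
    integral_nonneg_of_ae (hnn ℓ)
  refine ⟨hsum.nonneg hnn', ?_⟩
  rw [← hsum.tsum_eq, ENNReal.ofReal_tsum_of_nonneg hnn' hsum.summable]
  refine tsum_congr fun ℓ => ?_
  rw [ofReal_integral_eq_lintegral_ofReal (integrable_inner_wave ψ χ ℓ).re (hnn ℓ)]
  refine lintegral_congr_ae ?_
  filter_upwards [hpt ℓ, hv ℓ] with k h1 h2
  rw [h1, ENNReal.ofReal_mul h2, ENNReal.ofReal_pow (norm_nonneg _), ofReal_norm]

theorem IsMul.re_inner_le (h : IsMul v ψ χ) (h' : IsMul v' ψ χ')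
    (hv : ∀ ℓ, ∀ᵐ k ∂configMeasure A ℓ, v ℓ k ≤ v' ℓ k) :
    (⟪ψ, χ⟫_ℂ).re ≤ (⟪ψ, χ'⟫_ℂ).re := by
  have h1 := ((h'.sub_coeff h).ofReal_inner fun ℓ => by
    filter_upwards [hv ℓ] with k hk
    linarith).1
  rw [inner_sub_right, sub_re] at h1
  linarith

theorem IsMul.mass_eq (h : IsMul v ψ χ) : ‖χ‖ₑ ^ 2 =
    ∑' ℓ, ∫⁻ k, ENNReal.ofReal (v ℓ k ^ 2) * ‖wave ψ ℓ k‖ₑ ^ 2 ∂configMeasure A ℓ := by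
  rw [enorm_sq_eq_mass, mass]
  refine tsum_congr fun ℓ => lintegral_congr_ae ?_
  filter_upwards [h ℓ] with k hk
  rw [hk, enorm_mul, mul_pow, ← sq_abs, ENNReal.ofReal_pow (abs_nonneg _),
    ← ofReal_norm (v ℓ k : ℂ), norm_real, Real.norm_eq_abs]

/-- The coefficient `v` is measurable and symmetric in the momenta. -/
structure IsSymmCoeff (v : ∀ ℓ : ℕ, (Fin ℓ → Momentum) → ℝ) : Prop where
  meas : ∀ ℓ, Measurable (v ℓ)
  symm : ∀ ℓ (σ : Equiv.Perm (Fin ℓ)) k, v ℓ (k ∘ σ) = v ℓ k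

theorem IsSymmCoeff.exists_isMul (hv : IsSymmCoeff v) (ψ : Fock A)
    (hfin : ∑' ℓ, ∫⁻ k, ENNReal.ofReal (v ℓ k ^ 2) * ‖wave ψ ℓ k‖ₑ ^ 2 ∂configMeasure A ℓ ≠ ∞) :
    ∃ χ, IsMul v ψ χ := by
  refine exists_fock (F := fun ℓ k => (v ℓ k : ℂ) * wave ψ ℓ k) (fun ℓ => ?_) (fun ℓ σ => ?_) ?_
  · exact ((continuous_ofReal.measurable.comp (hv.meas ℓ)).aestronglyMeasurable).mul
      (aestronglyMeasurable_wave ψ ℓ)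
  · filter_upwards [wave_comp_perm ψ ℓ σ] with k hk
    rw [hv.symm, hk]
  · convert hfin using 1
    refine tsum_congr fun ℓ => lintegral_congr fun k => ?_
    rw [enorm_mul, mul_pow, ← sq_abs, ENNReal.ofReal_pow (abs_nonneg _),
      ← ofReal_norm (v ℓ k : ℂ), norm_real, Real.norm_eq_abs]

theorem IsSymmCoeff.exists_isMul_of_le (hv : IsSymmCoeff v) (h : IsMul v' ψ χ) {C : ℝ}
    (hle : ∀ ℓ, ∀ᵐ k ∂configMeasure A ℓ, |v ℓ k| ≤ C * |v' ℓ k|) :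
    ∃ χ', IsMul v ψ χ' := by
  refine hv.exists_isMul ψ (ne_top_of_le_ne_top (b := ENNReal.ofReal (C ^ 2) * ‖χ‖ₑ ^ 2) ?_ ?_)
  · finiteness
  · rw [h.mass_eq, ← ENNReal.tsum_mul_left]
    refine ENNReal.tsum_le_tsum fun ℓ => ?_
    rw [← lintegral_const_mul' _ _ ENNReal.ofReal_ne_top]
    refine lintegral_mono_ae ?_
    filter_upwards [hle ℓ] with k hk
    rw [← mul_assoc, ← ENNReal.ofReal_mul (sq_nonneg _)]
    gcongr
    rw [← sq_abs (v ℓ k), ← sq_abs (v' ℓ k), ← mul_pow]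
    exact pow_le_pow_left₀ (abs_nonneg _) hk 2

theorem IsMul.norm_le (h : IsMul v ψ χ) {C : ℝ} (hC : 0 ≤ C)
    (hle : ∀ ℓ, ∀ᵐ k ∂configMeasure A ℓ, |v ℓ k| ≤ C) : ‖χ‖ ≤ C * ‖ψ‖ := by
  have h1 : ‖χ‖ₑ ^ 2 ≤ (ENNReal.ofReal (C * ‖ψ‖)) ^ 2 := by
    rw [h.mass_eq, ENNReal.ofReal_mul hC, mul_pow, ofReal_norm, enorm_sq_eq_mass, mass,
      ← ENNReal.tsum_mul_left]
    refine ENNReal.tsum_le_tsum fun ℓ => ?_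
    rw [← lintegral_const_mul' _ _ (by finiteness)]
    refine lintegral_mono_ae ?_
    filter_upwards [hle ℓ] with k hk
    rw [← ENNReal.ofReal_pow hC]
    refine mul_le_mul' (ENNReal.ofReal_le_ofReal ?_) le_rfl
    rw [← sq_abs (v ℓ k)]
    exact pow_le_pow_left₀ (abs_nonneg _) hk 2
  have h2 := (ENNReal.pow_le_pow_left_iff two_ne_zero).1 h1
  rw [← ofReal_norm] at h2
  exact (ENNReal.ofReal_le_ofReal_iff (by positivity)).1 h2

/-- A bounded symmetric coefficient. -/
structure IsMultiplier (v : ∀ ℓ : ℕ, (Fin ℓ → Momentum) → ℝ) (C : ℝ) : Prop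
    extends IsSymmCoeff v where
  bound : ∀ ℓ k, |v ℓ k| ≤ C

theorem IsMultiplier.exists_isMul {C : ℝ} (hv : IsMultiplier v C) (ψ : Fock A) :
    ∃ χ, IsMul v ψ χ :=
  hv.toIsSymmCoeff.exists_isMul_of_le (isMul_one ψ) (C := C) fun ℓ => by
    filter_upwards with k
    simpa using hv.bound ℓ k

theorem IsMultiplier.exists_mulOp {C : ℝ} (hv : IsMultiplier v C) :
    ∃ L : Fock A →L[ℂ] Fock A, ∀ ψ, IsMul v ψ (L ψ) := by
  choose L hL using fun ψ : Fock A => hv.exists_isMul ψ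
  have hC : 0 ≤ C := (abs_nonneg _).trans (hv.bound 0 Fin.elim0)
  refine ⟨LinearMap.mkContinuous ⟨⟨L, fun ψ φ => ?_⟩, fun c ψ => ?_⟩ C fun ψ => ?_, hL⟩
  · exact (hL _).unique ((hL ψ).add (hL φ))
  · exact (hL _).unique ((hL ψ).smul c)
  · exact (hL ψ).norm_le hC fun ℓ => by filter_upwards with k; exact hv.bound ℓ k

open Classical in
/-- The multiplication operator with a bounded symmetric coefficient. -/
def mulOp (A : Set Momentum) (v : ∀ ℓ : ℕ, (Fin ℓ → Momentum) → ℝ) : Fock A →L[ℂ] Fock A :=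
  if h : ∃ L : Fock A →L[ℂ] Fock A, ∀ ψ, IsMul v ψ (L ψ) then h.choose else 0

theorem IsMultiplier.isMul_mulOp {C : ℝ} (hv : IsMultiplier v C) (ψ : Fock A) :
    IsMul v ψ (mulOp A v ψ) := by
  rw [mulOp, dif_pos hv.exists_mulOp]
  exact hv.exists_mulOp.choose_spec ψ

end FockBasics

end SpinBoson
end

open MeasureTheory Complex
open scoped ENNReal InnerProductSpace
noncomputable section
namespace SpinBoson

/-! ### Number bounds and adjointness for creation and annihilation operators -/

section CreationAnnihilation

variable {A : Set Momentum}

/-! ### Integration over configurations -/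

theorem measurePreserving_cons (A : Set Momentum) (ℓ : ℕ) :
    MeasurePreserving (fun p : Momentum × (Fin ℓ → Momentum) =>
      (Fin.cons p.1 p.2 : Fin (ℓ + 1) → Momentum))
      ((volume.restrict A).prod (configMeasure A ℓ)) (configMeasure A (ℓ + 1)) := by
  have h := (measurePreserving_piFinSuccAbove
    (fun _ : Fin (ℓ + 1) => (volume.restrict A : Measure Momentum)) 0).symm
  convert h using 1
  funext p
  exact (Fin.insertNth_zero' p.1 p.2).symm

theorem lintegral_cons {ℓ : ℕ} {G : (Fin (ℓ + 1) → Momentum) → ℝ≥0∞}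
    (hG : AEMeasurable G (configMeasure A (ℓ + 1))) :
    ∫⁻ k, G k ∂configMeasure A (ℓ + 1) =
      ∫⁻ q in A, ∫⁻ k, G (Fin.cons q k) ∂configMeasure A ℓ := by
  have h := measurePreserving_cons A ℓ
  rw [← h.map_eq] at hG
  rw [← h.map_eq, lintegral_map' hG h.aemeasurable,
    lintegral_prod (fun p : Momentum × (Fin ℓ → Momentum) => G (Fin.cons p.1 p.2))
      (hG.comp_aemeasurable h.aemeasurable)]

theorem lintegral_cons_symm {ℓ : ℕ} {G : (Fin (ℓ + 1) → Momentum) → ℝ≥0∞}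
    (hG : AEMeasurable G (configMeasure A (ℓ + 1))) :
    ∫⁻ k, G k ∂configMeasure A (ℓ + 1) =
      ∫⁻ k, (∫⁻ q in A, G (Fin.cons q k)) ∂configMeasure A ℓ := by
  have h := measurePreserving_cons A ℓ
  rw [← h.map_eq] at hG
  rw [← h.map_eq, lintegral_map' hG h.aemeasurable,
    lintegral_prod_symm (fun p : Momentum × (Fin ℓ → Momentum) => G (Fin.cons p.1 p.2))
      (hG.comp_aemeasurable h.aemeasurable)]

theorem integral_cons_symm {ℓ : ℕ} {G : (Fin (ℓ + 1) → Momentum) → ℂ}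
    (hG : Integrable G (configMeasure A (ℓ + 1))) :
    ∫ k, G k ∂configMeasure A (ℓ + 1) =
      ∫ k, (∫ q in A, G (Fin.cons q k)) ∂configMeasure A ℓ := by
  have h := measurePreserving_cons A ℓ
  rw [← h.map_eq] at hG
  rw [← h.map_eq, integral_map h.aemeasurable hG.aestronglyMeasurable,
    integral_prod_symm (fun p : Momentum × (Fin ℓ → Momentum) => G (Fin.cons p.1 p.2))
      (hG.comp_aemeasurable h.aemeasurable)]

theorem lintegral_comp_perm {ℓ : ℕ} (σ : Equiv.Perm (Fin ℓ)) {G : (Fin ℓ → Momentum) → ℝ≥0∞}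
    (hG : AEMeasurable G (configMeasure A ℓ)) :
    ∫⁻ k, G (k ∘ σ) ∂configMeasure A ℓ = ∫⁻ k, G k ∂configMeasure A ℓ := by
  have h := measurePreserving_perm A σ
  rw [← h.map_eq] at hG
  conv_rhs => rw [← h.map_eq, lintegral_map' hG h.aemeasurable]

theorem integral_comp_perm {ℓ : ℕ} (σ : Equiv.Perm (Fin ℓ)) {G : (Fin ℓ → Momentum) → ℂ}
    (hG : AEStronglyMeasurable G (configMeasure A ℓ)) :
    ∫ k, G (k ∘ σ) ∂configMeasure A ℓ = ∫ k, G k ∂configMeasure A ℓ := by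
  have h := measurePreserving_perm A σ
  rw [← h.map_eq] at hG
  conv_rhs => rw [← h.map_eq, integral_map h.aemeasurable hG]

theorem quasiMeasurePreserving_apply (A : Set Momentum) {ℓ : ℕ} (i : Fin ℓ) :
    Measure.QuasiMeasurePreserving (fun k : Fin ℓ → Momentum => k i)
      (configMeasure A ℓ) (volume.restrict A) :=
  Measure.quasiMeasurePreserving_eval _ i

theorem ae_forall_apply {ℓ : ℕ} {p : Momentum → Prop}
    (hp : ∀ᵐ q ∂(volume.restrict A : Measure Momentum), p q) :
    ∀ᵐ k ∂configMeasure A ℓ, ∀ i, p (k i) :=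
  ae_all_iff.2 fun i => (quasiMeasurePreserving_apply A i).ae hp

/-- The coefficient of `dΓ(w)`. -/
def dCoeff (w : Momentum → ℝ) (ℓ : ℕ) (k : Fin ℓ → Momentum) : ℝ := ∑ i, w (k i)

/-- By permutation symmetry of G each of the ℓ + 1 terms w(kᵢ) contributes the same integral as
w(k₀); the first momentum is then integrated last. -/
theorem lintegral_dCoeff_mul {ℓ : ℕ} {w : Momentum → ℝ} (hw : Measurable w) (hw0 : ∀ q, 0 ≤ w q)
    {G : (Fin (ℓ + 1) → Momentum) → ℝ≥0∞} (hG : AEMeasurable G (configMeasure A (ℓ + 1)))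
    (hs : ∀ σ : Equiv.Perm (Fin (ℓ + 1)), (fun k => G (k ∘ σ)) =ᵐ[configMeasure A (ℓ + 1)] G) :
    ∫⁻ k, ENNReal.ofReal (dCoeff w (ℓ + 1) k) * G k ∂configMeasure A (ℓ + 1) =
      (ℓ + 1 : ℕ) * ∫⁻ q in A, ENNReal.ofReal (w q) * ∫⁻ k, G (Fin.cons q k) ∂configMeasure A ℓ := by
  have hm : ∀ i : Fin (ℓ + 1), AEMeasurable
      (fun k : Fin (ℓ + 1) → Momentum => ENNReal.ofReal (w (k i)) * G k) (configMeasure A (ℓ + 1)) :=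
    fun i => ((ENNReal.measurable_ofReal.comp (hw.comp (measurable_pi_apply i))).aemeasurable).mul hG
  have h1 : ∀ k, ENNReal.ofReal (dCoeff w (ℓ + 1) k) * G k =
      ∑ i, ENNReal.ofReal (w (k i)) * G k := fun k => by
    rw [dCoeff, ENNReal.ofReal_sum_of_nonneg fun i _ => hw0 _, Finset.sum_mul]
  -- The permutation `i.cycleRange` sends i to 0, so composing with it turns w(k₀) into the term for
  -- i.
  have h2 : ∀ i : Fin (ℓ + 1),
      ∫⁻ k, ENNReal.ofReal (w (k i)) * G k ∂configMeasure A (ℓ + 1) =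
      ∫⁻ k, ENNReal.ofReal (w (k 0)) * G k ∂configMeasure A (ℓ + 1) := fun i => by
    rw [← lintegral_comp_perm i.cycleRange (hm i)]
    refine lintegral_congr_ae ?_
    filter_upwards [hs i.cycleRange] with k hk
    rw [hk, Function.comp_apply, Fin.cycleRange_self]
  rw [lintegral_congr h1, lintegral_finsetSum' _ fun i _ => hm i, Finset.sum_congr rfl fun i _ => h2 i,
    Finset.sum_const, Finset.card_univ, Fintype.card_fin, nsmul_eq_mul, lintegral_cons (hm 0)]
  congr 1
  refine lintegral_congr fun q => ?_
  simp only [Fin.cons_zero]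
  rw [lintegral_const_mul' _ _ ENNReal.ofReal_ne_top]

theorem lintegral_mul_sq_le {α : Type*} [MeasurableSpace α] {μ : Measure α} {f g : α → ℝ≥0∞}
    (hf : AEMeasurable f μ) (hg : AEMeasurable g μ) :
    (∫⁻ x, f x * g x ∂μ) ^ 2 ≤ (∫⁻ x, f x ^ 2 ∂μ) * ∫⁻ x, g x ^ 2 ∂μ := by
  have h := ENNReal.lintegral_mul_le_Lp_mul_Lq μ Real.HolderConjugate.two_two hf hg
  have h2 := pow_le_pow_left' h 2
  refine h2.trans_eq ?_
  rw [mul_pow]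
  simp only [ENNReal.rpow_ofNat, one_div]
  rw [← ENNReal.rpow_natCast, ← ENNReal.rpow_mul, ← ENNReal.rpow_natCast, ← ENNReal.rpow_mul]
  norm_num

/-! ### Annihilation operators -/

theorem measurable_dCoeff {w : Momentum → ℝ} (hw : Measurable w) (ℓ : ℕ) :
    Measurable (dCoeff w ℓ) :=
  Finset.measurable_sum _ fun i _ => hw.comp (measurable_pi_apply i)

theorem isSymmCoeff_dCoeff {w : Momentum → ℝ} (hw : Measurable w) : IsSymmCoeff (dCoeff w) :=
  ⟨measurable_dCoeff hw, fun _ σ k => Equiv.sum_comp σ fun i => w (k i)⟩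

theorem dCoeff_nonneg {w : Momentum → ℝ} (hw : ∀ q, 0 ≤ w q) (ℓ : ℕ) (k : Fin ℓ → Momentum) :
    0 ≤ dCoeff w ℓ k :=
  Finset.sum_nonneg fun _ _ => hw _

/-- The expectation of `dΓ(w)`. -/
def dMass (w : Momentum → ℝ) (ψ : Fock A) : ℝ≥0∞ :=
  ∑' ℓ, ∫⁻ k, ENNReal.ofReal (dCoeff w ℓ k) * ‖wave ψ ℓ k‖ₑ ^ 2 ∂configMeasure A ℓ

theorem aemeasurable_enorm_sq_wave (ψ : Fock A) (ℓ : ℕ) :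
    AEMeasurable (fun k => ‖wave ψ ℓ k‖ₑ ^ 2) (configMeasure A ℓ) :=
  (aestronglyMeasurable_wave ψ ℓ).enorm.pow_const 2

theorem dMass_eq {w : Momentum → ℝ} (hw : Measurable w) (hw0 : ∀ q, 0 ≤ w q) (ψ : Fock A) :
    dMass w ψ = ∑' ℓ : ℕ, (ℓ + 1 : ℕ) * ∫⁻ q in A, ENNReal.ofReal (w q) *
      ∫⁻ k, ‖wave ψ (ℓ + 1) (Fin.cons q k)‖ₑ ^ 2 ∂configMeasure A ℓ := by
  rw [dMass, tsum_eq_zero_add' ENNReal.summable]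
  have h0 : ∫⁻ k, ENNReal.ofReal (dCoeff w 0 k) * ‖wave ψ 0 k‖ₑ ^ 2 ∂configMeasure A 0 = 0 := by
    simp [dCoeff]
  rw [h0, zero_add]
  refine tsum_congr fun ℓ => ?_
  rw [lintegral_dCoeff_mul hw hw0 (aemeasurable_enorm_sq_wave ψ (ℓ + 1))]
  intro σ
  filter_upwards [wave_comp_perm ψ (ℓ + 1) σ] with k hk
  rw [hk]

theorem aestronglyMeasurable_wave_cons (ψ : Fock A) (ℓ : ℕ) :
    AEStronglyMeasurable (fun p : (Fin ℓ → Momentum) × Momentum =>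
      wave ψ (ℓ + 1) (Fin.cons p.2 p.1)) ((configMeasure A ℓ).prod (volume.restrict A)) :=
  (aestronglyMeasurable_wave ψ (ℓ + 1)).comp_measurePreserving
    ((measurePreserving_cons A ℓ).comp Measure.measurePreserving_swap)

/-- The permutation σ of the last ℓ momenta is extended to ℓ + 1 momenta by fixing the first one.
This gives the symmetry of a(h)ψ. -/
theorem ae_wave_cons_perm (ψ : Fock A) (ℓ : ℕ) (σ : Equiv.Perm (Fin ℓ)) :
    ∀ᵐ k ∂configMeasure A ℓ, ∀ᵐ q ∂(volume.restrict A : Measure Momentum),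
      wave ψ (ℓ + 1) (Fin.cons q (k ∘ σ)) = wave ψ (ℓ + 1) (Fin.cons q k) := by
  filter_upwards [ae_ae_cons (wave_comp_perm ψ (ℓ + 1)
    (Equiv.Perm.decomposeFin.symm (0, σ)))] with k hk
  filter_upwards [hk] with q hq
  rw [← hq]
  congr 1
  funext i
  refine Fin.cases ?_ (fun j => ?_) i
  · simp [Equiv.Perm.decomposeFin_symm_apply_zero]
  · simp [Equiv.Perm.decomposeFin_symm_apply_succ]

/-- The standard bound ‖a(h)ψ‖² ≤ ‖h‖²⟨ψ, N_S ψ⟩: Cauchy–Schwarz in the integrated momentum q,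
restricted to the set S carrying h, and then the factor ℓ + 1 turns the q-integral into the number
of photons in S. -/
theorem exists_annihilation {h : Momentum → ℂ} (hh : MemLp h 2 (volume.restrict A))
    {S : Set Momentum} (hS : MeasurableSet S) (hhS : ∀ q ∉ S, h q = 0) (ψ : Fock A)
    (hfin : dMass (S.indicator 1) ψ ≠ ∞) :
    ∃ χ, (ψ, χ) ∈ annihilationGraph A h ∧
      ‖χ‖ₑ ^ 2 ≤ (∫⁻ q in A, ‖h q‖ₑ ^ 2) * dMass (S.indicator 1) ψ := by
  set W : ∀ ℓ : ℕ, (Fin ℓ → Momentum) → Momentum → ℂ :=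
    fun ℓ k q => wave ψ (ℓ + 1) (Fin.cons q k) with hW
  set s : Momentum → ℝ≥0∞ := fun q => ENNReal.ofReal (S.indicator 1 q) with hs
  have hsm : Measurable s :=
    ENNReal.measurable_ofReal.comp (measurable_one.indicator hS)
  -- The indicator of S is idempotent, so it can be attached to the wave function inside the product
  -- before Cauchy–Schwarz is applied.
  have hs2 : ∀ q, s q ^ 2 = s q := fun q => by
    by_cases hq : q ∈ S <;> simp [hs, hq]
  have hhs : ∀ q, ‖h q‖ₑ = ‖h q‖ₑ * s q := fun q => by
    by_cases hq : q ∈ S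
    · simp [hs, hq]
    · simp [hhS q hq]
  have hh2 : ∫⁻ q in A, ‖h q‖ₑ ^ 2 ≠ ∞ := by
    rw [lintegral_enorm_sq]
    exact ENNReal.pow_ne_top hh.2.ne
  have hWm : ∀ ℓ, AEStronglyMeasurable (fun p : (Fin ℓ → Momentum) × Momentum => W ℓ p.1 p.2)
      ((configMeasure A ℓ).prod (volume.restrict A)) := aestronglyMeasurable_wave_cons ψ
  have hpt : ∀ ℓ, ∀ᵐ k ∂configMeasure A ℓ,
      (∫⁻ q in A, ‖star (h q) * W ℓ k q‖ₑ) ^ 2 ≤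
        (∫⁻ q in A, ‖h q‖ₑ ^ 2) * ∫⁻ q in A, s q * ‖W ℓ k q‖ₑ ^ 2 := by
    intro ℓ
    filter_upwards [(hWm ℓ).prodMk_left] with k hk
    have h1 : ∀ q, ‖star (h q) * W ℓ k q‖ₑ = ‖h q‖ₑ * (s q * ‖W ℓ k q‖ₑ) := fun q => by
      rw [enorm_mul, ← mul_assoc, ← hhs]
      congr 1
      rw [← ofReal_norm, norm_star, ofReal_norm]
    have h2 : ∀ q, s q * ‖W ℓ k q‖ₑ ^ 2 = (s q * ‖W ℓ k q‖ₑ) ^ 2 := fun q => by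
      rw [mul_pow, hs2]
    rw [lintegral_congr h1, lintegral_congr h2]
    exact lintegral_mul_sq_le hh.1.enorm (hsm.aemeasurable.mul hk.enorm)
  have hsW : ∀ ℓ, ∫⁻ k, (∫⁻ q in A, s q * ‖W ℓ k q‖ₑ ^ 2) ∂configMeasure A ℓ =
      ∫⁻ q in A, s q * ∫⁻ k, ‖wave ψ (ℓ + 1) (Fin.cons q k)‖ₑ ^ 2 ∂configMeasure A ℓ := by
    intro ℓ
    have hm : AEMeasurable (fun k : Fin (ℓ + 1) → Momentum => s (k 0) * ‖wave ψ (ℓ + 1) k‖ₑ ^ 2)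
        (configMeasure A (ℓ + 1)) :=
      (hsm.comp (measurable_pi_apply 0)).aemeasurable.mul (aemeasurable_enorm_sq_wave ψ _)
    have h1 := lintegral_cons_symm hm
    have h2 := lintegral_cons hm
    simp only [Fin.cons_zero] at h1 h2
    rw [← h1, h2]
    refine lintegral_congr fun q => ?_
    rw [lintegral_const_mul' _ _ ENNReal.ofReal_ne_top]
  have hfinℓ : ∀ ℓ, ∫⁻ k, (∫⁻ q in A, s q * ‖W ℓ k q‖ₑ ^ 2) ∂configMeasure A ℓ ≠ ∞ := by
    intro ℓ
    rw [hsW]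
    rw [dMass_eq (measurable_one.indicator hS)
      (fun q => Set.indicator_nonneg (fun _ _ => zero_le_one) q)] at hfin
    have h1 := ENNReal.ne_top_of_tsum_ne_top hfin ℓ
    exact fun h2 => h1 (by
      rw [show (∫⁻ q in A, ENNReal.ofReal (S.indicator 1 q) *
        ∫⁻ k, ‖wave ψ (ℓ + 1) (Fin.cons q k)‖ₑ ^ 2 ∂configMeasure A ℓ) = ∞ from h2]
      exact ENNReal.mul_top (by simp))
  have hint : ∀ ℓ, ∀ᵐ k ∂configMeasure A ℓ, IntegrableOn (fun q => star (h q) * W ℓ k q) A := by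
    intro ℓ
    have hm : AEMeasurable (fun k => ∫⁻ q in A, s q * ‖W ℓ k q‖ₑ ^ 2) (configMeasure A ℓ) := by
      have h1 : AEMeasurable (fun p : (Fin ℓ → Momentum) × Momentum => s p.2 * ‖W ℓ p.1 p.2‖ₑ ^ 2)
          ((configMeasure A ℓ).prod (volume.restrict A)) :=
        (hsm.comp measurable_snd).aemeasurable.mul ((hWm ℓ).enorm.pow_const 2)
      exact h1.lintegral_prod_right'
    filter_upwards [hpt ℓ, (hWm ℓ).prodMk_left, ae_lt_top' hm (hfinℓ ℓ)] with k h1 h2 h3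
    refine ⟨hh.1.star.mul h2, ?_⟩
    rw [HasFiniteIntegral, lt_top_iff_ne_top]
    intro h4
    rw [h4] at h1
    exact (ENNReal.mul_ne_top hh2 h3.ne) (top_le_iff.1 (by simpa using h1))
  have hmass : mass A (fun ℓ k => ((Real.sqrt (ℓ + 1) : ℝ) : ℂ) * ∫ q in A, star (h q) * W ℓ k q) ≤
      (∫⁻ q in A, ‖h q‖ₑ ^ 2) * dMass (S.indicator 1) ψ := by
    rw [dMass_eq (measurable_one.indicator hS)
      (fun q => Set.indicator_nonneg (fun _ _ => zero_le_one) q), ← ENNReal.tsum_mul_left, mass]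
    refine ENNReal.tsum_le_tsum fun ℓ => ?_
    have h1 : ∀ᵐ k ∂configMeasure A ℓ,
        ‖((Real.sqrt (ℓ + 1) : ℝ) : ℂ) * ∫ q in A, star (h q) * W ℓ k q‖ₑ ^ 2 ≤
        (∫⁻ q in A, ‖h q‖ₑ ^ 2) * ((ℓ + 1 : ℕ) * ∫⁻ q in A, s q * ‖W ℓ k q‖ₑ ^ 2) := by
      filter_upwards [hpt ℓ] with k hk
      have h2 : ‖((Real.sqrt (ℓ + 1) : ℝ) : ℂ)‖ₑ ^ 2 = (ℓ + 1 : ℕ) := by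
        rw [← ofReal_norm, norm_real, Real.norm_eq_abs, ← ENNReal.ofReal_pow (abs_nonneg _), sq_abs,
          Real.sq_sqrt (by positivity)]
        exact_mod_cast ENNReal.ofReal_natCast (ℓ + 1)
      rw [enorm_mul, mul_pow, h2, mul_left_comm]
      gcongr
      exact (pow_le_pow_left' (enorm_integral_le_lintegral_enorm _) 2).trans hk
    refine (lintegral_mono_ae h1).trans_eq ?_
    rw [lintegral_const_mul' _ _ hh2, lintegral_const_mul' _ _ (ENNReal.natCast_ne_top _), hsW]
  have hFm : ∀ ℓ : ℕ, AEStronglyMeasurable (fun k => ((Real.sqrt (ℓ + 1) : ℝ) : ℂ) *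
      ∫ q in A, star (h q) * W ℓ k q) (configMeasure A ℓ) := fun ℓ => by
    have h1 : AEStronglyMeasurable (fun p : (Fin ℓ → Momentum) × Momentum =>
        star (h p.2) * W ℓ p.1 p.2) ((configMeasure A ℓ).prod (volume.restrict A)) :=
      (hh.1.star.comp_snd).mul (hWm ℓ)
    exact aestronglyMeasurable_const.mul h1.integral_prod_right'
  obtain ⟨χ, hχ⟩ := exists_fock hFm (fun ℓ σ => by
    filter_upwards [ae_wave_cons_perm ψ ℓ σ] with k hk
    congr 1
    refine integral_congr_ae ?_
    filter_upwards [hk] with q hq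
    simp only [hW, hq]) (ne_top_of_le_ne_top (ENNReal.mul_ne_top hh2 hfin) hmass)
  refine ⟨χ, fun ℓ => ?_, ?_⟩
  · filter_upwards [hint ℓ, hχ ℓ] with k h1 h2
    exact ⟨h1, h2⟩
  · rw [enorm_sq_eq_mass, mass_congr hχ]
    exact hmass

/-! ### Creation operators -/

theorem measurePreserving_succAbove (A : Set Momentum) {ℓ : ℕ} (i : Fin (ℓ + 1)) :
    MeasurePreserving (fun k : Fin (ℓ + 1) → Momentum => (k i, fun j => k (i.succAbove j)))
      (configMeasure A (ℓ + 1)) ((volume.restrict A).prod (configMeasure A ℓ)) :=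
  measurePreserving_piFinSuccAbove (fun _ : Fin (ℓ + 1) => (volume.restrict A : Measure Momentum)) i

/-- Omitting kᵢ after a permutation σ is omitting k_{σ(i)} before it, up to a permutation τ of the
remaining momenta. This is why a*(h)ψ is symmetric. -/
theorem exists_perm_succAbove {ℓ : ℕ} (σ : Equiv.Perm (Fin (ℓ + 1))) (i : Fin (ℓ + 1)) :
    ∃ τ : Equiv.Perm (Fin ℓ), ∀ j, σ (i.succAbove j) = (σ i).succAbove (τ j) := by
  refine ⟨(finSuccAboveEquiv i).trans
    ((σ.subtypeEquiv (p := (· ≠ i)) (q := (· ≠ σ i)) fun x => by simp).trans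
      (finSuccAboveEquiv (σ i)).symm), fun j => ?_⟩
  have h := (finSuccAboveEquiv (σ i)).apply_symm_apply
    ((σ.subtypeEquiv (p := (· ≠ i)) (q := (· ≠ σ i)) fun x => by simp) (finSuccAboveEquiv i j))
  have h2 := congrArg Subtype.val h
  exact h2.symm

theorem enorm_sum_sq_le {n : ℕ} (f : Fin n → ℂ) : ‖∑ i, f i‖ₑ ^ 2 ≤ n * ∑ i, ‖f i‖ₑ ^ 2 := by
  have h1 : ‖∑ i, f i‖ ^ 2 ≤ n * ∑ i, ‖f i‖ ^ 2 := by
    have h2 := sq_sum_le_card_mul_sum_sq (s := Finset.univ) (f := fun i => ‖f i‖)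
    rw [Finset.card_univ, Fintype.card_fin] at h2
    exact (pow_le_pow_left₀ (norm_nonneg _) (norm_sum_le _ _) 2).trans h2
  have h3 := ENNReal.ofReal_le_ofReal h1
  rw [ENNReal.ofReal_mul (by positivity), ENNReal.ofReal_sum_of_nonneg fun _ _ => sq_nonneg _,
    ENNReal.ofReal_natCast, ENNReal.ofReal_pow (norm_nonneg _), ofReal_norm] at h3
  refine h3.trans_eq ?_
  congr 1
  refine Finset.sum_congr rfl fun i _ => ?_
  rw [ENNReal.ofReal_pow (norm_nonneg _), ofReal_norm]

theorem lintegral_succAbove {h : Momentum → ℂ} (hh : AEStronglyMeasurable h (volume.restrict A))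
    (ψ : Fock A) (ℓ : ℕ) (i : Fin (ℓ + 1)) :
    ∫⁻ k, ‖h (k i) * wave ψ ℓ (fun j => k (i.succAbove j))‖ₑ ^ 2 ∂configMeasure A (ℓ + 1) =
      (∫⁻ q in A, ‖h q‖ₑ ^ 2) * ∫⁻ k, ‖wave ψ ℓ k‖ₑ ^ 2 ∂configMeasure A ℓ := by
  have hmp := measurePreserving_succAbove A i
  have h1 := lintegral_prod_mul (hh.enorm.pow_const 2) (aemeasurable_enorm_sq_wave ψ ℓ)
  rw [← h1, ← hmp.map_eq, lintegral_map' _ hmp.aemeasurable]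
  · refine lintegral_congr fun k => ?_
    rw [enorm_mul, mul_pow]
  · rw [hmp.map_eq]
    exact (hh.enorm.pow_const 2).comp_fst.mul (aemeasurable_enorm_sq_wave ψ ℓ).comp_snd

theorem aestronglyMeasurable_succAbove {h : Momentum → ℂ}
    (hh : AEStronglyMeasurable h (volume.restrict A)) (ψ : Fock A) (ℓ : ℕ) (i : Fin (ℓ + 1)) :
    AEStronglyMeasurable
      (fun k : Fin (ℓ + 1) → Momentum => h (k i) * wave ψ ℓ (fun j => k (i.succAbove j)))
      (configMeasure A (ℓ + 1)) :=
  (hh.comp_quasiMeasurePreserving (quasiMeasurePreserving_apply A i)).mul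
    ((aestronglyMeasurable_wave ψ ℓ).comp_quasiMeasurePreserving
      (quasiMeasurePreserving_succAbove A i))

/-- The wave functions of `a*(h) ψ`. -/
def creationWave (h : Momentum → ℂ) (ψ : Fock A) : ∀ ℓ : ℕ, (Fin ℓ → Momentum) → ℂ
  | 0, _ => 0
  | ℓ + 1, k => ((Real.sqrt (ℓ + 1))⁻¹ : ℝ) *
      ∑ i : Fin (ℓ + 1), h (k i) * wave ψ ℓ (fun j => k (i.succAbove j))

/-- The standard bound ‖a*(h)ψ‖² ≤ ‖h‖²⟨ψ, (N + 1)ψ⟩. Cauchy–Schwarz over the ℓ + 1 summands cancels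
the normalization 1/(ℓ + 1), and each summand has squared norm ‖h‖²‖ψ_ℓ‖². -/
theorem exists_creation {h : Momentum → ℂ} (hh : MemLp h 2 (volume.restrict A)) (ψ : Fock A)
    (hfin : dMass (fun _ => 1) ψ ≠ ∞) :
    ∃ χ, (ψ, χ) ∈ creationGraph A h ∧
      ‖χ‖ₑ ^ 2 ≤ (∫⁻ q in A, ‖h q‖ₑ ^ 2) * (dMass (fun _ => 1) ψ + ‖ψ‖ₑ ^ 2) := by
  have hh2 : ∫⁻ q in A, ‖h q‖ₑ ^ 2 ≠ ∞ := by
    rw [lintegral_enorm_sq]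
    exact ENNReal.pow_ne_top hh.2.ne
  have hmass : mass A (creationWave h ψ) ≤
      (∫⁻ q in A, ‖h q‖ₑ ^ 2) * (dMass (fun _ => 1) ψ + ‖ψ‖ₑ ^ 2) := by
    rw [mass, tsum_eq_zero_add' ENNReal.summable, enorm_sq_eq_mass, dMass, mass, ← ENNReal.tsum_add,
      ← ENNReal.tsum_mul_left]
    have h0 : ∫⁻ k, ‖creationWave h ψ 0 k‖ₑ ^ 2 ∂configMeasure A 0 = 0 := by
      simp [creationWave]
    rw [h0, zero_add]
    refine ENNReal.tsum_le_tsum fun ℓ => ?_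
    have h1 : ∀ k, ‖creationWave h ψ (ℓ + 1) k‖ₑ ^ 2 ≤
        ∑ i : Fin (ℓ + 1), ‖h (k i) * wave ψ ℓ (fun j => k (i.succAbove j))‖ₑ ^ 2 := fun k => by
      have h2 : ‖(((Real.sqrt (ℓ + 1))⁻¹ : ℝ) : ℂ)‖ₑ ^ 2 = ((ℓ + 1 : ℕ) : ℝ≥0∞)⁻¹ := by
        rw [← ofReal_norm, norm_real, Real.norm_eq_abs, ← ENNReal.ofReal_pow (abs_nonneg _), sq_abs,
          inv_pow, Real.sq_sqrt (by positivity), ENNReal.ofReal_inv_of_pos (by positivity)]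
        congr 1
        exact_mod_cast ENNReal.ofReal_natCast (ℓ + 1)
      rw [creationWave, enorm_mul, mul_pow, h2]
      refine (mul_le_mul_right (enorm_sum_sq_le _) _).trans_eq ?_
      rw [← mul_assoc, ENNReal.inv_mul_cancel (by simp) (ENNReal.natCast_ne_top _), one_mul]
    refine (lintegral_mono h1).trans_eq ?_
    rw [lintegral_finsetSum' _ fun i _ =>
        (aestronglyMeasurable_succAbove hh.1 ψ ℓ i).enorm.pow_const 2,
      Finset.sum_congr rfl fun i _ => lintegral_succAbove hh.1 ψ ℓ i, Finset.sum_const,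
      Finset.card_univ, Fintype.card_fin, nsmul_eq_mul]
    have h3 : ∀ k : Fin ℓ → Momentum, dCoeff (fun _ => 1) ℓ k = ℓ := fun k => by simp [dCoeff]
    simp only [h3, ENNReal.ofReal_natCast]
    rw [lintegral_const_mul' _ _ (ENNReal.natCast_ne_top _)]
    push_cast
    ring
  have hFm : ∀ ℓ, AEStronglyMeasurable (creationWave h ψ ℓ) (configMeasure A ℓ) := fun ℓ => by
    cases ℓ with
    | zero => exact aestronglyMeasurable_const
    | succ ℓ =>
      exact aestronglyMeasurable_const.mul
        (Finset.aestronglyMeasurable_fun_sum _ fun i _ => aestronglyMeasurable_succAbove hh.1 ψ ℓ i)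
  have hFs : ∀ ℓ (σ : Equiv.Perm (Fin ℓ)),
      (fun k => creationWave h ψ ℓ (k ∘ σ)) =ᵐ[configMeasure A ℓ] creationWave h ψ ℓ := fun ℓ σ => by
    cases ℓ with
    | zero => exact Filter.EventuallyEq.rfl
    | succ ℓ =>
      choose τ hτ using exists_perm_succAbove σ
      have h1 := ae_all_iff.2 fun i : Fin (ℓ + 1) =>
        (quasiMeasurePreserving_succAbove A (σ i)).ae (wave_comp_perm ψ ℓ (τ i))
      filter_upwards [h1] with k hk
      simp only [creationWave, Function.comp_apply]
      congr 1
      rw [← Equiv.sum_comp σ fun i => h (k i) * wave ψ ℓ (fun j => k (i.succAbove j))]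
      refine Finset.sum_congr rfl fun i _ => ?_
      rw [← hk i]
      congr 2
      funext j
      simp [hτ]
  obtain ⟨χ, hχ⟩ := exists_fock hFm hFs
    (ne_top_of_le_ne_top (by have := enorm_sq_eq_mass ψ; finiteness) hmass)
  refine ⟨χ, ⟨hχ 0, fun ℓ => hχ (ℓ + 1)⟩, ?_⟩
  rw [enorm_sq_eq_mass, mass_congr hχ]
  exact hmass

/-- `a*(h)` is the formal adjoint of `a(h)`. -/
theorem creation_inner_annihilation {h : Momentum → ℂ} (hh : MemLp h 2 (volume.restrict A))
    {φ χ ψ η : Fock A} (hc : (φ, χ) ∈ creationGraph A h) (ha : (ψ, η) ∈ annihilationGraph A h) :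
    ⟪χ, ψ⟫_ℂ = ⟪φ, η⟫_ℂ := by
  have hs := hasSum_inner_wave χ ψ
  have h0 : ∫ k, ⟪wave χ 0 k, wave ψ 0 k⟫_ℂ ∂configMeasure A 0 = 0 := by
    rw [integral_congr_ae (g := fun _ => 0), integral_zero]
    filter_upwards [hc.1] with k hk
    rw [hk, inner_zero_left]
  rw [← hs.tsum_eq, hs.summable.tsum_eq_zero_add, h0, zero_add, ← (hasSum_inner_wave φ η).tsum_eq]
  refine tsum_congr fun ℓ => ?_
  set X : Fin (ℓ + 1) → (Fin (ℓ + 1) → Momentum) → ℂ :=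
    fun i k => h (k i) * wave φ ℓ (fun j => k (i.succAbove j)) with hX
  have hXL : ∀ i, MemLp (X i) 2 (configMeasure A (ℓ + 1)) := by
    refine fun i => ⟨aestronglyMeasurable_succAbove hh.1 φ ℓ i, ?_⟩
    have h1 := lintegral_succAbove hh.1 φ ℓ i
    rw [lintegral_enorm_sq, lintegral_enorm_sq, lintegral_enorm_sq] at h1
    rw [lt_top_iff_ne_top]
    intro h2
    rw [h2] at h1
    exact (ENNReal.mul_ne_top (ENNReal.pow_ne_top hh.2.ne)
      (ENNReal.pow_ne_top (memLp_wave φ ℓ).2.ne)) (h1.symm.trans (by simp))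
  have hint : ∀ i, Integrable (fun k => ⟪X i k, wave ψ (ℓ + 1) k⟫_ℂ) (configMeasure A (ℓ + 1)) := by
    intro i
    have h1 := L2.integrable_inner (𝕜 := ℂ) ((hXL i).toLp (X i)) ((memLp_wave ψ (ℓ + 1)).toLp _)
    refine h1.congr ?_
    filter_upwards [(hXL i).coeFn_toLp, (memLp_wave ψ (ℓ + 1)).coeFn_toLp] with k h2 h3
    rw [h2, h3]
  -- The symmetry of ψ makes all ℓ + 1 terms of the creation operator contribute equally to the
  -- pairing.
  have hperm : ∀ i, ∫ k, ⟪X i k, wave ψ (ℓ + 1) k⟫_ℂ ∂configMeasure A (ℓ + 1) =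
      ∫ k, ⟪X 0 k, wave ψ (ℓ + 1) k⟫_ℂ ∂configMeasure A (ℓ + 1) := by
    intro i
    rw [← integral_comp_perm i.cycleRange (hint i).1]
    refine integral_congr_ae ?_
    filter_upwards [wave_comp_perm ψ (ℓ + 1) i.cycleRange] with k hk
    rw [hk]
    congr 1
    simp [hX]
  have hX0 : ∫ k, ⟪X 0 k, wave ψ (ℓ + 1) k⟫_ℂ ∂configMeasure A (ℓ + 1) =
      ∫ k, ⟪wave φ ℓ k, ∫ q in A, star (h q) * wave ψ (ℓ + 1) (Fin.cons q k)⟫_ℂ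
        ∂configMeasure A ℓ := by
    rw [integral_cons_symm (hint 0)]
    refine integral_congr_ae ?_
    filter_upwards with k
    rw [RCLike.inner_apply, ← integral_mul_const]
    congr 1
    funext q
    simp only [hX, Fin.cons_zero, Fin.zero_succAbove, Fin.cons_succ, RCLike.inner_apply, map_mul]
    change _ = (starRingEnd ℂ) (h q) * _ * _
    ring
  have hleft : ∫ k, ⟪wave χ (ℓ + 1) k, wave ψ (ℓ + 1) k⟫_ℂ ∂configMeasure A (ℓ + 1) =
      (((Real.sqrt (ℓ + 1))⁻¹ : ℝ) : ℂ) *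
        ∑ i, ∫ k, ⟪X i k, wave ψ (ℓ + 1) k⟫_ℂ ∂configMeasure A (ℓ + 1) := by
    rw [← integral_finsetSum _ fun i _ => hint i, ← integral_const_mul]
    refine integral_congr_ae ?_
    filter_upwards [hc.2 ℓ] with k hk
    rw [hk, ← smul_eq_mul, inner_smul_left, conj_ofReal, sum_inner]
  rw [hleft, Finset.sum_congr rfl fun i _ => hperm i, Finset.sum_const, Finset.card_univ,
    Fintype.card_fin, nsmul_eq_mul, hX0, ← mul_assoc]
  -- The ℓ + 1 equal terms turn the factor (ℓ + 1)^{-1/2} of a* into the factor (ℓ + 1)^{1/2} of a.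
  have hsq : (((Real.sqrt (ℓ + 1))⁻¹ : ℝ) : ℂ) * ((ℓ + 1 : ℕ) : ℂ) = ((Real.sqrt (ℓ + 1) : ℝ) : ℂ) := by
    have h1 : (Real.sqrt (ℓ + 1))⁻¹ * ((ℓ + 1 : ℕ) : ℝ) = Real.sqrt (ℓ + 1) := by
      have h2 : (0 : ℝ) < Real.sqrt (ℓ + 1) := by positivity
      have h3 : Real.sqrt (ℓ + 1) * Real.sqrt (ℓ + 1) = ((ℓ + 1 : ℕ) : ℝ) := by
        rw [Real.mul_self_sqrt (by positivity)]; push_cast; ring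
      rw [← h3, inv_mul_cancel_left₀ h2.ne']
    rw [← ofReal_natCast, ← ofReal_mul, h1]
  rw [hsq, ← integral_const_mul]
  refine integral_congr_ae ?_
  filter_upwards [ha ℓ] with k hk
  rw [hk.2]
  exact (inner_smul_right _ _ _).symm

end CreationAnnihilation

end SpinBoson
end

open MeasureTheory Complex
open scoped ENNReal InnerProductSpace
noncomputable section
namespace SpinBoson

/-! ### Fixing the momentum of one photon: the pull-through relations for a(q) -/

section Slices

variable {A : Set Momentum}

/-! ### Slices of Fock vectors -/

/-- `η = a(q) χ`: fixing one photon momentum `q` in `χ` gives `η`. -/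
def IsSlice (q : Momentum) (χ η : Fock A) : Prop :=
  ∀ ℓ : ℕ, ∀ᵐ k ∂configMeasure A ℓ,
    wave η ℓ k = (Real.sqrt (ℓ + 1) : ℝ) * wave χ (ℓ + 1) (Fin.cons q k)

/-- The squared norm of `a(q) χ`. -/
def sliceMass (χ : Fock A) (q : Momentum) : ℝ≥0∞ :=
  ∑' ℓ : ℕ, (ℓ + 1 : ℕ) * ∫⁻ k, ‖wave χ (ℓ + 1) (Fin.cons q k)‖ₑ ^ 2 ∂configMeasure A ℓ

theorem ae_ae_cons_left {ℓ : ℕ} {p : (Fin (ℓ + 1) → Momentum) → Prop}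
    (hp : ∀ᵐ k ∂configMeasure A (ℓ + 1), p k) :
    ∀ᵐ q ∂(volume.restrict A : Measure Momentum), ∀ᵐ k ∂configMeasure A ℓ, p (Fin.cons q k) :=
  Measure.ae_ae_of_ae_prod ((measurePreserving_cons A ℓ).quasiMeasurePreserving.ae hp)

theorem enorm_sqrt_mul_sq (ℓ : ℕ) (z : ℂ) :
    ‖((Real.sqrt (ℓ + 1) : ℝ) : ℂ) * z‖ₑ ^ 2 = (ℓ + 1 : ℕ) * ‖z‖ₑ ^ 2 := by
  rw [enorm_mul, mul_pow]
  congr 1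
  rw [← ofReal_norm, norm_real, Real.norm_eq_abs, ← ENNReal.ofReal_pow (abs_nonneg _), sq_abs,
    Real.sq_sqrt (by positivity)]
  exact_mod_cast ENNReal.ofReal_natCast (ℓ + 1)

theorem IsSlice.enorm_sq {q : Momentum} {χ η : Fock A} (h : IsSlice q χ η) :
    ‖η‖ₑ ^ 2 = sliceMass χ q := by
  rw [enorm_sq_eq_mass, mass_congr h, mass, sliceMass]
  refine tsum_congr fun ℓ => ?_
  simp only [enorm_sqrt_mul_sq]
  rw [lintegral_const_mul' _ _ (ENNReal.natCast_ne_top _)]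

theorem aestronglyMeasurable_wave_cons_left (ψ : Fock A) (ℓ : ℕ) :
    AEStronglyMeasurable (fun p : Momentum × (Fin ℓ → Momentum) =>
      wave ψ (ℓ + 1) (Fin.cons p.1 p.2)) ((volume.restrict A).prod (configMeasure A ℓ)) :=
  (aestronglyMeasurable_wave ψ (ℓ + 1)).comp_measurePreserving (measurePreserving_cons A ℓ)

theorem aemeasurable_lintegral_cons (ψ : Fock A) (ℓ : ℕ) :
    AEMeasurable (fun q => ∫⁻ k, ‖wave ψ (ℓ + 1) (Fin.cons q k)‖ₑ ^ 2 ∂configMeasure A ℓ)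
      (volume.restrict A) :=
  ((aestronglyMeasurable_wave_cons_left ψ ℓ).enorm.pow_const 2).lintegral_prod_right'

theorem aemeasurable_sliceMass (ψ : Fock A) : AEMeasurable (sliceMass ψ) (volume.restrict A) :=
  AEMeasurable.tsum fun ℓ => (aemeasurable_lintegral_cons ψ ℓ).const_mul _

theorem indicator_one_nonneg (S : Set Momentum) (q : Momentum) :
    (0 : ℝ) ≤ S.indicator 1 q :=
  Set.indicator_nonneg (fun _ _ => zero_le_one) q

/-- This is ⟨ψ, N_S ψ⟩ = ∫_S ‖a(q)ψ‖² dq, the identity by which slice estimates are integrated back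
to estimates of ψ. -/
theorem dMass_eq_lintegral {S : Set Momentum} (hS : MeasurableSet S) (ψ : Fock A) :
    dMass (S.indicator 1) ψ = ∫⁻ q in A, S.indicator 1 q * sliceMass ψ q := by
  have hi : ∀ q, ENNReal.ofReal (S.indicator 1 q) = S.indicator 1 q := fun q => by
    by_cases hq : q ∈ S <;> simp [hq]
  rw [dMass_eq (measurable_one.indicator hS) (indicator_one_nonneg S)]
  simp only [sliceMass, hi, ← ENNReal.tsum_mul_left]
  have hm : ∀ ℓ : ℕ, AEMeasurable (fun q => S.indicator (1 : Momentum → ℝ≥0∞) q * ((ℓ + 1 : ℕ) *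
      ∫⁻ k, ‖wave ψ (ℓ + 1) (Fin.cons q k)‖ₑ ^ 2 ∂configMeasure A ℓ)) (volume.restrict A) := fun ℓ =>
    ((measurable_one.indicator hS).aemeasurable).mul ((aemeasurable_lintegral_cons ψ ℓ).const_mul _)
  rw [lintegral_tsum hm]
  refine tsum_congr fun ℓ => ?_
  rw [← lintegral_const_mul' _ _ (ENNReal.natCast_ne_top _)]
  refine lintegral_congr fun q => ?_
  ring

/-- Finite expectation of N_S makes ‖a(q)ψ‖² integrable over S, hence finite for almost every q in
S. -/
theorem exists_isSlice {S : Set Momentum} (hS : MeasurableSet S) (ψ : Fock A)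
    (hfin : dMass (S.indicator 1) ψ ≠ ∞) :
    ∀ᵐ q ∂(volume.restrict A : Measure Momentum), q ∈ S → ∃ η, IsSlice q ψ η := by
  rw [dMass_eq_lintegral hS] at hfin
  have h1 := ae_lt_top' (((measurable_one.indicator hS).aemeasurable).mul
    (aemeasurable_sliceMass ψ)) hfin
  have h2 := ae_all_iff.2 fun ℓ => (aestronglyMeasurable_wave_cons_left ψ ℓ).prodMk_left
  have h3 := ae_all_iff.2 fun ℓ => ae_all_iff.2 fun σ : Equiv.Perm (Fin ℓ) =>
    ae_ae_cons_left (wave_comp_perm ψ (ℓ + 1) (Equiv.Perm.decomposeFin.symm (0, σ)))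
  filter_upwards [h1, h2, h3] with q hq1 hq2 hq3 hqS
  refine exists_fock
    (F := fun ℓ k => ((Real.sqrt (ℓ + 1) : ℝ) : ℂ) * wave ψ (ℓ + 1) (Fin.cons q k))
    (fun ℓ => aestronglyMeasurable_const.mul (hq2 ℓ)) (fun ℓ σ => ?_) ?_
  · filter_upwards [hq3 ℓ σ] with k hk
    rw [← hk]
    congr 2
    funext i
    refine Fin.cases ?_ (fun j => ?_) i
    · simp [Equiv.Perm.decomposeFin_symm_apply_zero]
    · simp [Equiv.Perm.decomposeFin_symm_apply_succ]
  · have h4 : mass A (fun ℓ k => ((Real.sqrt (ℓ + 1) : ℝ) : ℂ) * wave ψ (ℓ + 1) (Fin.cons q k)) =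
        sliceMass ψ q := by
      rw [mass, sliceMass]
      refine tsum_congr fun ℓ => ?_
      simp only [enorm_sqrt_mul_sq]
      rw [lintegral_const_mul' _ _ (ENNReal.natCast_ne_top _)]
    rw [h4]
    simpa [hqS] using hq1.ne

theorem isSlice_add (ψ φ : Fock A) : ∀ᵐ q ∂(volume.restrict A : Measure Momentum),
    ∀ η ξ, IsSlice q ψ η → IsSlice q φ ξ → IsSlice q (ψ + φ) (η + ξ) := by
  have h1 := ae_all_iff.2 fun ℓ => ae_ae_cons_left (wave_add ψ φ (ℓ + 1))
  filter_upwards [h1] with q hq η ξ hη hξ ℓ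
  filter_upwards [hq ℓ, hη ℓ, hξ ℓ, wave_add η ξ ℓ] with k h2 h3 h4 h5
  rw [h5, Pi.add_apply, h3, h4, h2, Pi.add_apply, mul_add]

theorem isSlice_smul (c : ℂ) (ψ : Fock A) : ∀ᵐ q ∂(volume.restrict A : Measure Momentum),
    ∀ η, IsSlice q ψ η → IsSlice q (c • ψ) (c • η) := by
  have h1 := ae_all_iff.2 fun ℓ => ae_ae_cons_left (wave_smul c ψ (ℓ + 1))
  filter_upwards [h1] with q hq η hη ℓ
  filter_upwards [hq ℓ, hη ℓ, wave_smul c η ℓ] with k h2 h3 h5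
  rw [h5, Pi.smul_apply, h3, h2, Pi.smul_apply, smul_eq_mul, smul_eq_mul, mul_left_comm]

theorem IsMul.slice {v : ∀ ℓ : ℕ, (Fin ℓ → Momentum) → ℝ} {ψ χ : Fock A} (h : IsMul v ψ χ) :
    ∀ᵐ q ∂(volume.restrict A : Measure Momentum), ∀ η ξ, IsSlice q ψ η → IsSlice q χ ξ →
      IsMul (fun ℓ k => v (ℓ + 1) (Fin.cons q k)) η ξ := by
  have h1 := ae_all_iff.2 fun ℓ => ae_ae_cons_left (h (ℓ + 1))
  filter_upwards [h1] with q hq η ξ hη hξ ℓ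
  filter_upwards [hq ℓ, hη ℓ, hξ ℓ] with k h2 h3 h4
  rw [h4, h3, h2, mul_left_comm]

theorem dCoeff_cons (w : Momentum → ℝ) (ℓ : ℕ) (q : Momentum) (k : Fin ℓ → Momentum) :
    dCoeff w (ℓ + 1) (Fin.cons q k) = w q + dCoeff w ℓ k := by
  simp [dCoeff, Fin.sum_univ_succ]

/-- The pull-through formula a(q)dΓ(w) = (dΓ(w) + w(q))a(q), from splitting off w(q) in the sum of
the photon energies. -/
theorem isMul_dCoeff_slice {w : Momentum → ℝ} {ψ χ : Fock A} (h : IsMul (dCoeff w) ψ χ) :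
    ∀ᵐ q ∂(volume.restrict A : Measure Momentum), ∀ η ξ, IsSlice q ψ η → IsSlice q χ ξ →
      IsMul (dCoeff w) η (ξ - (w q : ℂ) • η) := by
  filter_upwards [h.slice] with q hq η ξ hη hξ ℓ
  filter_upwards [hq η ξ hη hξ ℓ, wave_sub ξ ((w q : ℂ) • η) ℓ, wave_smul (w q : ℂ) η ℓ]
    with k h1 h2 h3
  rw [h2, Pi.sub_apply, h3, Pi.smul_apply, h1, dCoeff_cons, smul_eq_mul, ofReal_add]
  ring

/-- The commutator of a(q) and a*(h) is h(q), so the two commute where h vanishes: the term creating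
the photon at q drops out. -/
theorem creationGraph_slice {h : Momentum → ℂ} {ψ χ : Fock A} (hg : (ψ, χ) ∈ creationGraph A h) :
    ∀ᵐ q ∂(volume.restrict A : Measure Momentum), h q = 0 → ∀ η ξ, IsSlice q ψ η →
      IsSlice q χ ξ → (η, ξ) ∈ creationGraph A h := by
  have h1 := ae_all_iff.2 fun ℓ => ae_ae_cons_left (hg.2 ℓ)
  filter_upwards [h1] with q hq hq0 η ξ hη hξ
  refine ⟨?_, fun ℓ => ?_⟩
  · filter_upwards [hq 0, hξ 0] with k h2 h3
    rw [h3, h2]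
    simp [hq0]
  · have h4 := ae_all_iff.2 fun i : Fin (ℓ + 1) =>
      (quasiMeasurePreserving_succAbove A i).ae (hη ℓ)
    filter_upwards [hq (ℓ + 1), hξ (ℓ + 1), h4] with k h2 h3 h5
    simp only [h3, h2, h5]
    rw [Fin.sum_univ_succ]
    simp only [Fin.cons_zero, hq0, zero_mul, zero_add, Fin.cons_succ]
    have e1 : ∀ i : Fin (ℓ + 1), (fun j : Fin (ℓ + 1) =>
        (Fin.cons q k : Fin (ℓ + 2) → Momentum) (i.succ.succAbove j)) =
        Fin.cons q (fun j => k (i.succAbove j)) := fun i => by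
      funext j
      refine Fin.cases ?_ (fun j => ?_) j
      · simp
      · simp
    simp only [e1]
    have hpos : ∀ m : ℕ, ((Real.sqrt ((m : ℝ) + 1) : ℝ) : ℂ) ≠ 0 := fun m =>
      ofReal_ne_zero.2 (by positivity)
    rw [← mul_assoc, ofReal_inv, mul_inv_cancel₀ (hpos (ℓ + 1)), one_mul, ofReal_inv,
      Finset.mul_sum]
    refine Finset.sum_congr rfl fun i _ => ?_
    have := hpos ℓ
    field_simp

/-- Annihilation operators commute: the symmetry of ψ under exchange of its first two momenta swaps
the fixed q with the integrated p. -/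
theorem annihilationGraph_slice {h : Momentum → ℂ} {ψ χ : Fock A}
    (hg : (ψ, χ) ∈ annihilationGraph A h) :
    ∀ᵐ q ∂(volume.restrict A : Measure Momentum), ∀ η ξ, IsSlice q ψ η →
      IsSlice q χ ξ → (η, ξ) ∈ annihilationGraph A h := by
  have h1 := ae_all_iff.2 fun ℓ => ae_ae_cons_left (hg (ℓ + 1))
  have h2 := ae_all_iff.2 fun ℓ => ae_ae_cons_left (wave_comp_perm ψ (ℓ + 1 + 1) (Equiv.swap 0 1))
  filter_upwards [h1, h2] with q hq1 hq2 η ξ hη hξ ℓ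
  filter_upwards [hq1 ℓ, ae_ae_cons (hq2 ℓ), ae_ae_cons (hη (ℓ + 1)), hξ ℓ] with k h3 h4 h5 h6
  have h7 : (fun p => star (h p) * wave η (ℓ + 1) (Fin.cons p k)) =ᵐ[volume.restrict A]
      fun p => ((Real.sqrt ((ℓ + 1 : ℕ) + 1) : ℝ) : ℂ) *
        (star (h p) * wave ψ (ℓ + 1 + 1) (Fin.cons p (Fin.cons q k))) := by
    filter_upwards [h4, h5] with p hp4 hp5
    rw [hp5, ← hp4, mul_left_comm]
    congr 3
    have : (Fin.cons q (Fin.cons p k : Fin (ℓ + 1) → Momentum) : Fin (ℓ + 1 + 1) → Momentum) ∘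
        (Equiv.swap 0 1) = Fin.cons p (Fin.cons q k : Fin (ℓ + 1) → Momentum) := by
      funext i
      refine Fin.cases ?_ (fun j => ?_) i
      · simp [Function.comp, Equiv.swap_apply_left]
      · refine Fin.cases ?_ (fun j => ?_) j
        · simp [Function.comp, Equiv.swap_apply_right]
        · have e1 : (Equiv.swap (0 : Fin (ℓ + 1 + 1)) 1) j.succ.succ = j.succ.succ :=
            Equiv.swap_apply_of_ne_of_ne (by simp [Fin.ext_iff]) (by simp [Fin.ext_iff])
          simp [Function.comp, e1]
    rw [this]
  refine ⟨(h3.1.const_mul _).congr h7.symm, ?_⟩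
  rw [integral_congr_ae h7, integral_const_mul, h6, h3.2]

end Slices

/-! ### Sectors with a fixed number of photons in `S` -/

section Sectors

variable {A : Set Momentum} {S : Set Momentum}

/-- Multiplication by a function of the number of photons in `S`. -/
def numCoeff (S : Set Momentum) (F : ℝ → ℝ) (ℓ : ℕ) (k : Fin ℓ → Momentum) : ℝ :=
  F (dCoeff (S.indicator 1) ℓ k)

/-- A photon created by h lies outside S wherever the contribution is nonzero, so the number of
photons in S is unchanged. -/
theorem isMul_creationGraph {h : Momentum → ℂ} (hS : ∀ q ∈ S, h q = 0) {F : ℝ → ℝ}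
    {ψ χ ψ' χ' : Fock A} (hg : (ψ, χ) ∈ creationGraph A h) (hψ : IsMul (numCoeff S F) ψ ψ')
    (hχ : IsMul (numCoeff S F) χ χ') : (ψ', χ') ∈ creationGraph A h := by
  refine ⟨?_, fun ℓ => ?_⟩
  · filter_upwards [hg.1, hχ 0] with k h1 h2
    rw [h2, h1, mul_zero]
  · have h4 := ae_all_iff.2 fun i : Fin (ℓ + 1) =>
      (quasiMeasurePreserving_succAbove A i).ae (hψ ℓ)
    filter_upwards [hg.2 ℓ, hχ (ℓ + 1), h4] with k h1 h2 h3
    rw [h2, h1, mul_left_comm, Finset.mul_sum]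
    congr 1
    refine Finset.sum_congr rfl fun i _ => ?_
    rw [h3]
    by_cases hi : k i ∈ S
    · rw [hS _ hi]; ring
    · have e : dCoeff (S.indicator 1) (ℓ + 1) k =
          dCoeff (S.indicator 1) ℓ (fun j => k (i.succAbove j)) := by
        rw [dCoeff, Fin.sum_univ_succAbove _ i, Set.indicator_of_notMem hi, zero_add, dCoeff]
      rw [numCoeff, numCoeff, e]; ring

theorem isMul_annihilationGraph {h : Momentum → ℂ} (hS : ∀ q ∈ S, h q = 0) {F : ℝ → ℝ}
    {ψ χ ψ' χ' : Fock A} (hg : (ψ, χ) ∈ annihilationGraph A h) (hψ : IsMul (numCoeff S F) ψ ψ')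
    (hχ : IsMul (numCoeff S F) χ χ') : (ψ', χ') ∈ annihilationGraph A h := by
  intro ℓ
  filter_upwards [hg ℓ, hχ ℓ, ae_ae_cons (hψ (ℓ + 1))] with k h1 h2 h3
  have h7 : (fun q => star (h q) * wave ψ' (ℓ + 1) (Fin.cons q k)) =ᵐ[volume.restrict A]
      fun q => ((numCoeff S F ℓ k : ℝ) : ℂ) * (star (h q) * wave ψ (ℓ + 1) (Fin.cons q k)) := by
    filter_upwards [h3] with q hq
    rw [hq]
    by_cases hi : q ∈ S
    · rw [hS _ hi]; simp
    · rw [numCoeff, dCoeff_cons, Set.indicator_of_notMem hi, zero_add, numCoeff]; ring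
  refine ⟨(h1.1.const_mul _).congr h7.symm, ?_⟩
  rw [integral_congr_ae h7, integral_const_mul, h2, h1.2, mul_left_comm]

theorem IsMul.isMul_of_comm {v u : ∀ ℓ : ℕ, (Fin ℓ → Momentum) → ℝ} {ψ χ ψ' χ' : Fock A}
    (hg : IsMul v ψ χ) (hψ : IsMul u ψ ψ') (hχ : IsMul u χ χ') : IsMul v ψ' χ' := fun ℓ => by
  filter_upwards [hg ℓ, hψ ℓ, hχ ℓ] with k h1 h2 h3
  rw [h3, h1, h2, mul_left_comm]

/-- The indicator of having exactly `m` photons in `S`. -/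
abbrev sectorCoeff (S : Set Momentum) (m : ℕ) : ∀ ℓ : ℕ, (Fin ℓ → Momentum) → ℝ :=
  numCoeff S fun x => if x = m then 1 else 0

theorem isMultiplier_numCoeff (hS : MeasurableSet S) {F : ℝ → ℝ} (hF : Measurable F) {C : ℝ}
    (hC : ∀ x, |F x| ≤ C) : IsMultiplier (numCoeff S F) C where
  meas ℓ := hF.comp (measurable_dCoeff (measurable_one.indicator hS) ℓ)
  symm ℓ σ k := by
    rw [numCoeff, (isSymmCoeff_dCoeff (measurable_one.indicator hS)).symm ℓ σ k, numCoeff]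
  bound ℓ k := hC _

theorem sectorCoeff_apply (S : Set Momentum) (m ℓ : ℕ) (k : Fin ℓ → Momentum) :
    sectorCoeff S m ℓ k = if dCoeff (S.indicator 1) ℓ k = m then 1 else 0 := rfl

theorem isMultiplier_sectorCoeff (hS : MeasurableSet S) (m : ℕ) :
    IsMultiplier (sectorCoeff S m) 1 :=
  isMultiplier_numCoeff hS (F := fun x => if x = m then 1 else 0)
    (Measurable.ite (measurableSet_singleton (m : ℝ)) measurable_const measurable_const) fun x => by
      split_ifs <;> norm_num

/-- `ψ` has exactly `m` photons in `S`. -/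
def InSector (S : Set Momentum) (m : ℕ) (ψ : Fock A) : Prop := IsMul (sectorCoeff S m) ψ ψ

theorem InSector.wave_eq_zero {m : ℕ} {ψ : Fock A} (h : InSector S m ψ) (ℓ : ℕ) :
    ∀ᵐ k ∂configMeasure A ℓ, dCoeff (S.indicator 1) ℓ k ≠ m → wave ψ ℓ k = 0 := by
  filter_upwards [h ℓ] with k hk hne
  rw [hk, sectorCoeff_apply, if_neg hne]; simp

theorem inSector_of {m : ℕ} {ψ : Fock A} (h : ∀ ℓ, ∀ᵐ k ∂configMeasure A ℓ,
    dCoeff (S.indicator 1) ℓ k ≠ m → wave ψ ℓ k = 0) : InSector S m ψ := fun ℓ => by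
  filter_upwards [h ℓ] with k hk
  by_cases hm : dCoeff (S.indicator 1) ℓ k = m
  · rw [sectorCoeff_apply, if_pos hm]; simp
  · rw [hk hm, mul_zero]

theorem inSector_mulOp (hS : MeasurableSet S) (m : ℕ) (ψ : Fock A) :
    InSector S m (mulOp A (sectorCoeff S m) ψ) := by
  refine inSector_of fun ℓ => ?_
  filter_upwards [(isMultiplier_sectorCoeff hS m).isMul_mulOp ψ ℓ] with k hk hne
  rw [hk, sectorCoeff_apply, if_neg hne]; simp

theorem InSector.mulOp_eq {m : ℕ} (hS : MeasurableSet S) {ψ : Fock A} (h : InSector S m ψ) :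
    mulOp A (sectorCoeff S m) ψ = ψ :=
  ((isMultiplier_sectorCoeff hS m).isMul_mulOp ψ).unique h

theorem InSector.isMul {m : ℕ} {v : ∀ ℓ : ℕ, (Fin ℓ → Momentum) → ℝ} {ψ χ : Fock A}
    (h : InSector S m ψ) (hm : IsMul v ψ χ) : InSector S m χ := by
  refine inSector_of fun ℓ => ?_
  filter_upwards [h.wave_eq_zero ℓ, hm ℓ] with k h1 h2 h3
  rw [h2, h1 h3, mul_zero]

/-- Projecting the image χ onto the sector gives another value of the same operator at the same
vector; as the graph is single-valued, χ equals its projection. -/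
theorem InSector.creation {m : ℕ} (hS : MeasurableSet S) {h : Momentum → ℂ}
    (hhS : ∀ q ∈ S, h q = 0) {ψ χ : Fock A} (hψ : InSector S m ψ)
    (hg : (ψ, χ) ∈ creationGraph A h) : InSector S m χ := by
  have h1 := isMul_creationGraph hhS hg hψ ((isMultiplier_sectorCoeff hS m).isMul_mulOp χ)
  have h2 : χ - mulOp A (sectorCoeff S m) χ = 0 :=
    creationGraph_functional A h _ ((creationGraph A h).sub_mem hg h1) (sub_self ψ)
  rw [sub_eq_zero.1 h2]
  exact inSector_mulOp hS m χ

theorem InSector.annihilation {m : ℕ} (hS : MeasurableSet S) {h : Momentum → ℂ}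
    (hhS : ∀ q ∈ S, h q = 0) {ψ χ : Fock A} (hψ : InSector S m ψ)
    (hg : (ψ, χ) ∈ annihilationGraph A h) : InSector S m χ := by
  have h1 := isMul_annihilationGraph hhS hg hψ ((isMultiplier_sectorCoeff hS m).isMul_mulOp χ)
  have h2 : χ - mulOp A (sectorCoeff S m) χ = 0 :=
    annihilationGraph_functional A h _ ((annihilationGraph A h).sub_mem hg h1) (sub_self ψ)
  rw [sub_eq_zero.1 h2]
  exact inSector_mulOp hS m χ

theorem InSector.add {m : ℕ} {ψ φ : Fock A} (h : InSector S m ψ) (h' : InSector S m φ) :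
    InSector S m (ψ + φ) := IsMul.add h h'

theorem InSector.smul {m : ℕ} {ψ : Fock A} (h : InSector S m ψ) (c : ℂ) :
    InSector S m (c • ψ) := IsMul.smul h c

theorem InSector.dMass_eq {m : ℕ} {ψ : Fock A} (h : InSector S m ψ) :
    dMass (S.indicator 1) ψ = m * ‖ψ‖ₑ ^ 2 := by
  rw [enorm_sq_eq_mass, dMass, mass, ← ENNReal.tsum_mul_left]
  refine tsum_congr fun ℓ => ?_
  rw [← lintegral_const_mul' _ _ (ENNReal.natCast_ne_top _)]
  refine lintegral_congr_ae ?_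
  filter_upwards [h.wave_eq_zero ℓ] with k hk
  by_cases hm : dCoeff (S.indicator 1) ℓ k = m
  · rw [hm, ENNReal.ofReal_natCast]
  · rw [hk hm]; simp

theorem InSector.slice {m : ℕ} {ψ : Fock A} (h : InSector S (m + 1) ψ) :
    ∀ᵐ q ∂(volume.restrict A : Measure Momentum), q ∈ S → ∀ η, IsSlice q ψ η → InSector S m η := by
  have h1 := ae_all_iff.2 fun ℓ => ae_ae_cons_left (h.wave_eq_zero (ℓ + 1))
  filter_upwards [h1] with q hq hqS η hη
  refine inSector_of fun ℓ => ?_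
  filter_upwards [hq ℓ, hη ℓ] with k h2 h3 h4
  rw [h3, h2, mul_zero]
  rw [dCoeff_cons, Set.indicator_of_mem hqS, Pi.one_apply, Nat.cast_succ, add_comm]
  exact fun h5 => h4 (add_right_cancel h5)

theorem exists_dCoeff_eq_nat (S : Set Momentum) (ℓ : ℕ) (k : Fin ℓ → Momentum) :
    ∃ m : ℕ, dCoeff (S.indicator 1) ℓ k = m := by
  classical
  refine ⟨(Finset.univ.filter fun i => k i ∈ S).card, ?_⟩
  rw [dCoeff, Finset.card_filter, Nat.cast_sum]
  refine Finset.sum_congr rfl fun i _ => ?_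
  by_cases hi : k i ∈ S <;> simp [hi]

/-- Each configuration has exactly one natural number of momenta in S, so the sector indicators sum
to one pointwise. -/
theorem tsum_enorm_sq_sector (hS : MeasurableSet S) (ψ : Fock A) :
    ∑' m, ‖mulOp A (sectorCoeff S m) ψ‖ₑ ^ 2 = ‖ψ‖ₑ ^ 2 := by
  have h1 := fun m => ((isMultiplier_sectorCoeff hS m).isMul_mulOp ψ).mass_eq
  rw [tsum_congr h1, ENNReal.tsum_comm, enorm_sq_eq_mass, mass]
  refine tsum_congr fun ℓ => ?_
  have hm : ∀ m, AEMeasurable (fun k => ENNReal.ofReal (sectorCoeff S m ℓ k ^ 2) *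
      ‖wave ψ ℓ k‖ₑ ^ 2) (configMeasure A ℓ) := fun m =>
    ((ENNReal.measurable_ofReal.comp
      (((isMultiplier_sectorCoeff hS m).meas ℓ).pow_const 2)).aemeasurable).mul
      (aemeasurable_enorm_sq_wave ψ ℓ)
  rw [← lintegral_tsum hm]
  refine lintegral_congr fun k => ?_
  obtain ⟨m₀, hm₀⟩ := exists_dCoeff_eq_nat S ℓ k
  rw [tsum_eq_single m₀]
  · rw [sectorCoeff_apply, if_pos hm₀]; simp
  · intro m hm
    rw [sectorCoeff_apply, if_neg]
    · simp
    · rw [hm₀]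
      exact_mod_cast hm.symm

end Sectors

end SpinBoson
end

open MeasureTheory Complex
open scoped ENNReal InnerProductSpace
noncomputable section
namespace SpinBoson

/-! ### Lower bounds carried from the sector without photons in S to all sectors -/

section PullThrough

variable {A : Set Momentum} {S : Set Momentum}

/-! ### Graphs of operators on the atom-photon space -/

/-- `F = (σ₁ ⊗ (a*(h) + a(h))) ψ`. -/
def IsField (h : Momentum → ℂ) (ψ F : AtomPhoton A) : Prop :=
  ∃ c b : Fin 2 → Fock A, (∀ i, (ψ i, c i) ∈ creationGraph A h) ∧
    (∀ i, (ψ i, b i) ∈ annihilationGraph A h) ∧ ∀ i, F i = c i.rev + b i.rev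

/-- `χ` is obtained from `ψ` by multiplying all wave functions by `v`. -/
def IsMul₂ (v : ∀ ℓ : ℕ, (Fin ℓ → Momentum) → ℝ) (ψ χ : AtomPhoton A) : Prop :=
  ∀ i, IsMul v (ψ i) (χ i)

/-- `χ = (H_at + Φ + dΓ(w)) ψ` with the coupling `h σ₁`. -/
def IsHam (h : Momentum → ℂ) (w : Momentum → ℝ) (ψ χ : AtomPhoton A) : Prop :=
  ∃ F d, IsField h ψ F ∧ IsMul₂ (dCoeff w) ψ d ∧ χ = matrixOp A atomMatrix ψ + F + d

theorem atomMatrix_apply (ψ : AtomPhoton A) (i : Fin 2) :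
    matrixOp A atomMatrix ψ i = (atomMatrix i i) • ψ i := by
  change ∑ j, atomMatrix i j • ψ j = _
  fin_cases i <;> simp [Fin.sum_univ_two, atomMatrix]

theorem enorm_sq_atomPhoton (ψ : AtomPhoton A) : ‖ψ‖ₑ ^ 2 = ∑ i, ‖ψ i‖ₑ ^ 2 := by
  have h := PiLp.norm_sq_eq_of_L2 (fun _ : Fin 2 => Fock A) ψ
  have h2 := congrArg ENNReal.ofReal h
  rw [ENNReal.ofReal_sum_of_nonneg fun _ _ => sq_nonneg _, ENNReal.ofReal_pow (norm_nonneg _),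
    ofReal_norm] at h2
  rw [h2]
  refine Finset.sum_congr rfl fun i _ => ?_
  rw [ENNReal.ofReal_pow (norm_nonneg _), ofReal_norm]

/-- Componentwise application of an operator on Fock space. -/
def liftOp (L : Fock A →L[ℂ] Fock A) : AtomPhoton A →L[ℂ] AtomPhoton A where
  toFun ψ := WithLp.toLp 2 fun i => L (ψ i)
  map_add' ψ φ := by ext1 i; exact map_add L _ _
  map_smul' c ψ := by ext1 i; exact map_smul L c _
  cont := by fun_prop

theorem liftOp_apply (L : Fock A →L[ℂ] Fock A) (ψ : AtomPhoton A) (i : Fin 2) :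
    liftOp L ψ i = L (ψ i) := rfl

theorem IsMultiplier.isMul₂ {v : ∀ ℓ : ℕ, (Fin ℓ → Momentum) → ℝ} {C : ℝ} (hv : IsMultiplier v C)
    (ψ : AtomPhoton A) : IsMul₂ v ψ (liftOp (mulOp A v) ψ) := fun i => hv.isMul_mulOp (ψ i)

theorem isHam_liftOp (hSh : ∀ q ∈ S, (h : Momentum → ℂ) q = 0) {F : ℝ → ℝ} {C : ℝ}
    (hF : IsMultiplier (numCoeff S F) C) {w : Momentum → ℝ} {ψ χ : AtomPhoton A}
    (hH : IsHam h w ψ χ) :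
    IsHam h w (liftOp (mulOp A (numCoeff S F)) ψ) (liftOp (mulOp A (numCoeff S F)) χ) := by
  obtain ⟨G, d, ⟨c, b, hc, hb, hG⟩, hd, rfl⟩ := hH
  refine ⟨liftOp (mulOp A (numCoeff S F)) G, liftOp (mulOp A (numCoeff S F)) d,
    ⟨fun i => mulOp A (numCoeff S F) (c i), fun i => mulOp A (numCoeff S F) (b i), fun i => ?_,
      fun i => ?_, fun i => ?_⟩, fun i => ?_, ?_⟩
  · exact isMul_creationGraph hSh (hc i) (hF.isMul_mulOp _) (hF.isMul_mulOp _)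
  · exact isMul_annihilationGraph hSh (hb i) (hF.isMul_mulOp _) (hF.isMul_mulOp _)
  · rw [liftOp_apply, hG, map_add]
  · exact (hd i).isMul_of_comm (hF.isMul_mulOp _) (hF.isMul_mulOp _)
  · rw [map_add, map_add]
    congr 2
    ext1 i
    rw [liftOp_apply, atomMatrix_apply, atomMatrix_apply, map_smul, liftOp_apply]

/-- In the sector with `m` photons in `S`, lower bounds on an operator not acting on these photons
follow from the sector without photons in `S`. -/
theorem sector_lower_bound (hS : MeasurableSet S) {h : Momentum → ℂ} (hSh : ∀ q ∈ S, h q = 0)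
    {w u : Momentum → ℝ} (hSw : ∀ q ∈ S, w q = 0) {s : ℂ} {τ : ℝ≥0∞}
    (base : ∀ ψ χ : AtomPhoton A, (∃ d, IsMul₂ (dCoeff u) ψ d) → (∀ i, InSector S 0 (ψ i)) →
      IsHam h w ψ χ → τ * ‖ψ‖ₑ ^ 2 ≤ ‖χ + s • ψ‖ₑ ^ 2) (m : ℕ) :
    ∀ ψ χ : AtomPhoton A, (∃ d, IsMul₂ (dCoeff u) ψ d) → (∀ i, InSector S m (ψ i)) →
      IsHam h w ψ χ → τ * ‖ψ‖ₑ ^ 2 ≤ ‖χ + s • ψ‖ₑ ^ 2 := by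
  induction m with
  | zero => exact base
  | succ m ih =>
    rintro ψ χ ⟨d', hd'⟩ hψ ⟨G, d, ⟨c, b, hc, hb, hG⟩, hd, rfl⟩
    set X : AtomPhoton A := matrixOp A atomMatrix ψ + G + d + s • ψ with hX
    have hXi : ∀ i, X i = (atomMatrix i i + s) • ψ i + (c i.rev + b i.rev) + d i := fun i => by
      rw [hX]
      change matrixOp A atomMatrix ψ i + G i + d i + s • ψ i = _
      rw [atomMatrix_apply, hG, add_smul]
      abel
    have hsc := fun i => (hψ i).creation hS hSh (hc i)
    have hsb := fun i => (hψ i).annihilation hS hSh (hb i)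
    have hsd := fun i => (hψ i).isMul (hd i)
    have hsd' := fun i => (hψ i).isMul (hd' i)
    have hsX : ∀ i, InSector S (m + 1) (X i) := fun i => by
      rw [hXi]
      exact (((hψ i).smul _).add ((hsc _).add (hsb _))).add (hsd i)
    have hfin : ∀ φ : Fock A, InSector S (m + 1) φ → dMass (S.indicator 1) φ ≠ ∞ := fun φ hφ => by
      rw [hφ.dMass_eq]; finiteness
    have hsl := fun (φ : Fock A) (hφ : InSector S (m + 1) φ) => exists_isSlice hS φ (hfin φ hφ)
    -- For almost every q in S, the slice a(q)ψ lies in the sector with one photon fewer and a(q)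
    -- commutes with the operator. So the induction hypothesis applies to each slice.
    have hslice : ∀ᵐ q ∂(volume.restrict A : Measure Momentum),
        S.indicator (1 : Momentum → ℝ≥0∞) q * (τ * ∑ i, sliceMass (ψ i) q) ≤
          S.indicator (1 : Momentum → ℝ≥0∞) q * ∑ i, sliceMass (X i) q := by
      filter_upwards [ae_all_iff.2 fun i => hsl _ (hψ i), ae_all_iff.2 fun i => hsl _ (hsc i),
        ae_all_iff.2 fun i => hsl _ (hsb i), ae_all_iff.2 fun i => hsl _ (hsd i),
        ae_all_iff.2 fun i => hsl _ (hsd' i), ae_all_iff.2 fun i => creationGraph_slice (hc i),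
        ae_all_iff.2 fun i => annihilationGraph_slice (hb i),
        ae_all_iff.2 fun i => isMul_dCoeff_slice (hd i),
        ae_all_iff.2 fun i => isMul_dCoeff_slice (hd' i),
        ae_all_iff.2 fun i => (hψ i).slice,
        ae_all_iff.2 fun i => isSlice_smul (atomMatrix i i + s) (ψ i),
        ae_all_iff.2 fun i : Fin 2 => isSlice_add (c i.rev) (b i.rev),
        ae_all_iff.2 fun i => isSlice_add ((atomMatrix i i + s) • ψ i) (c i.rev + b i.rev),
        ae_all_iff.2 fun i =>
          isSlice_add ((atomMatrix i i + s) • ψ i + (c i.rev + b i.rev)) (d i)]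
        with q eψ ec eb ed ed' hc' hb' hm hm' hsec a1 a2 a3 a4
      by_cases hq : q ∈ S
      · choose η hη using fun i => eψ i hq
        choose ξc hξc using fun i => ec i hq
        choose ξb hξb using fun i => eb i hq
        choose ξd hξd using fun i => ed i hq
        choose ξd' hξd' using fun i => ed' i hq
        have hYs : ∀ i, IsSlice q (X i)
            ((atomMatrix i i + s) • η i + (ξc i.rev + ξb i.rev) + ξd i) := fun i => by
          rw [hXi]
          exact a4 i _ _ (a3 i _ _ (a1 i _ (hη i)) (a2 i _ _ (hξc _) (hξb _))) (hξd i)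
        have hH : IsHam h w (WithLp.toLp 2 η : AtomPhoton A)
            (matrixOp A atomMatrix (WithLp.toLp 2 η) + WithLp.toLp 2 (fun i => ξc i.rev + ξb i.rev) +
              WithLp.toLp 2 ξd) := by
          refine ⟨_, _, ⟨ξc, ξb, fun i => hc' i (hSh q hq) _ _ (hη i) (hξc i),
            fun i => hb' i _ _ (hη i) (hξb i), fun i => rfl⟩, fun i => ?_, rfl⟩
          -- The energy shift w(q) of the pull-through formula vanishes because w is zero on S.
          have := hm i _ _ (hη i) (hξd i)
          rw [hSw q hq, ofReal_zero, zero_smul, sub_zero] at this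
          exact this
        have h1 := ih _ _ ⟨WithLp.toLp 2 fun i => ξd' i - (u q : ℂ) • η i,
          fun i => hm' i _ _ (hη i) (hξd' i)⟩ (fun i => hsec i hq _ (hη i)) hH
        rw [enorm_sq_atomPhoton, enorm_sq_atomPhoton] at h1
        have h2 : ∀ i, (matrixOp A atomMatrix (WithLp.toLp 2 η) +
            WithLp.toLp 2 (fun i => ξc i.rev + ξb i.rev) + WithLp.toLp 2 ξd +
            s • WithLp.toLp 2 η : AtomPhoton A) i =
            (atomMatrix i i + s) • η i + (ξc i.rev + ξb i.rev) + ξd i := fun i => by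
          change matrixOp A atomMatrix (WithLp.toLp 2 η) i + (ξc i.rev + ξb i.rev) + ξd i +
            s • η i = _
          rw [atomMatrix_apply, add_smul]
          change atomMatrix i i • η i + _ + _ + _ = _
          abel
        have e1 : ∑ i, ‖(matrixOp A atomMatrix (WithLp.toLp 2 η) +
            WithLp.toLp 2 (fun i => ξc i.rev + ξb i.rev) + WithLp.toLp 2 ξd +
            s • WithLp.toLp 2 η : AtomPhoton A) i‖ₑ ^ 2 = ∑ i, sliceMass (X i) q :=
          Finset.sum_congr rfl fun i _ => by rw [h2 i, (hYs i).enorm_sq]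
        have e2 : ∑ i, ‖(WithLp.toLp 2 η : AtomPhoton A) i‖ₑ ^ 2 = ∑ i, sliceMass (ψ i) q :=
          Finset.sum_congr rfl fun i _ => (hη i).enorm_sq
        rw [e1, e2] at h1
        gcongr
      · simp [hq]
    -- In the sector with m + 1 photons in S, integrating ‖a(q)φ‖² over S counts φ exactly m + 1
    -- times; the same factor appears on both sides and cancels.
    have hint : ∀ φ : AtomPhoton A, (∀ i, InSector S (m + 1) (φ i)) →
        ∫⁻ q in A, S.indicator (1 : Momentum → ℝ≥0∞) q * ∑ i, sliceMass (φ i) q =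
          (m + 1 : ℕ) * ‖φ‖ₑ ^ 2 := fun φ hφ => by
      have hm : ∀ i, AEMeasurable
          (fun q => S.indicator (1 : Momentum → ℝ≥0∞) q * sliceMass (φ i) q)
          (volume.restrict A) := fun i =>
        ((measurable_one.indicator hS).aemeasurable).mul (aemeasurable_sliceMass (φ i))
      rw [enorm_sq_atomPhoton, Finset.mul_sum]
      simp only [Finset.mul_sum]
      rw [lintegral_finsetSum' _ fun i _ => hm i]
      refine Finset.sum_congr rfl fun i _ => ?_
      rw [← (hφ i).dMass_eq]
      exact (dMass_eq_lintegral hS _).symm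
    have h1 := lintegral_mono_ae hslice
    rw [hint X hsX] at h1
    have h2 : ∫⁻ q in A, S.indicator (1 : Momentum → ℝ≥0∞) q * (τ * ∑ i, sliceMass (ψ i) q) =
        τ * ((m + 1 : ℕ) * ‖ψ‖ₑ ^ 2) := by
      rw [← hint ψ hψ, ← lintegral_const_mul'']
      · refine lintegral_congr fun q => ?_
        ring
      · exact ((measurable_one.indicator hS).aemeasurable).mul
          (Finset.aemeasurable_fun_sum _ fun i _ => aemeasurable_sliceMass (ψ i))
    rw [h2, mul_left_comm] at h1
    exact (ENNReal.mul_le_mul_iff_right (by simp) (ENNReal.natCast_ne_top _)).1 h1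

theorem tsum_enorm_sq_liftOp_sector (hS : MeasurableSet S) (φ : AtomPhoton A) :
    ∑' m, ‖liftOp (mulOp A (sectorCoeff S m)) φ‖ₑ ^ 2 = ‖φ‖ₑ ^ 2 := by
  have h1 : ∀ m, ‖liftOp (mulOp A (sectorCoeff S m)) φ‖ₑ ^ 2 =
      ∑ i, ‖mulOp A (sectorCoeff S m) (φ i)‖ₑ ^ 2 := fun m => enorm_sq_atomPhoton _
  rw [tsum_congr h1, enorm_sq_atomPhoton, Summable.tsum_finsetSum fun i _ => ENNReal.summable]
  exact Finset.sum_congr rfl fun i _ => tsum_enorm_sq_sector hS (φ i)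

/-- The operator preserves each sector and the squared norms on both sides are the sums of those of
the sector components. -/
theorem all_sectors_lower_bound (hS : MeasurableSet S) {h : Momentum → ℂ}
    (hSh : ∀ q ∈ S, h q = 0) {w u : Momentum → ℝ} (hSw : ∀ q ∈ S, w q = 0) {s : ℂ} {τ : ℝ≥0∞}
    (base : ∀ ψ χ : AtomPhoton A, (∃ d, IsMul₂ (dCoeff u) ψ d) → (∀ i, InSector S 0 (ψ i)) →
      IsHam h w ψ χ → τ * ‖ψ‖ₑ ^ 2 ≤ ‖χ + s • ψ‖ₑ ^ 2) (ψ χ : AtomPhoton A)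
    (hu : ∃ d, IsMul₂ (dCoeff u) ψ d) (hH : IsHam h w ψ χ) :
    τ * ‖ψ‖ₑ ^ 2 ≤ ‖χ + s • ψ‖ₑ ^ 2 := by
  obtain ⟨d, hd⟩ := hu
  rw [← tsum_enorm_sq_liftOp_sector hS ψ, ← tsum_enorm_sq_liftOp_sector hS (χ + s • ψ),
    ← ENNReal.tsum_mul_left]
  refine ENNReal.tsum_le_tsum fun m => ?_
  have hm : IsMultiplier (sectorCoeff S m) 1 := isMultiplier_sectorCoeff hS m
  have hd' : IsMul₂ (dCoeff u) (liftOp (mulOp A (sectorCoeff S m)) ψ)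
      (liftOp (mulOp A (sectorCoeff S m)) d) :=
    fun i => (hd i).isMul_of_comm (hm.isMul_mulOp _) (hm.isMul_mulOp _)
  have hH' : IsHam h w (liftOp (mulOp A (sectorCoeff S m)) ψ)
      (liftOp (mulOp A (sectorCoeff S m)) χ) :=
    isHam_liftOp (F := fun x => if x = m then 1 else 0) hSh hm hH
  have hs : ∀ i, InSector S m (liftOp (mulOp A (sectorCoeff S m)) ψ i) :=
    fun i => inSector_mulOp hS m (ψ i)
  have h1 := sector_lower_bound hS hSh hSw base m _ _ ⟨_, hd'⟩ hs hH'
  have h2 : liftOp (mulOp A (sectorCoeff S m)) (χ + s • ψ) =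
      liftOp (mulOp A (sectorCoeff S m)) χ + s • liftOp (mulOp A (sectorCoeff S m)) ψ := by
    rw [map_add, map_smul]
  rw [h2]
  exact h1

end PullThrough

end SpinBoson
end

open MeasureTheory Complex
open scoped ENNReal InnerProductSpace
noncomputable section
namespace SpinBoson

/-! ### Quadratic forms of second quantized operators and bounds on the field operator -/

section Forms

variable {A : Set Momentum} {v v' : ∀ ℓ : ℕ, (Fin ℓ → Momentum) → ℝ}
  {ψ ψ' χ χ' : AtomPhoton A}

/-! ### Multiplication operators on the atom-photon space and their quadratic forms -/

theorem inner_atomPhoton (ψ χ : AtomPhoton A) : ⟪ψ, χ⟫_ℂ = ∑ i, ⟪ψ i, χ i⟫_ℂ :=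
  PiLp.inner_apply _ _

theorem norm_sq_atomPhoton (ψ : AtomPhoton A) : ‖ψ‖ ^ 2 = ∑ i, ‖ψ i‖ ^ 2 :=
  PiLp.norm_sq_eq_of_L2 (fun _ : Fin 2 => Fock A) ψ

theorem re_inner_atomPhoton (ψ χ : AtomPhoton A) :
    (⟪ψ, χ⟫_ℂ).re = ∑ i, (⟪ψ i, χ i⟫_ℂ).re := by
  rw [inner_atomPhoton, Complex.re_sum]

theorem re_inner_self_eq (ψ : AtomPhoton A) : (⟪ψ, ψ⟫_ℂ).re = ‖ψ‖ ^ 2 := by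
  rw [inner_self_eq_norm_sq_to_K]
  norm_cast

theorem IsMul₂.unique (h : IsMul₂ v ψ χ) (h' : IsMul₂ v ψ χ') : χ = χ' := by
  ext1 i
  exact (h i).unique (h' i)

theorem IsMul₂.congr (h : IsMul₂ v ψ χ) (hv : ∀ ℓ, v ℓ =ᵐ[configMeasure A ℓ] v' ℓ) :
    IsMul₂ v' ψ χ := fun i => (h i).congr hv

theorem IsMul₂.add (h : IsMul₂ v ψ χ) (h' : IsMul₂ v ψ' χ') : IsMul₂ v (ψ + ψ') (χ + χ') :=
  fun i => (h i).add (h' i)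

theorem IsMul₂.smul (h : IsMul₂ v ψ χ) (c : ℂ) : IsMul₂ v (c • ψ) (c • χ) :=
  fun i => (h i).smul c

theorem IsMul₂.add_coeff (h : IsMul₂ v ψ χ) (h' : IsMul₂ v' ψ χ') :
    IsMul₂ (fun ℓ k => v ℓ k + v' ℓ k) ψ (χ + χ') := fun i => (h i).add_coeff (h' i)

theorem IsMul₂.sub_coeff (h : IsMul₂ v ψ χ) (h' : IsMul₂ v' ψ χ') :
    IsMul₂ (fun ℓ k => v ℓ k - v' ℓ k) ψ (χ - χ') := fun i => (h i).sub_coeff (h' i)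

theorem IsMul₂.smul_coeff (h : IsMul₂ v ψ χ) (c : ℝ) :
    IsMul₂ (fun ℓ k => c * v ℓ k) ψ ((c : ℂ) • χ) := fun i => (h i).smul_coeff c

theorem IsMul₂.inner_comm (h : IsMul₂ v ψ χ) (h' : IsMul₂ v ψ' χ') : ⟪χ, ψ'⟫_ℂ = ⟪ψ, χ'⟫_ℂ := by
  rw [inner_atomPhoton, inner_atomPhoton]
  exact Finset.sum_congr rfl fun i _ => (h i).inner_comm (h' i)

theorem IsMul₂.re_inner_le (h : IsMul₂ v ψ χ) (h' : IsMul₂ v' ψ χ')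
    (hv : ∀ ℓ, ∀ᵐ k ∂configMeasure A ℓ, v ℓ k ≤ v' ℓ k) :
    (⟪ψ, χ⟫_ℂ).re ≤ (⟪ψ, χ'⟫_ℂ).re := by
  rw [re_inner_atomPhoton, re_inner_atomPhoton]
  exact Finset.sum_le_sum fun i _ => (h i).re_inner_le (h' i) hv

open Classical in
/-- The quadratic form `⟨ψ, v ψ⟩` of a multiplication operator. -/
def mulForm (v : ∀ ℓ : ℕ, (Fin ℓ → Momentum) → ℝ) (ψ : AtomPhoton A) : ℝ :=
  if h : ∃ χ, IsMul₂ v ψ χ then (⟪ψ, h.choose⟫_ℂ).re else 0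

theorem IsMul₂.mulForm_eq (h : IsMul₂ v ψ χ) : mulForm v ψ = (⟪ψ, χ⟫_ℂ).re := by
  have h' : ∃ χ, IsMul₂ v ψ χ := ⟨χ, h⟩
  rw [mulForm, dif_pos h', h'.choose_spec.unique h]

/-- The dispersion relation `ω(k) = |k|`. -/
abbrev dispersion : Momentum → ℝ := fun k => ‖k‖

/-- The vectors in the domain of `1 ⊗ dΓ(ω)`. -/
def FreeDomain (ψ : AtomPhoton A) : Prop := ∃ d, IsMul₂ (dCoeff dispersion) ψ d

/-- `|w| ≤ C ω` on `A`. -/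
structure RelBounded (A : Set Momentum) (w : Momentum → ℝ) (C : ℝ) : Prop where
  meas : Measurable w
  bound : ∀ᵐ q ∂(volume.restrict A : Measure Momentum), |w q| ≤ C * ‖q‖

theorem dCoeff_mono_ae {w w' : Momentum → ℝ}
    (h : ∀ᵐ q ∂(volume.restrict A : Measure Momentum), w q ≤ w' q) (ℓ : ℕ) :
    ∀ᵐ k ∂configMeasure A ℓ, dCoeff w ℓ k ≤ dCoeff w' ℓ k := by
  filter_upwards [ae_forall_apply (ℓ := ℓ) h] with k hk
  exact Finset.sum_le_sum fun i _ => hk i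

theorem dCoeff_congr_ae {w w' : Momentum → ℝ} (h : w =ᵐ[volume.restrict A] w') (ℓ : ℕ) :
    dCoeff w ℓ =ᵐ[configMeasure A ℓ] dCoeff w' ℓ := by
  filter_upwards [ae_forall_apply (ℓ := ℓ) h] with k hk
  exact Finset.sum_congr rfl fun i _ => hk i

theorem dCoeff_add (w w' : Momentum → ℝ) (ℓ : ℕ) (k : Fin ℓ → Momentum) :
    dCoeff (fun q => w q + w' q) ℓ k = dCoeff w ℓ k + dCoeff w' ℓ k :=
  Finset.sum_add_distrib

theorem dCoeff_const_mul (c : ℝ) (w : Momentum → ℝ) (ℓ : ℕ) (k : Fin ℓ → Momentum) :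
    dCoeff (fun q => c * w q) ℓ k = c * dCoeff w ℓ k :=
  (Finset.mul_sum _ _ _).symm

theorem FreeDomain.exists_isMul₂ (hψ : FreeDomain ψ) {w : Momentum → ℝ} {C : ℝ}
    (hw : RelBounded A w C) : ∃ d, IsMul₂ (dCoeff w) ψ d := by
  obtain ⟨d, hd⟩ := hψ
  have h1 : ∀ ℓ, ∀ᵐ k ∂configMeasure A ℓ, |dCoeff w ℓ k| ≤ C * |dCoeff dispersion ℓ k| := by
    intro ℓ
    filter_upwards [ae_forall_apply (ℓ := ℓ) hw.bound] with k hk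
    rw [abs_of_nonneg (dCoeff_nonneg (fun q => norm_nonneg q) ℓ k)]
    calc |dCoeff w ℓ k| ≤ ∑ i, |w (k i)| := Finset.abs_sum_le_sum_abs _ _
      _ ≤ ∑ i, C * ‖k i‖ := Finset.sum_le_sum fun i _ => hk i
      _ = C * dCoeff dispersion ℓ k := (Finset.mul_sum _ _ _).symm
  choose D hD using fun i => (isSymmCoeff_dCoeff hw.meas).exists_isMul_of_le (hd i) h1
  exact ⟨WithLp.toLp 2 D, hD⟩

/-- The quadratic form of `1 ⊗ dΓ(w)`. -/
abbrev numForm (w : Momentum → ℝ) (ψ : AtomPhoton A) : ℝ := mulForm (dCoeff w) ψ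

theorem FreeDomain.numForm_mono (hψ : FreeDomain ψ) {w w' : Momentum → ℝ} {C C' : ℝ}
    (hw : RelBounded A w C) (hw' : RelBounded A w' C')
    (h : ∀ᵐ q ∂(volume.restrict A : Measure Momentum), w q ≤ w' q) :
    numForm w ψ ≤ numForm w' ψ := by
  obtain ⟨d, hd⟩ := hψ.exists_isMul₂ hw
  obtain ⟨d', hd'⟩ := hψ.exists_isMul₂ hw'
  rw [numForm, numForm, hd.mulForm_eq, hd'.mulForm_eq]
  exact hd.re_inner_le hd' (dCoeff_mono_ae h)

theorem FreeDomain.numForm_add (hψ : FreeDomain ψ) {w w' : Momentum → ℝ} {C C' : ℝ}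
    (hw : RelBounded A w C) (hw' : RelBounded A w' C') :
    numForm (fun q => w q + w' q) ψ = numForm w ψ + numForm w' ψ := by
  obtain ⟨d, hd⟩ := hψ.exists_isMul₂ hw
  obtain ⟨d', hd'⟩ := hψ.exists_isMul₂ hw'
  have h1 : IsMul₂ (dCoeff fun q => w q + w' q) ψ (d + d') :=
    (hd.add_coeff hd').congr fun ℓ => by
      filter_upwards with k
      exact (dCoeff_add w w' ℓ k).symm
  rw [numForm, numForm, numForm, hd.mulForm_eq, hd'.mulForm_eq, h1.mulForm_eq, inner_add_right,
    Complex.add_re]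

theorem FreeDomain.numForm_const_mul (hψ : FreeDomain ψ) {w : Momentum → ℝ} {C : ℝ}
    (hw : RelBounded A w C) (c : ℝ) : numForm (fun q => c * w q) ψ = c * numForm w ψ := by
  obtain ⟨d, hd⟩ := hψ.exists_isMul₂ hw
  have h1 : IsMul₂ (dCoeff fun q => c * w q) ψ ((c : ℂ) • d) :=
    (hd.smul_coeff c).congr fun ℓ => by
      filter_upwards with k
      exact (dCoeff_const_mul c w ℓ k).symm
  rw [numForm, numForm, hd.mulForm_eq, h1.mulForm_eq, inner_smul_right, Complex.re_ofReal_mul]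

theorem RelBounded.const_mul {w : Momentum → ℝ} {C : ℝ} (hw : RelBounded A w C) (c : ℝ) :
    RelBounded A (fun q => c * w q) (|c| * C) where
  meas := hw.meas.const_mul c
  bound := by
    filter_upwards [hw.bound] with q h1
    rw [abs_mul, mul_assoc]
    exact mul_le_mul_of_nonneg_left h1 (abs_nonneg c)

theorem RelBounded.indicator {w : Momentum → ℝ} {C : ℝ} (hw : RelBounded A w C)
    {S : Set Momentum} (hS : MeasurableSet S) : RelBounded A (S.indicator w) C where
  meas := hw.meas.indicator hS
  bound := by
    filter_upwards [hw.bound] with q h1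
    by_cases hq : q ∈ S
    · rwa [Set.indicator_of_mem hq]
    · rw [Set.indicator_of_notMem hq, abs_zero]
      exact (abs_nonneg _).trans h1

theorem relBounded_dispersion : RelBounded A dispersion 1 where
  meas := measurable_norm
  bound := by
    filter_upwards with q
    rw [one_mul, abs_norm]

theorem relBounded_one {m₀ : ℝ} (hm : 0 < m₀)
    (hA : ∀ᵐ q ∂(volume.restrict A : Measure Momentum), m₀ ≤ ‖q‖) :
    RelBounded A (fun _ => 1) m₀⁻¹ where
  meas := measurable_const
  bound := by
    filter_upwards [hA] with q hq
    rw [abs_one, inv_mul_eq_div, one_le_div hm]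
    exact hq

theorem FreeDomain.numForm_nonneg (hψ : FreeDomain ψ) {w : Momentum → ℝ} {C : ℝ}
    (hw : RelBounded A w C) (h : ∀ q, 0 ≤ w q) : 0 ≤ numForm w ψ := by
  obtain ⟨d, hd⟩ := hψ.exists_isMul₂ hw
  rw [numForm, hd.mulForm_eq, re_inner_atomPhoton]
  exact Finset.sum_nonneg fun i _ => ((hd i).ofReal_inner fun ℓ => by
    filter_upwards with k
    exact dCoeff_nonneg h ℓ k).1

/-! ### The field operator -/

theorem IsMul.ofReal_re_inner_eq_dMass {w : Momentum → ℝ} (hw : ∀ q, 0 ≤ w q) {ψ d : Fock A}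
    (h : IsMul (dCoeff w) ψ d) : 0 ≤ (⟪ψ, d⟫_ℂ).re ∧ dMass w ψ = ENNReal.ofReal (⟪ψ, d⟫_ℂ).re :=
  have h1 := h.ofReal_inner fun ℓ => by
    filter_upwards with k
    exact dCoeff_nonneg hw ℓ k
  ⟨h1.1, h1.2.symm⟩

theorem ofReal_toReal_coupling {h : Momentum → ℂ} (hh : MemLp h 2 (volume.restrict A)) :
    ∫⁻ q in A, ‖h q‖ₑ ^ 2 = ENNReal.ofReal (∫⁻ q in A, ‖h q‖ₑ ^ 2).toReal := by
  rw [ENNReal.ofReal_toReal]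
  rw [lintegral_enorm_sq]
  exact ENNReal.pow_ne_top hh.eLpNorm_ne_top

theorem enorm_sq_eq_ofReal {E : Type*} [SeminormedAddCommGroup E] (x : E) :
    ‖x‖ₑ ^ 2 = ENNReal.ofReal (‖x‖ ^ 2) := by
  rw [ENNReal.ofReal_pow (norm_nonneg _), ofReal_norm]

theorem annihilation_norm_sq_le {h : Momentum → ℂ} (hh : MemLp h 2 (volume.restrict A))
    {S : Set Momentum} (hS : MeasurableSet S) (hhS : ∀ q ∉ S, h q = 0) {ψ b d : Fock A}
    (hb : (ψ, b) ∈ annihilationGraph A h) (hd : IsMul (dCoeff (S.indicator 1)) ψ d) :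
    ‖b‖ ^ 2 ≤ (∫⁻ q in A, ‖h q‖ₑ ^ 2).toReal * (⟪ψ, d⟫_ℂ).re := by
  obtain ⟨h0, h1⟩ := hd.ofReal_re_inner_eq_dMass (indicator_one_nonneg S)
  obtain ⟨b', hb', hle⟩ := exists_annihilation hh hS hhS ψ (by rw [h1]; exact ENNReal.ofReal_ne_top)
  have hbb : b = b' := by
    have h2 := (annihilationGraph A h).sub_mem hb hb'
    exact sub_eq_zero.1 (annihilationGraph_functional A h _ h2 (sub_self ψ))
  rw [← hbb, h1, ofReal_toReal_coupling hh, enorm_sq_eq_ofReal,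
    ← ENNReal.ofReal_mul ENNReal.toReal_nonneg] at hle
  exact (ENNReal.ofReal_le_ofReal_iff (mul_nonneg ENNReal.toReal_nonneg h0)).1 hle

theorem creation_norm_sq_le {h : Momentum → ℂ} (hh : MemLp h 2 (volume.restrict A))
    {ψ c d : Fock A} (hc : (ψ, c) ∈ creationGraph A h) (hd : IsMul (dCoeff fun _ => 1) ψ d) :
    ‖c‖ ^ 2 ≤ (∫⁻ q in A, ‖h q‖ₑ ^ 2).toReal * ((⟪ψ, d⟫_ℂ).re + ‖ψ‖ ^ 2) := by
  obtain ⟨h0, h1⟩ := hd.ofReal_re_inner_eq_dMass fun _ => zero_le_one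
  obtain ⟨c', hc', hle⟩ := exists_creation hh ψ (by rw [h1]; exact ENNReal.ofReal_ne_top)
  have hcc : c = c' := by
    have h2 := (creationGraph A h).sub_mem hc hc'
    exact sub_eq_zero.1 (creationGraph_functional A h _ h2 (sub_self ψ))
  rw [← hcc, h1, ofReal_toReal_coupling hh, enorm_sq_eq_ofReal, enorm_sq_eq_ofReal,
    ← ENNReal.ofReal_add h0 (sq_nonneg _), ← ENNReal.ofReal_mul ENNReal.toReal_nonneg] at hle
  exact (ENNReal.ofReal_le_ofReal_iff
    (mul_nonneg ENNReal.toReal_nonneg (add_nonneg h0 (sq_nonneg _)))).1 hle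

theorem FreeDomain.exists_isField (hψ : FreeDomain ψ) {C : ℝ}
    (h1 : RelBounded A (fun _ => 1) C) {h : Momentum → ℂ} (hh : MemLp h 2 (volume.restrict A)) :
    ∃ F, IsField h ψ F := by
  obtain ⟨d, hd⟩ := hψ.exists_isMul₂ h1
  have hfin : ∀ i, dMass (fun _ => 1) (ψ i) ≠ ∞ := fun i => by
    rw [((hd i).ofReal_re_inner_eq_dMass fun _ => zero_le_one).2]
    exact ENNReal.ofReal_ne_top
  choose c hc _ using fun i => exists_creation hh (ψ i) (hfin i)
  have hu : (Set.univ : Set Momentum).indicator (1 : Momentum → ℝ) = fun _ => 1 :=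
    Set.indicator_univ _
  choose b hb _ using fun i => exists_annihilation hh MeasurableSet.univ
    (fun q hq => absurd (Set.mem_univ q) hq) (ψ i) (by rw [hu]; exact hfin i)
  exact ⟨WithLp.toLp 2 fun i => c i.rev + b i.rev, c, b, hc, hb, fun i => rfl⟩

theorem IsField.unique {h : Momentum → ℂ} {F F' : AtomPhoton A} (hF : IsField h ψ F)
    (hF' : IsField h ψ F') : F = F' := by
  obtain ⟨c, b, hc, hb, hG⟩ := hF
  obtain ⟨c', b', hc', hb', hG'⟩ := hF'
  ext1 i
  have h1 : c = c' := funext fun i => sub_eq_zero.1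
    (creationGraph_functional A h _ ((creationGraph A h).sub_mem (hc i) (hc' i)) (sub_self _))
  have h2 : b = b' := funext fun i => sub_eq_zero.1
    (annihilationGraph_functional A h _ ((annihilationGraph A h).sub_mem (hb i) (hb' i))
      (sub_self _))
  rw [hG, hG', h1, h2]

theorem creationGraph_add_coupling {h h' : Momentum → ℂ} {ψ c c' : Fock A}
    (hc : (ψ, c) ∈ creationGraph A h) (hc' : (ψ, c') ∈ creationGraph A h') :
    (ψ, c + c') ∈ creationGraph A (fun q => h q + h' q) := by
  refine ⟨?_, fun ℓ => ?_⟩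
  · filter_upwards [hc.1, hc'.1, wave_add c c' 0] with k h1 h2 h3
    rw [h3, Pi.add_apply, h1, h2, add_zero]
  · filter_upwards [hc.2 ℓ, hc'.2 ℓ, wave_add c c' (ℓ + 1)] with k h1 h2 h3
    simp only [h3, Pi.add_apply, h1, h2, add_mul, Finset.sum_add_distrib, mul_add]

theorem annihilationGraph_add_coupling {h h' : Momentum → ℂ} {ψ b b' : Fock A}
    (hb : (ψ, b) ∈ annihilationGraph A h) (hb' : (ψ, b') ∈ annihilationGraph A h') :
    (ψ, b + b') ∈ annihilationGraph A (fun q => h q + h' q) := by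
  intro ℓ
  filter_upwards [hb ℓ, hb' ℓ, wave_add b b' ℓ] with k h1 h2 h3
  simp only [star_add, add_mul]
  exact ⟨h1.1.add h2.1, by rw [integral_add h1.1 h2.1, h3, Pi.add_apply, h1.2, h2.2, mul_add]⟩

theorem IsField.add_coupling {h h' : Momentum → ℂ} {F F' : AtomPhoton A} (hF : IsField h ψ F)
    (hF' : IsField h' ψ F') : IsField (fun q => h q + h' q) ψ (F + F') := by
  obtain ⟨c, b, hc, hb, hG⟩ := hF
  obtain ⟨c', b', hc', hb', hG'⟩ := hF'
  refine ⟨fun i => c i + c' i, fun i => b i + b' i,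
    fun i => creationGraph_add_coupling (hc i) (hc' i),
    fun i => annihilationGraph_add_coupling (hb i) (hb' i), fun i => ?_⟩
  change F i + F' i = _
  rw [hG, hG']
  exact add_add_add_comm _ _ _ _

theorem IsField.inner_comm {h : Momentum → ℂ} (hh : MemLp h 2 (volume.restrict A))
    {F F' : AtomPhoton A} (hF : IsField h ψ F) (hF' : IsField h ψ' F') :
    ⟪F, ψ'⟫_ℂ = ⟪ψ, F'⟫_ℂ := by
  obtain ⟨c, b, hc, hb, hG⟩ := hF
  obtain ⟨c', b', hc', hb', hG'⟩ := hF'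
  have h1 : ∀ i j, ⟪c i, ψ' j⟫_ℂ = ⟪ψ i, b' j⟫_ℂ := fun i j =>
    creation_inner_annihilation hh (hc i) (hb' j)
  have h2 : ∀ i j, ⟪b i, ψ' j⟫_ℂ = ⟪ψ i, c' j⟫_ℂ := fun i j => by
    rw [← inner_conj_symm, ← creation_inner_annihilation hh (hc' j) (hb i), inner_conj_symm]
  simp only [inner_atomPhoton, Fin.sum_univ_two, hG, hG', inner_add_left, inner_add_right, h1, h2]
  simp only [show (0 : Fin 2).rev = 1 from rfl, show (1 : Fin 2).rev = 0 from rfl]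
  ring

theorem IsField.norm_sq_le {h : Momentum → ℂ} (hh : MemLp h 2 (volume.restrict A))
    {F : AtomPhoton A} (hF : IsField h ψ F) (hψ : ∃ d, IsMul₂ (dCoeff fun _ => 1) ψ d) :
    ‖F‖ ^ 2 ≤ 4 * (∫⁻ q in A, ‖h q‖ₑ ^ 2).toReal * (numForm (fun _ => 1) ψ + ‖ψ‖ ^ 2) := by
  obtain ⟨d, hd⟩ := hψ
  obtain ⟨c, b, hc, hb, hG⟩ := hF
  set H := (∫⁻ q in A, ‖h q‖ₑ ^ 2).toReal
  have hH : 0 ≤ H := ENNReal.toReal_nonneg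
  have hu : (Set.univ : Set Momentum).indicator (1 : Momentum → ℝ) = fun _ => 1 :=
    Set.indicator_univ _
  have h1 : ∀ i, ‖c i + b i‖ ^ 2 ≤ 4 * H * ((⟪ψ i, d i⟫_ℂ).re + ‖ψ i‖ ^ 2) := fun i => by
    have e1 := creation_norm_sq_le hh (hc i) (hd i)
    have e2 := annihilation_norm_sq_le hh MeasurableSet.univ
      (fun q hq => absurd (Set.mem_univ q) hq) (hb i) (by rw [hu]; exact hd i)
    have e3 := norm_add_le (c i) (b i)
    have e4 : ‖c i + b i‖ ^ 2 ≤ 2 * ‖c i‖ ^ 2 + 2 * ‖b i‖ ^ 2 := by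
      nlinarith [norm_nonneg (c i + b i), sq_nonneg (‖c i‖ - ‖b i‖)]
    nlinarith [mul_nonneg hH (sq_nonneg ‖ψ i‖)]
  rw [numForm, hd.mulForm_eq, norm_sq_atomPhoton F, norm_sq_atomPhoton ψ, re_inner_atomPhoton,
    ← Finset.sum_add_distrib, Finset.mul_sum]
  calc ∑ i, ‖F i‖ ^ 2 = ∑ i : Fin 2, ‖c i + b i‖ ^ 2 := by
        simp only [Fin.sum_univ_two, hG, show (0 : Fin 2).rev = 1 from rfl,
          show (1 : Fin 2).rev = 0 from rfl]
        ring
    _ ≤ _ := Finset.sum_le_sum fun i _ => h1 i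

/-- In the expectation the creation part can be moved to the other side as an annihilation part. So
only the number operator on the support of h enters, without the usual + 1, and the bound vanishes
on vectors having no photons there. -/
theorem IsField.re_inner_sq_le {h : Momentum → ℂ} (hh : MemLp h 2 (volume.restrict A))
    {S : Set Momentum} (hS : MeasurableSet S) (hhS : ∀ q ∉ S, h q = 0)
    {F : AtomPhoton A} (hF : IsField h ψ F) (hψ : ∃ d, IsMul₂ (dCoeff (S.indicator 1)) ψ d) :
    (⟪ψ, F⟫_ℂ).re ^ 2 ≤
      4 * (∫⁻ q in A, ‖h q‖ₑ ^ 2).toReal * numForm (S.indicator 1) ψ * ‖ψ‖ ^ 2 := by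
  obtain ⟨d, hd⟩ := hψ
  obtain ⟨c, b, hc, hb, hG⟩ := hF
  set H := (∫⁻ q in A, ‖h q‖ₑ ^ 2).toReal
  have h1 : ∀ i j, (⟪ψ j, c i⟫_ℂ).re = (⟪ψ i, b j⟫_ℂ).re := fun i j => by
    rw [← creation_inner_annihilation hh (hc i) (hb j), ← inner_conj_symm, Complex.conj_re]
  have h2 : ∀ i, ‖b i‖ ^ 2 ≤ H * (⟪ψ i, d i⟫_ℂ).re := fun i =>
    annihilation_norm_sq_le hh hS hhS (hb i) (hd i)
  have h3 : (⟪ψ, F⟫_ℂ).re = 2 * ((⟪ψ 1, b 0⟫_ℂ).re + (⟪ψ 0, b 1⟫_ℂ).re) := by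
    simp only [re_inner_atomPhoton, Fin.sum_univ_two, hG, inner_add_right, Complex.add_re, h1]
    simp only [show (0 : Fin 2).rev = 1 from rfl, show (1 : Fin 2).rev = 0 from rfl]
    ring
  have h4 : |(⟪ψ 1, b 0⟫_ℂ).re + (⟪ψ 0, b 1⟫_ℂ).re| ≤ ‖ψ 1‖ * ‖b 0‖ + ‖ψ 0‖ * ‖b 1‖ :=
    (abs_add_le _ _).trans (add_le_add
      ((Complex.abs_re_le_norm _).trans (norm_inner_le_norm _ _))
      ((Complex.abs_re_le_norm _).trans (norm_inner_le_norm _ _)))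
  have h5 : ((⟪ψ 1, b 0⟫_ℂ).re + (⟪ψ 0, b 1⟫_ℂ).re) ^ 2 ≤
      (‖ψ 1‖ * ‖b 0‖ + ‖ψ 0‖ * ‖b 1‖) ^ 2 := sq_le_sq' (by linarith [(abs_le.1 h4).1])
        (abs_le.1 h4).2
  have h6 : (‖ψ 1‖ * ‖b 0‖ + ‖ψ 0‖ * ‖b 1‖) ^ 2 ≤
      -- Cauchy–Schwarz in ℂ²; the square used is the defect in Lagrange's identity.
      (‖ψ 0‖ ^ 2 + ‖ψ 1‖ ^ 2) * (‖b 0‖ ^ 2 + ‖b 1‖ ^ 2) := by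
    nlinarith [sq_nonneg (‖ψ 1‖ * ‖b 1‖ - ‖ψ 0‖ * ‖b 0‖)]
  rw [h3, numForm, hd.mulForm_eq, norm_sq_atomPhoton ψ, re_inner_atomPhoton]
  simp only [Fin.sum_univ_two]
  have h7 : (‖ψ 0‖ ^ 2 + ‖ψ 1‖ ^ 2) * (‖b 0‖ ^ 2 + ‖b 1‖ ^ 2) ≤
      (‖ψ 0‖ ^ 2 + ‖ψ 1‖ ^ 2) * (H * (⟪ψ 0, d 0⟫_ℂ).re + H * (⟪ψ 1, d 1⟫_ℂ).re) :=
    mul_le_mul_of_nonneg_left (add_le_add (h2 0) (h2 1)) (by positivity)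
  nlinarith

end Forms

end SpinBoson
end

open MeasureTheory Complex
open scoped ENNReal InnerProductSpace
noncomputable section
namespace SpinBoson

/-! ### Graphs of sums and compositions of unbounded operators -/

section Graphs

variable {E : Type*} [NormedAddCommGroup E] [NormedSpace ℂ E]

theorem mem_graph_add {T T' : E →ₗ.[ℂ] E} {x y : E} :
    (x, y) ∈ (T + T').graph ↔ ∃ a b, (x, a) ∈ T.graph ∧ (x, b) ∈ T'.graph ∧ y = a + b := by
  simp only [LinearPMap.mem_graph_iff]
  constructor
  · rintro ⟨z, rfl, rfl⟩
    exact ⟨_, _, ⟨⟨z, z.2.1⟩, rfl, rfl⟩, ⟨⟨z, z.2.2⟩, rfl, rfl⟩, rfl⟩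
  · rintro ⟨_, _, ⟨z, rfl, rfl⟩, ⟨z', hz, rfl⟩, rfl⟩
    have h1 : (z : E) ∈ T'.domain := by
      have := z'.2
      rwa [hz] at this
    refine ⟨⟨z, z.2, h1⟩, rfl, ?_⟩
    rw [LinearPMap.add_apply]
    congr 2
    exact Subtype.ext hz.symm

theorem mem_graph_compPMap {T : E →ₗ.[ℂ] E} {L : E →ₗ[ℂ] E} {x y : E} :
    (x, y) ∈ (L.compPMap T).graph ↔ ∃ a, (x, a) ∈ T.graph ∧ y = L a := by
  simp only [LinearPMap.mem_graph_iff]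
  constructor
  · rintro ⟨z, rfl, rfl⟩
    exact ⟨_, ⟨z, rfl, rfl⟩, rfl⟩
  · rintro ⟨_, ⟨z, rfl, rfl⟩, rfl⟩
    exact ⟨z, rfl, rfl⟩

theorem mem_graph_toPMap_top {L : E →ₗ[ℂ] E} {x y : E} :
    (x, y) ∈ (L.toPMap ⊤).graph ↔ y = L x := by
  simp only [LinearPMap.mem_graph_iff]
  constructor
  · rintro ⟨z, rfl, rfl⟩
    rfl
  · rintro rfl
    exact ⟨⟨x, trivial⟩, rfl, rfl⟩

/-- A Neumann series argument: an approximate right inverse `B` of `T + s` onto the domain. -/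
theorem neg_mem_resolventSet [CompleteSpace E] {T : E →ₗ.[ℂ] E} {B : E →L[ℂ] E} {s : ℝ}
    (hdom : ∀ φ, B φ ∈ T.domain)
    (hle : ∀ φ, ‖T ⟨B φ, hdom φ⟩ + (s : ℂ) • B φ - φ‖ ≤ 3 / 4 * ‖φ‖)
    (hB : ∀ ψ : T.domain, ∃ φ, B φ = ψ) : ((-s : ℝ) : ℂ) ∈ resolventSet T := by
  let K : E →ₗ[ℂ] E :=
    T.toFun ∘ₗ (B.toLinearMap.codRestrict _ hdom) + (s : ℂ) • B.toLinearMap - LinearMap.id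
  have hKa : ∀ φ, K φ = T ⟨B φ, hdom φ⟩ + (s : ℂ) • B φ - φ := fun φ => rfl
  have hKb : ∀ φ, ‖K φ‖ ≤ 3 / 4 * ‖φ‖ := hle
  clear_value K
  have hK' : ‖-K.mkContinuous (3 / 4) hKb‖ < 1 := by
    rw [norm_neg]
    exact (LinearMap.mkContinuous_norm_le _ (by norm_num) _).trans_lt (by norm_num)
  have hC : IsUnit (1 - -K.mkContinuous (3 / 4) hKb) := isUnit_one_sub_of_norm_lt_one hK'
  refine ⟨_, isResolvent_of_factor hC (fun φ => ⟨hdom φ, ?_⟩) hB⟩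
  have e : (1 - -K.mkContinuous (3 / 4) hKb) φ = φ - -(K φ) := rfl
  rw [e, hKa, Complex.ofReal_neg, neg_smul, sub_neg_eq_add, sub_neg_eq_add, add_sub_cancel]

end Graphs

/-! ### The spin-boson operator: domain, self-adjointness and symmetry -/

section Operators

variable {A : Set Momentum} {h : Momentum → ℂ} {w : Momentum → ℝ} {ψ χ : AtomPhoton A}

theorem mem_graph_photonOp {T : Fock A →ₗ.[ℂ] Fock A} :
    (ψ, χ) ∈ (photonOp A T).graph ↔ ∀ i, (ψ i, χ i) ∈ T.graph := by
  simp only [LinearPMap.mem_graph_iff]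
  constructor
  · rintro ⟨z, rfl, rfl⟩ i
    exact ⟨⟨_, z.2 i⟩, rfl, rfl⟩
  · intro H
    choose z hz hz' using H
    have h1 : ∀ i, ψ i ∈ T.domain := fun i => by
      rw [← hz i]
      exact (z i).2
    refine ⟨⟨ψ, h1⟩, rfl, ?_⟩
    ext1 i
    change T ⟨ψ i, h1 i⟩ = χ i
    rw [← hz' i]
    congr 1
    exact Subtype.ext (hz i).symm

theorem mem_graph_dGamma {ψ χ : Fock A} :
    (ψ, χ) ∈ (dGamma A w).graph ↔ IsMul (dCoeff w) ψ χ := by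
  rw [dGamma, Submodule.toLinearPMap_graph_eq _ fun p hp => dGammaGraph_functional A w p hp]
  rfl

theorem mem_graph_photonOp_dGamma :
    (ψ, χ) ∈ (photonOp A (dGamma A w)).graph ↔ IsMul₂ (dCoeff w) ψ χ := by
  rw [mem_graph_photonOp]
  exact forall_congr' fun i => mem_graph_dGamma

theorem matrixOp_sigma1_apply (ψ : AtomPhoton A) (i : Fin 2) :
    matrixOp A sigma1 ψ i = ψ i.rev := by
  change ∑ j, sigma1 i j • ψ j = _
  fin_cases i <;> simp [Fin.sum_univ_two, sigma1]

theorem sigma1_conjTranspose : sigma1.conjTranspose = sigma1 := by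
  ext i j
  fin_cases i <;> fin_cases j <;> simp [sigma1]

theorem mem_graph_fieldOp :
    (ψ, χ) ∈ (fieldOp A sigma1 h).graph ↔ IsField h ψ χ := by
  rw [fieldOp, sigma1_conjTranspose, mem_graph_add]
  simp only [mem_graph_compPMap, mem_graph_photonOp, creation, annihilation]
  rw [Submodule.toLinearPMap_graph_eq _ fun p hp => creationGraph_functional A h p hp,
    Submodule.toLinearPMap_graph_eq _ fun p hp => annihilationGraph_functional A h p hp]
  constructor
  · rintro ⟨_, _, ⟨c, hc, rfl⟩, ⟨b, hb, rfl⟩, rfl⟩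
    refine ⟨c, b, hc, hb, fun i => ?_⟩
    change matrixOp A sigma1 c i + matrixOp A sigma1 b i = _
    rw [matrixOp_sigma1_apply, matrixOp_sigma1_apply]
  · rintro ⟨c, b, hc, hb, hG⟩
    refine ⟨_, _, ⟨WithLp.toLp 2 c, hc, rfl⟩, ⟨WithLp.toLp 2 b, hb, rfl⟩, ?_⟩
    ext1 i
    change χ i = matrixOp A sigma1 (WithLp.toLp 2 c) i + matrixOp A sigma1 (WithLp.toLp 2 b) i
    rw [matrixOp_sigma1_apply, matrixOp_sigma1_apply, hG]

/-- `H_at + Φ(h σ₁) + dΓ(w)` on `ℂ² ⊗ 𝓕[L²(A)]`. -/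
def spinBoson (A : Set Momentum) (h : Momentum → ℂ) (w : Momentum → ℝ) :
    AtomPhoton A →ₗ.[ℂ] AtomPhoton A :=
  (matrixOp A atomMatrix).toLinearMap.toPMap ⊤ + fieldOp A sigma1 h + photonOp A (dGamma A w)

/-- From here on the operator is handled through the relation `IsHam`, which carries its domain
conditions inside the existential witnesses. -/
theorem mem_graph_spinBoson : (ψ, χ) ∈ (spinBoson A h w).graph ↔ IsHam h w ψ χ := by
  rw [spinBoson, mem_graph_add]
  simp only [mem_graph_add, mem_graph_toPMap_top, mem_graph_fieldOp, mem_graph_photonOp_dGamma]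
  constructor
  · rintro ⟨_, d, ⟨_, F, rfl, hF, rfl⟩, hd, rfl⟩
    exact ⟨F, d, hF, hd, rfl⟩
  · rintro ⟨F, d, hF, hd, rfl⟩
    exact ⟨_, d, ⟨_, F, rfl, hF, rfl⟩, hd, rfl⟩

theorem isHam_spinBoson (ψ : (spinBoson A h w).domain) : IsHam h w ψ (spinBoson A h w ψ) :=
  mem_graph_spinBoson.1 (LinearPMap.mem_graph _ ψ)

theorem IsHam.exists_mem (H : IsHam h w ψ χ) :
    ∃ hψ : ψ ∈ (spinBoson A h w).domain, spinBoson A h w ⟨ψ, hψ⟩ = χ := by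
  obtain ⟨z, hz, hz'⟩ := (LinearPMap.mem_graph_iff _).1 (mem_graph_spinBoson.2 H)
  subst hz
  exact ⟨z.2, hz'⟩

theorem IsHam.unique {χ' : AtomPhoton A} (H : IsHam h w ψ χ) (H' : IsHam h w ψ χ') : χ = χ' := by
  obtain ⟨h1, rfl⟩ := H.exists_mem
  obtain ⟨h2, rfl⟩ := H'.exists_mem
  rfl

theorem IsHam.congr_dispersion {w' : Momentum → ℝ} (H : IsHam h w ψ χ)
    (hw : w =ᵐ[volume.restrict A] w') : IsHam h w' ψ χ := by
  obtain ⟨F, d, hF, hd, rfl⟩ := H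
  exact ⟨F, d, hF, hd.congr fun ℓ => dCoeff_congr_ae hw ℓ, rfl⟩

theorem IsHam.add_isMul₂ {w' : Momentum → ℝ} {d : AtomPhoton A} (H : IsHam h w ψ χ)
    (hd : IsMul₂ (dCoeff w') ψ d) : IsHam h (fun q => w q + w' q) ψ (χ + d) := by
  obtain ⟨F, d', hF, hd', rfl⟩ := H
  refine ⟨F, d' + d, hF, (hd'.add_coeff hd).congr fun ℓ => ?_, by rw [add_assoc]⟩
  filter_upwards with k
  exact (dCoeff_add w w' ℓ k).symm

theorem IsHam.sub_isMul₂ {w' : Momentum → ℝ} {d : AtomPhoton A} (H : IsHam h w ψ χ)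
    (hd : IsMul₂ (dCoeff w') ψ d) : IsHam h (fun q => w q - w' q) ψ (χ - d) := by
  obtain ⟨F, d', hF, hd', rfl⟩ := H
  refine ⟨F, d' - d, hF, (hd'.sub_coeff hd).congr fun ℓ => ?_, by rw [add_sub_assoc]⟩
  filter_upwards with k
  exact (Finset.sum_sub_distrib _ _).symm

theorem IsHam.add_isField {h' : Momentum → ℂ} {F : AtomPhoton A} (H : IsHam h w ψ χ)
    (hF : IsField h' ψ F) : IsHam (fun q => h q + h' q) w ψ (χ + F) := by
  obtain ⟨F', d, hF', hd, rfl⟩ := H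
  exact ⟨F' + F, d, hF'.add_coupling hF, hd, by abel⟩

theorem IsHam.freeDomain (H : IsHam h dispersion ψ χ) : FreeDomain ψ :=
  let ⟨_, d, _, hd, _⟩ := H
  ⟨d, hd⟩

theorem FreeDomain.exists_isHam (hψ : FreeDomain ψ) {C : ℝ}
    (h1 : RelBounded A (fun _ => 1) C) (hh : MemLp h 2 (volume.restrict A)) :
    ∃ χ, IsHam h dispersion ψ χ := by
  obtain ⟨F, hF⟩ := hψ.exists_isField h1 hh
  obtain ⟨d, hd⟩ := hψ
  exact ⟨_, F, d, hF, hd, rfl⟩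

theorem inner_atomMatrix_comm (ψ φ : AtomPhoton A) :
    ⟪matrixOp A atomMatrix ψ, φ⟫_ℂ = ⟪ψ, matrixOp A atomMatrix φ⟫_ℂ := by
  simp only [inner_atomPhoton, atomMatrix_apply, inner_smul_left, inner_smul_right]
  simp [Fin.sum_univ_two, atomMatrix, Complex.conj_ofNat]

theorem IsHam.inner_comm (hh : MemLp h 2 (volume.restrict A)) {ψ' χ' : AtomPhoton A}
    (H : IsHam h w ψ χ) (H' : IsHam h w ψ' χ') : ⟪χ, ψ'⟫_ℂ = ⟪ψ, χ'⟫_ℂ := by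
  obtain ⟨F, d, hF, hd, rfl⟩ := H
  obtain ⟨F', d', hF', hd', rfl⟩ := H'
  rw [inner_add_left, inner_add_left, inner_add_right, inner_add_right, inner_atomMatrix_comm,
    hF.inner_comm hh hF', hd.inner_comm hd']

/-! ### Self-adjointness -/

/-- The resolvent `(dΓ(ω) + s)⁻¹` as a multiplication operator. -/
def freeResolventCoeff (s : ℝ) (ℓ : ℕ) (k : Fin ℓ → Momentum) : ℝ :=
  (dCoeff dispersion ℓ k + s)⁻¹

theorem isMultiplier_freeResolventCoeff {s : ℝ} (hs : 0 < s) :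
    IsMultiplier (freeResolventCoeff s) s⁻¹ where
  meas ℓ := ((measurable_dCoeff measurable_norm ℓ).add_const s).inv
  symm ℓ σ k := by
    rw [freeResolventCoeff, (isSymmCoeff_dCoeff measurable_norm).symm ℓ σ k, freeResolventCoeff]
  bound ℓ k := by
    have h0 : 0 ≤ dCoeff dispersion ℓ k := dCoeff_nonneg (fun q => norm_nonneg q) ℓ k
    rw [freeResolventCoeff, abs_of_nonneg (by positivity)]
    exact inv_anti₀ hs (by linarith)

theorem norm_atomMatrix_le (ψ : AtomPhoton A) : ‖matrixOp A atomMatrix ψ‖ ≤ 2 * ‖ψ‖ := by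
  refine (sq_le_sq₀ (norm_nonneg _) (by positivity)).1 ?_
  rw [mul_pow, norm_sq_atomPhoton, norm_sq_atomPhoton]
  simp only [atomMatrix_apply, Fin.sum_univ_two, norm_smul]
  simp only [atomMatrix, Matrix.of_apply, Matrix.cons_val', Matrix.cons_val_zero,
    Matrix.cons_val_one, Matrix.cons_val_fin_one, norm_zero, RCLike.norm_ofNat]
  nlinarith [sq_nonneg ‖ψ 1‖]

theorem exists_freeResolvent (A : Set Momentum) {s : ℝ} (hs : 0 < s) :
    ∃ B : AtomPhoton A →L[ℂ] AtomPhoton A,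
      (∀ φ, ∃ d, IsMul₂ (dCoeff dispersion) (B φ) d ∧ d + (s : ℂ) • B φ = φ ∧
        (⟪B φ, d⟫_ℂ).re ≤ s⁻¹ * ‖φ‖ ^ 2 ∧ ‖B φ‖ ≤ s⁻¹ * ‖φ‖) ∧
      ∀ ψ, FreeDomain ψ → ∃ φ, B φ = ψ := by
  have hR := isMultiplier_freeResolventCoeff hs
  have hnn : ∀ ℓ (k : Fin ℓ → Momentum), 0 ≤ dCoeff dispersion ℓ k :=
    fun ℓ k => dCoeff_nonneg (fun q => norm_nonneg q) ℓ k
  refine ⟨liftOp (mulOp A (freeResolventCoeff s)), fun φ => ?_, fun ψ ⟨d, hd⟩ => ?_⟩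
  · have hB := hR.isMul₂ φ
    set B := liftOp (mulOp A (freeResolventCoeff s)) φ
    have h1 : IsMul₂ (dCoeff dispersion) B (φ - (s : ℂ) • B) := fun i ℓ => by
      filter_upwards [hB i ℓ, wave_sub (φ i) ((s : ℂ) • B i) ℓ, wave_smul (s : ℂ) (B i) ℓ]
        with k e1 e2 e3
      have e4 : wave ((φ - (s : ℂ) • B) i) ℓ k = wave (φ i) ℓ k - (s : ℂ) * wave (B i) ℓ k := by
        change wave (φ i - (s : ℂ) • B i) ℓ k = _
        rw [e2, Pi.sub_apply, e3, Pi.smul_apply, smul_eq_mul]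
      have e5 : ((dCoeff dispersion ℓ k : ℝ) : ℂ) + s ≠ 0 := by
        have : (dCoeff dispersion ℓ k + s : ℝ) ≠ 0 := by linarith [hnn ℓ k]
        exact_mod_cast this
      rw [e4, e1, freeResolventCoeff]
      push_cast
      field_simp
      ring
    have hle : ‖B‖ ≤ s⁻¹ * ‖φ‖ := by
      refine (sq_le_sq₀ (norm_nonneg _) (by positivity)).1 ?_
      rw [mul_pow, norm_sq_atomPhoton, norm_sq_atomPhoton, Finset.mul_sum]
      refine Finset.sum_le_sum fun i _ => ?_
      rw [← mul_pow]
      refine pow_le_pow_left₀ (norm_nonneg _) ?_ 2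
      exact (hB i).norm_le (by positivity) fun ℓ => by
        filter_upwards with k
        exact hR.bound ℓ k
    refine ⟨_, h1, sub_add_cancel _ _, ?_, hle⟩
    have h2 : (⟪B, φ - (s : ℂ) • B⟫_ℂ).re = (⟪B, φ⟫_ℂ).re - s * ‖B‖ ^ 2 := by
      rw [inner_sub_right, inner_smul_right, Complex.sub_re, Complex.re_ofReal_mul,
        re_inner_self_eq]
    have h3 : (⟪B, φ⟫_ℂ).re ≤ ‖B‖ * ‖φ‖ := re_inner_le_norm (𝕜 := ℂ) B φ
    rw [h2]
    nlinarith [mul_le_mul_of_nonneg_right hle (norm_nonneg φ), mul_nonneg hs.le (sq_nonneg ‖B‖)]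
  · refine ⟨d + (s : ℂ) • ψ, ?_⟩
    refine IsMul₂.unique (hR.isMul₂ _) fun i ℓ => ?_
    filter_upwards [hd i ℓ, wave_add (d i) ((s : ℂ) • ψ i) ℓ, wave_smul (s : ℂ) (ψ i) ℓ]
      with k e1 e2 e3
    have e4 : wave ((d + (s : ℂ) • ψ) i) ℓ k = wave (d i) ℓ k + (s : ℂ) * wave (ψ i) ℓ k := by
      change wave (d i + (s : ℂ) • ψ i) ℓ k = _
      rw [e2, Pi.add_apply, e3, Pi.smul_apply, smul_eq_mul]
    have e5 : ((dCoeff dispersion ℓ k : ℝ) : ℂ) + s ≠ 0 := by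
      have : (dCoeff dispersion ℓ k + s : ℝ) ≠ 0 := by linarith [hnn ℓ k]
      exact_mod_cast this
    rw [e4, e1, freeResolventCoeff, ← add_mul]
    push_cast
    rw [inv_mul_cancel_left₀ e5]

/-- For ψ = (dΓ(ω) + s)⁻¹φ the remainder (H + s)ψ - φ is (H_at + Φ)ψ. The atom contributes at most
2/s ≤ 1/4. The field contributes at most 1/2, because the infrared cutoff gives N ≤ m₀⁻¹dΓ(ω). The
three terms of s are sized for these estimates. -/
theorem IsHam.norm_sub_le {m₀ : ℝ} (hm : 0 < m₀)
    (hA : ∀ᵐ q ∂(volume.restrict A : Measure Momentum), m₀ ≤ ‖q‖)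
    (hh : MemLp h 2 (volume.restrict A)) {s : ℝ}
    (hs : s = 8 + 32 * (∫⁻ q in A, ‖h q‖ₑ ^ 2).toReal * m₀⁻¹ + 4 * (∫⁻ q in A, ‖h q‖ₑ ^ 2).toReal)
    {φ d : AtomPhoton A} (hd : IsMul₂ (dCoeff dispersion) ψ d) (hdφ : d + (s : ℂ) • ψ = φ)
    (hform : (⟪ψ, d⟫_ℂ).re ≤ s⁻¹ * ‖φ‖ ^ 2) (hle : ‖ψ‖ ≤ s⁻¹ * ‖φ‖)
    (hT : IsHam h dispersion ψ χ) : ‖χ + (s : ℂ) • ψ - φ‖ ≤ 3 / 4 * ‖φ‖ := by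
  set H := (∫⁻ q in A, ‖h q‖ₑ ^ 2).toReal with hHdef
  have hH : 0 ≤ H := ENNReal.toReal_nonneg
  have hm' : 0 < m₀⁻¹ := inv_pos.2 hm
  have hHm : 0 ≤ H * m₀⁻¹ := by positivity
  have hs8 : 8 ≤ s := by linarith
  have hs0 : 0 < s := by linarith
  have h1 := relBounded_one hm hA
  obtain ⟨F, d', hF, hd', rfl⟩ := hT
  have hK : matrixOp A atomMatrix ψ + F + d' + (s : ℂ) • ψ - φ = matrixOp A atomMatrix ψ + F := by
    rw [hd'.unique hd, add_assoc _ d, hdφ, add_sub_cancel_right]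
  have hfree : FreeDomain ψ := ⟨d, hd⟩
  have hN : numForm (fun _ => 1) ψ ≤ m₀⁻¹ * (s⁻¹ * ‖φ‖ ^ 2) := by
    have e1 := hfree.numForm_mono h1 (relBounded_dispersion.const_mul m₀⁻¹) (by
      filter_upwards [hA] with q hq
      rw [inv_mul_eq_div, one_le_div hm]
      exact hq)
    have e2 : numForm dispersion ψ = (⟪ψ, d⟫_ℂ).re := hd.mulForm_eq
    rw [hfree.numForm_const_mul relBounded_dispersion, e2] at e1
    exact e1.trans (mul_le_mul_of_nonneg_left hform hm'.le)
  have hF2 := hF.norm_sq_le hh (hfree.exists_isMul₂ h1)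
  have hB2 : ‖ψ‖ ^ 2 ≤ s⁻¹ * (s⁻¹ * ‖φ‖ ^ 2) :=
    (pow_le_pow_left₀ (norm_nonneg _) hle 2).trans_eq (by ring)
  -- Together with `e2`, this makes the field bound 4H(m₀⁻¹s⁻¹ + s⁻²)‖φ‖² at most ‖φ‖²/4.
  have e1 : H * m₀⁻¹ * s⁻¹ ≤ 1 / 32 := by
    rw [← div_eq_mul_inv, div_le_iff₀ hs0, hs]
    linarith
  have e4 : s⁻¹ ≤ 1 / 8 := by
    rw [inv_le_comm₀ hs0 (by norm_num)]
    linarith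
  have e2 : H * s⁻¹ * s⁻¹ ≤ 1 / 32 := by
    have e3 : H * s⁻¹ ≤ 1 / 4 := by
      rw [← div_eq_mul_inv, div_le_iff₀ hs0, hs]
      linarith
    have e5 : 0 ≤ s⁻¹ := (inv_pos.2 hs0).le
    nlinarith
  have hF3 : ‖F‖ ^ 2 ≤ (1 / 2 * ‖φ‖) ^ 2 := by
    rw [← hHdef] at hF2
    have e6 : numForm (fun _ => 1) ψ + ‖ψ‖ ^ 2 ≤
        m₀⁻¹ * (s⁻¹ * ‖φ‖ ^ 2) + s⁻¹ * (s⁻¹ * ‖φ‖ ^ 2) := add_le_add hN hB2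
    have e7 := mul_le_mul_of_nonneg_left e6 (by positivity : 0 ≤ 4 * H)
    have e8 := mul_le_mul_of_nonneg_right (add_le_add e1 e2) (sq_nonneg ‖φ‖)
    nlinarith
  have hF4 : ‖F‖ ≤ 1 / 2 * ‖φ‖ := (sq_le_sq₀ (norm_nonneg _) (by positivity)).1 hF3
  have ha : ‖matrixOp A atomMatrix ψ‖ ≤ 1 / 4 * ‖φ‖ := by
    have := norm_atomMatrix_le ψ
    nlinarith [mul_le_mul_of_nonneg_right e4 (norm_nonneg φ)]
  rw [hK]
  linarith [norm_add_le (matrixOp A atomMatrix ψ) F]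

/-- A Kato–Rellich argument: for large s the free resolvent at -s is an approximate right inverse
with error at most 3/4, and it maps onto the domain. -/
theorem isSelfAdj_spinBoson {m₀ : ℝ} (hm : 0 < m₀)
    (hA : ∀ᵐ q ∂(volume.restrict A : Measure Momentum), m₀ ≤ ‖q‖)
    (hh : MemLp h 2 (volume.restrict A)) : IsSelfAdj (spinBoson A h dispersion) := by
  refine ⟨fun ψ φ => (isHam_spinBoson ψ).inner_comm hh (isHam_spinBoson φ), ?_⟩
  obtain ⟨s, hs⟩ : ∃ s, s = 8 + 32 * (∫⁻ q in A, ‖h q‖ₑ ^ 2).toReal * m₀⁻¹ +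
    4 * (∫⁻ q in A, ‖h q‖ₑ ^ 2).toReal := ⟨_, rfl⟩
  have hs0 : 0 < s := by
    rw [hs]
    positivity
  obtain ⟨B, hB, hB'⟩ := exists_freeResolvent A hs0
  have hdom : ∀ φ, B φ ∈ (spinBoson A h dispersion).domain := fun φ => by
    obtain ⟨d, hd, -⟩ := hB φ
    obtain ⟨χ, hχ⟩ := FreeDomain.exists_isHam ⟨d, hd⟩ (relBounded_one hm hA) hh
    exact hχ.exists_mem.1
  refine ⟨-s, neg_mem_resolventSet hdom (fun φ => ?_) fun ψ => ?_⟩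
  · obtain ⟨d, hd, hdφ, hform, hle⟩ := hB φ
    exact IsHam.norm_sub_le hm hA hh hs hd hdφ hform hle
      (isHam_spinBoson (⟨B φ, hdom φ⟩ : (spinBoson A h dispersion).domain))
  · exact hB' ψ (isHam_spinBoson ψ).freeDomain

/-! ### Parity -/

theorem wave_parity (ψ : Fock A) (ℓ : ℕ) :
    wave (parity A ψ) ℓ =ᵐ[configMeasure A ℓ] (-1 : ℂ) ^ ℓ • wave ψ ℓ :=
  Lp.coeFn_smul ((-1 : ℂ) ^ ℓ) ((ψ ℓ : symmSubspace A ℓ) : Lp ℂ 2 (configMeasure A ℓ))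

theorem isMul_parity (ψ : Fock A) : IsMul (fun ℓ _ => (-1) ^ ℓ) ψ (parity A ψ) := fun ℓ => by
  filter_upwards [wave_parity ψ ℓ] with k hk
  rw [hk]
  push_cast
  rfl

theorem parity_parity (ψ : Fock A) : parity A (parity A ψ) = ψ := by
  refine ((isMul_parity ψ).comp (isMul_parity _)).unique ((isMul_one ψ).congr fun ℓ => ?_)
  filter_upwards with k
  rw [← mul_pow]
  norm_num

theorem inner_parity (ψ χ : Fock A) : ⟪parity A ψ, parity A χ⟫_ℂ = ⟪ψ, χ⟫_ℂ := by
  rw [(isMul_parity ψ).inner_comm (isMul_parity (parity A χ)), parity_parity]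

/-- Creation changes the photon number by one, hence anticommutes with (-1)^N. -/
theorem creationGraph_parity {ψ c : Fock A} (hc : (ψ, c) ∈ creationGraph A h) :
    (parity A ψ, -parity A c) ∈ creationGraph A h := by
  refine ⟨?_, fun ℓ => ?_⟩
  · filter_upwards [hc.1, wave_neg (parity A c) 0, wave_parity c 0] with k e1 e2 e3
    rw [e2, Pi.neg_apply, e3, Pi.smul_apply, e1, smul_zero, neg_zero]
  · have e0 := ae_all_iff.2 fun i : Fin (ℓ + 1) =>
      (quasiMeasurePreserving_succAbove A i).ae (wave_parity ψ ℓ)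
    filter_upwards [hc.2 ℓ, wave_neg (parity A c) (ℓ + 1), wave_parity c (ℓ + 1), e0]
      with k e1 e2 e3 e4
    simp only [e2, Pi.neg_apply, e3, Pi.smul_apply, e1, e4, smul_eq_mul, pow_succ,
      mul_left_comm _ ((-1 : ℂ) ^ ℓ), ← Finset.mul_sum]
    ring

theorem annihilationGraph_parity {ψ b : Fock A} (hb : (ψ, b) ∈ annihilationGraph A h) :
    (parity A ψ, -parity A b) ∈ annihilationGraph A h := by
  intro ℓ
  filter_upwards [hb ℓ, wave_neg (parity A b) ℓ, wave_parity b ℓ,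
    ae_ae_cons (wave_parity ψ (ℓ + 1))] with k e1 e2 e3 e4
  have e5 : (fun q => star (h q) * wave (parity A ψ) (ℓ + 1) (Fin.cons q k))
      =ᵐ[volume.restrict A] fun q =>
        (-1 : ℂ) ^ (ℓ + 1) * (star (h q) * wave ψ (ℓ + 1) (Fin.cons q k)) := by
    filter_upwards [e4] with q hq
    rw [hq, Pi.smul_apply, smul_eq_mul, mul_left_comm]
  refine ⟨(e1.1.const_mul _).congr e5.symm, ?_⟩
  rw [integral_congr_ae e5, integral_const_mul, e2, Pi.neg_apply, e3, Pi.smul_apply, e1.2,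
    smul_eq_mul]
  ring

theorem symmetryOp_apply (ψ : AtomPhoton A) (i : Fin 2) :
    symmetryOp A ψ i = sigma3 i i • parity A (ψ i) := by
  change ∑ j, sigma3 i j • parity A (ψ j) = _
  fin_cases i <;> simp [Fin.sum_univ_two, sigma3]

theorem sigma3_rev (i : Fin 2) : sigma3 i.rev i.rev = -sigma3 i i := by
  fin_cases i <;> simp [sigma3, Fin.rev]

/-- In the field term the sign from the photon parity and the sign from σ₃σ₁ = -σ₁σ₃ cancel. The
other two terms are diagonal and commute with both factors of S. -/
theorem IsHam.map_symmetryOp (H : IsHam h w ψ χ) :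
    IsHam h w (symmetryOp A ψ) (symmetryOp A χ) := by
  obtain ⟨F, d, ⟨c, b, hc, hb, hG⟩, hd, rfl⟩ := H
  have hc' : ∀ i, (symmetryOp A ψ i, sigma3 i i • -parity A (c i)) ∈ creationGraph A h :=
    fun i => by
      rw [symmetryOp_apply, ← Prod.smul_mk]
      exact (creationGraph A h).smul_mem (sigma3 i i) (creationGraph_parity (hc i))
  have hb' : ∀ i, (symmetryOp A ψ i, sigma3 i i • -parity A (b i)) ∈ annihilationGraph A h :=
    fun i => by
      rw [symmetryOp_apply, ← Prod.smul_mk]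
      exact (annihilationGraph A h).smul_mem (sigma3 i i) (annihilationGraph_parity (hb i))
  refine ⟨symmetryOp A F, symmetryOp A d, ⟨_, _, hc', hb', fun i => ?_⟩, fun i => ?_, ?_⟩
  · rw [symmetryOp_apply, hG, map_add, sigma3_rev, smul_neg, smul_neg, neg_smul, neg_smul,
      neg_neg, neg_neg, smul_add]
  · rw [symmetryOp_apply, symmetryOp_apply]
    exact ((hd i).isMul_of_comm (isMul_parity _) (isMul_parity _)).smul _
  · rw [map_add, map_add]
    congr 2
    ext1 i
    rw [symmetryOp_apply, atomMatrix_apply, atomMatrix_apply, map_smul, symmetryOp_apply,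
      smul_comm]

theorem commutesWith_symmetryOp {T : AtomPhoton A →ₗ.[ℂ] AtomPhoton A}
    (hT : T = spinBoson A h w) : CommutesWith (symmetryOp A) T := by
  subst hT
  exact fun ψ => (isHam_spinBoson ψ).map_symmetryOp.exists_mem

theorem inner_symmetryOp (ψ χ : AtomPhoton A) :
    ⟪symmetryOp A ψ, symmetryOp A χ⟫_ℂ = ⟪ψ, χ⟫_ℂ := by
  simp only [inner_atomPhoton, symmetryOp_apply, inner_smul_left, inner_smul_right, inner_parity]
  simp [Fin.sum_univ_two, sigma3]

theorem symmetryOp_sigma1 (ψ : AtomPhoton A) :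
    symmetryOp A (matrixOp A sigma1 ψ) = -matrixOp A sigma1 (symmetryOp A ψ) := by
  ext1 i
  change _ = -(matrixOp A sigma1 (symmetryOp A ψ) i)
  rw [symmetryOp_apply, matrixOp_sigma1_apply, matrixOp_sigma1_apply, symmetryOp_apply,
    sigma3_rev, neg_smul, neg_neg]

end Operators

end SpinBoson
end

open MeasureTheory Complex
open scoped ENNReal InnerProductSpace
noncomputable section
namespace SpinBoson

section Sectors

variable {A S S' : Set Momentum} {ψ χ φ : AtomPhoton A}

/-! ### The projection onto the vectors without photons in `S` -/

theorem dCoeff_indicator_ne_zero {ℓ : ℕ} {k : Fin ℓ → Momentum} {i : Fin ℓ} (hi : k i ∈ S) :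
    1 ≤ dCoeff (S.indicator 1) ℓ k := by
  have h1 := Finset.single_le_sum (f := fun i => S.indicator (1 : Momentum → ℝ) (k i))
    (fun i _ => indicator_one_nonneg S (k i)) (Finset.mem_univ i)
  rw [Set.indicator_of_mem hi, Pi.one_apply] at h1
  exact h1

theorem dCoeff_indicator_eq_zero_iff {ℓ : ℕ} {k : Fin ℓ → Momentum} :
    dCoeff (S.indicator 1) ℓ k = 0 ↔ ∀ i, k i ∉ S := by
  constructor
  · intro h i hi
    linarith [dCoeff_indicator_ne_zero hi]
  · intro h
    exact Finset.sum_eq_zero fun i _ => Set.indicator_of_notMem (h i) _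

theorem sectorCoeff_zero_eq_one {ℓ : ℕ} {k : Fin ℓ → Momentum} (h : ∀ i, k i ∉ S) :
    sectorCoeff S 0 ℓ k = 1 := by
  rw [sectorCoeff_apply, if_pos]
  rw [Nat.cast_zero]
  exact dCoeff_indicator_eq_zero_iff.2 h

theorem sectorCoeff_zero_eq_zero {ℓ : ℕ} {k : Fin ℓ → Momentum} {i : Fin ℓ} (h : k i ∈ S) :
    sectorCoeff S 0 ℓ k = 0 := by
  rw [sectorCoeff_apply, if_neg]
  rw [Nat.cast_zero, dCoeff_indicator_eq_zero_iff]
  exact fun h' => h' i h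

theorem sectorCoeff_zero_nonneg (S : Set Momentum) (ℓ : ℕ) (k : Fin ℓ → Momentum) :
    0 ≤ sectorCoeff S 0 ℓ k := by
  rw [sectorCoeff_apply]
  split_ifs <;> norm_num

theorem sectorCoeff_zero_le_one (S : Set Momentum) (ℓ : ℕ) (k : Fin ℓ → Momentum) :
    sectorCoeff S 0 ℓ k ≤ 1 := by
  rw [sectorCoeff_apply]
  split_ifs <;> norm_num

/-- The projection onto the vectors without photons in `S`. -/
def sectorProj (A S : Set Momentum) : AtomPhoton A →L[ℂ] AtomPhoton A :=
  liftOp (mulOp A (sectorCoeff S 0))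

theorem isMul₂_sectorProj (hS : MeasurableSet S) (ψ : AtomPhoton A) :
    IsMul₂ (sectorCoeff S 0) ψ (sectorProj A S ψ) :=
  (isMultiplier_sectorCoeff hS 0).isMul₂ ψ

theorem inSector_sectorProj (hS : MeasurableSet S) (ψ : AtomPhoton A) (i : Fin 2) :
    InSector S 0 (sectorProj A S ψ i) := inSector_mulOp hS 0 (ψ i)

theorem sectorProj_eq (hS : MeasurableSet S) (h : ∀ i, InSector S 0 (ψ i)) :
    sectorProj A S ψ = ψ := by
  ext1 i
  exact (h i).mulOp_eq hS

theorem inner_sectorProj (hS : MeasurableSet S) (ψ φ : AtomPhoton A) :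
    ⟪sectorProj A S ψ, φ⟫_ℂ = ⟪ψ, sectorProj A S φ⟫_ℂ :=
  (isMul₂_sectorProj hS ψ).inner_comm (isMul₂_sectorProj hS φ)

theorem sectorProj_sectorProj (hS : MeasurableSet S) (ψ : AtomPhoton A) :
    sectorProj A S (sectorProj A S ψ) = sectorProj A S ψ :=
  sectorProj_eq hS (inSector_sectorProj hS ψ)

theorem norm_sq_sectorProj (hS : MeasurableSet S) (ψ : AtomPhoton A) :
    ‖sectorProj A S ψ‖ ^ 2 = (⟪ψ, sectorProj A S ψ⟫_ℂ).re := by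
  rw [← re_inner_self_eq, inner_sectorProj hS, sectorProj_sectorProj hS]

theorem norm_sq_sub_sectorProj (hS : MeasurableSet S) (ψ : AtomPhoton A) :
    ‖ψ‖ ^ 2 = ‖sectorProj A S ψ‖ ^ 2 + ‖ψ - sectorProj A S ψ‖ ^ 2 := by
  have h1 : ‖ψ - sectorProj A S ψ‖ ^ 2 = ‖ψ‖ ^ 2 - ‖sectorProj A S ψ‖ ^ 2 := by
    rw [← re_inner_self_eq (ψ - _), inner_sub_left, inner_sub_right, inner_sub_right,
      inner_sectorProj hS ψ ψ, inner_sectorProj hS ψ (sectorProj A S ψ),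
      sectorProj_sectorProj hS, Complex.sub_re, Complex.sub_re, Complex.sub_re, re_inner_self_eq,
      norm_sq_sectorProj hS]
    ring
  linarith

theorem IsMul₂.inSector_zero {w : Momentum → ℝ} (hw : ∀ q ∉ S, w q = 0)
    (h : ∀ i, InSector S 0 (ψ i)) : IsMul₂ (dCoeff w) ψ 0 := fun i ℓ => by
  filter_upwards [(h i).wave_eq_zero ℓ, wave_zero A ℓ] with k h1 h2
  have e : wave ((0 : AtomPhoton A) i) ℓ k = 0 := h2
  rw [e]
  by_cases hk : ∀ i, k i ∉ S
  · have : dCoeff w ℓ k = 0 := Finset.sum_eq_zero fun i _ => hw _ (hk i)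
    rw [this, Complex.ofReal_zero, zero_mul]
  · rw [h1, mul_zero]
    rw [Nat.cast_zero, Ne, dCoeff_indicator_eq_zero_iff]
    exact hk

theorem InSector.mono_zero {ψ : Fock A} (h : InSector S 0 ψ) (hSS : S' ⊆ S) :
    InSector S' 0 ψ := inSector_of fun ℓ => by
  filter_upwards [h.wave_eq_zero ℓ] with k h1 h2
  refine h1 ?_
  rw [Nat.cast_zero, Ne, dCoeff_indicator_eq_zero_iff] at h2 ⊢
  exact fun h3 => h2 fun i hi => h3 i (hSS hi)

theorem RelBounded.indicator_one {C : ℝ} (h1 : RelBounded A (fun _ => 1) C)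
    (hS : MeasurableSet S) : RelBounded A (S.indicator 1) C := h1.indicator hS

/-- The operator inequality P_{S'} ≤ P_S + N_{S \ S'}: a configuration without photons in S' either
has none in S or has at least one in S \ S'. -/
theorem norm_sq_sectorProj_le (hS : MeasurableSet S) (hS' : MeasurableSet S')
    (hψ : FreeDomain ψ) {C : ℝ} (h1 : RelBounded A (fun _ => 1) C) :
    ‖sectorProj A S' ψ‖ ^ 2 ≤ ‖sectorProj A S ψ‖ ^ 2 + numForm ((S \ S').indicator 1) ψ := by
  obtain ⟨d, hd⟩ := hψ.exists_isMul₂ (h1.indicator_one (hS.diff hS'))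
  rw [norm_sq_sectorProj hS, norm_sq_sectorProj hS', numForm, hd.mulForm_eq, ← Complex.add_re,
    ← inner_add_right]
  refine (isMul₂_sectorProj hS' ψ).re_inner_le ((isMul₂_sectorProj hS ψ).add_coeff hd) fun ℓ => ?_
  filter_upwards with k
  by_cases h' : ∀ i, k i ∉ S'
  · by_cases h : ∀ i, k i ∉ S
    · rw [sectorCoeff_zero_eq_one h, sectorCoeff_zero_eq_one h']
      linarith [dCoeff_nonneg (indicator_one_nonneg (S \ S')) ℓ k]
    · push Not at h
      obtain ⟨i, hi⟩ := h
      have := dCoeff_indicator_ne_zero (S := S \ S') (k := k) ⟨hi, h' i⟩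
      linarith [sectorCoeff_zero_le_one S' ℓ k, sectorCoeff_zero_nonneg S ℓ k]
  · push Not at h'
    obtain ⟨i, hi⟩ := h'
    rw [sectorCoeff_zero_eq_zero hi]
    linarith [dCoeff_nonneg (indicator_one_nonneg (S \ S')) ℓ k, sectorCoeff_zero_nonneg S ℓ k]

theorem IsHam.map_sectorProj {h : Momentum → ℂ} {w : Momentum → ℝ} (hS : MeasurableSet S)
    (hSh : ∀ q ∈ S, h q = 0) (H : IsHam h w ψ χ) :
    IsHam h w (sectorProj A S ψ) (sectorProj A S χ) :=
  isHam_liftOp (F := fun x => if x = (0 : ℕ) then 1 else 0) hSh (isMultiplier_sectorCoeff hS 0) H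

theorem IsHam.sub {h : Momentum → ℂ} {w : Momentum → ℝ} {ψ' χ' : AtomPhoton A}
    (H : IsHam h w ψ χ) (H' : IsHam h w ψ' χ') : IsHam h w (ψ - ψ') (χ - χ') :=
  mem_graph_spinBoson.1 ((spinBoson A h w).graph.sub_mem (mem_graph_spinBoson.2 H)
    (mem_graph_spinBoson.2 H'))

/-- The operator dΓ(w) annihilates the vectors without photons in S, so it only sees the
complementary component. -/
theorem numForm_sub_sectorProj {w : Momentum → ℝ} (hS : MeasurableSet S)
    (hw : ∀ q ∉ S, w q = 0) {d : AtomPhoton A} (hd : IsMul₂ (dCoeff w) ψ d) :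
    numForm w (ψ - sectorProj A S ψ) = numForm w ψ := by
  have h0 := IsMul₂.inSector_zero hw (inSector_sectorProj hS ψ)
  have h1 : IsMul₂ (dCoeff w) (ψ - sectorProj A S ψ) d := by
    have h2 := hd.add (h0.smul (-1))
    rwa [smul_zero, add_zero, neg_smul, one_smul, ← sub_eq_add_neg] at h2
  have h2 : ⟪sectorProj A S ψ, d⟫_ℂ = 0 := by
    rw [← h0.inner_comm hd, inner_zero_left]
  rw [numForm, numForm, h1.mulForm_eq, hd.mulForm_eq, inner_sub_left, h2, sub_zero]

theorem re_inner_split (hS : MeasurableSet S) (ψ χ : AtomPhoton A) :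
    (⟪ψ, χ⟫_ℂ).re = (⟪sectorProj A S ψ, sectorProj A S χ⟫_ℂ).re +
      (⟪ψ - sectorProj A S ψ, χ - sectorProj A S χ⟫_ℂ).re := by
  rw [inner_sub_left, inner_sub_right, inner_sub_right, inner_sectorProj hS ψ (sectorProj A S χ),
    sectorProj_sectorProj hS, inner_sectorProj hS ψ χ, Complex.sub_re, Complex.sub_re,
    Complex.sub_re]
  ring

end Sectors

section Induction

variable {A S S' : Set Momentum} {ψ χ φ : AtomPhoton A} {h h' : Momentum → ℂ}

/-! ### The induction step: adding the coupling to a shell of photons -/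

/-- The operator with coupling `h` vanishing on `S` has the eigenvector `φ` without photons in `S`
for the eigenvalue `e`; up to the field energy in `S`, `e` is a lower bound, and on vectors without
photons in `S` there is a spectral gap `δ`. -/
structure GroundData (h : Momentum → ℂ) (S : Set Momentum) (δ e : ℝ) (φ : AtomPhoton A) :
    Prop where
  norm_eq : ‖φ‖ = 1
  eigen : IsHam h dispersion φ ((e : ℂ) • φ)
  sector : ∀ i, InSector S 0 (φ i)
  lower : ∀ ψ χ : AtomPhoton A, IsHam h dispersion ψ χ →
    e * ‖ψ‖ ^ 2 + numForm (S.indicator dispersion) ψ ≤ (⟪ψ, χ⟫_ℂ).re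
  gap : ∀ ψ χ : AtomPhoton A, IsHam h dispersion ψ χ →
    e * ‖ψ‖ ^ 2 + numForm (S.indicator dispersion) ψ +
      δ * (‖sectorProj A S ψ‖ ^ 2 - ‖⟪φ, ψ⟫_ℂ‖ ^ 2) ≤ (⟪ψ, χ⟫_ℂ).re

/-- The bracket may be negative, and then reducing δ would not weaken the gap inequality by itself;
in that case the plain lower bound is used. -/
theorem GroundData.gap_of_le {δ δ' e : ℝ} (G : GroundData h S δ e φ) (h0 : 0 ≤ δ') (hδ : δ' ≤ δ)
    (H : IsHam h dispersion ψ χ) :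
    e * ‖ψ‖ ^ 2 + numForm (S.indicator dispersion) ψ +
      δ' * (‖sectorProj A S ψ‖ ^ 2 - ‖⟪φ, ψ⟫_ℂ‖ ^ 2) ≤ (⟪ψ, χ⟫_ℂ).re := by
  have h1 := G.lower ψ χ H
  have h2 := G.gap ψ χ H
  rcases le_total 0 (‖sectorProj A S ψ‖ ^ 2 - ‖⟪φ, ψ⟫_ℂ‖ ^ 2) with h3 | h3
  · nlinarith
  · nlinarith

/-- A coupling `h'` supported in the shell `S \ S'`, where the photon energies are at least `r`, and
which is weak compared to `r`; there is an infrared cutoff `m₀` on `A`. -/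
structure Shell (A S S' : Set Momentum) (h' : Momentum → ℂ) (m₀ r τ : ℝ) : Prop where
  cutoff_pos : 0 < m₀
  cutoff_le : ∀ᵐ q ∂(volume.restrict A : Measure Momentum), m₀ ≤ ‖q‖
  measurableSet : MeasurableSet S
  measurableSet' : MeasurableSet S'
  subset : S' ⊆ S
  memLp : MemLp h' 2 (volume.restrict A)
  support : ∀ q ∉ S \ S', h' q = 0
  energy_pos : 0 < r
  energy_le : ∀ᵐ q ∂(volume.restrict A : Measure Momentum), q ∈ S \ S' → r ≤ ‖q‖
  weak : 2 * (∫⁻ q in A, ‖h' q‖ₑ ^ 2).toReal ≤ τ * r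

theorem Shell.nonneg {m₀ r τ : ℝ} (Z : Shell A S S' h' m₀ r τ) : 0 ≤ τ := by
  by_contra hneg
  push Not at hneg
  have h1 : 0 ≤ (∫⁻ q in A, ‖h' q‖ₑ ^ 2).toReal := ENNReal.toReal_nonneg
  nlinarith [Z.weak, Z.energy_pos]

/-- The new field term is at least -(r/2)N - τ, with N the number of shell photons. The free energy
of the shell is at least rN, so half of it can absorb the coupling and half remains for later use.
-/
theorem Shell.lower_bound {m₀ r τ : ℝ} (Z : Shell A S S' h' m₀ r τ) {χ' : AtomPhoton A}
    (H : IsHam h dispersion ψ χ) (H' : IsHam (fun q => h q + h' q) dispersion ψ χ') :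
    (⟪ψ, χ⟫_ℂ).re - numForm (S.indicator dispersion) ψ +
      r / 2 * numForm ((S \ S').indicator 1) ψ + numForm (S'.indicator dispersion) ψ -
      τ * ‖ψ‖ ^ 2 ≤ (⟪ψ, χ'⟫_ℂ).re := by
  have hτ0 := Z.nonneg
  obtain ⟨hm, hA, hS, hS', hSS, hh', hsupp, hr, hrS, hτ⟩ := Z
  have hψ := H.freeDomain
  have h1 := relBounded_one hm hA
  have hsh := hS.diff hS'
  obtain ⟨F, hF⟩ := hψ.exists_isField h1 hh'
  have e1 : χ' = χ + F := H'.unique (H.add_isField hF)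
  have e2 := hF.re_inner_sq_le hh' hsh hsupp (hψ.exists_isMul₂ (h1.indicator_one hsh))
  have hn : 0 ≤ numForm ((S \ S').indicator 1) ψ :=
    hψ.numForm_nonneg (h1.indicator_one hsh) (indicator_one_nonneg _)
  have e3 : numForm (S.indicator dispersion) ψ =
      numForm ((S \ S').indicator dispersion) ψ + numForm (S'.indicator dispersion) ψ := by
    rw [← hψ.numForm_add (relBounded_dispersion.indicator hsh)
      (relBounded_dispersion.indicator hS')]
    congr 1
    funext q
    by_cases hq : q ∈ S'
    · simp [hq, hSS hq]
    · by_cases hq2 : q ∈ S <;> simp [hq, hq2]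
  have e4 : r * numForm ((S \ S').indicator 1) ψ ≤ numForm ((S \ S').indicator dispersion) ψ := by
    rw [← hψ.numForm_const_mul (h1.indicator_one hsh)]
    refine hψ.numForm_mono ((h1.indicator_one hsh).const_mul r)
      (relBounded_dispersion.indicator hsh) ?_
    filter_upwards [hrS] with q hq
    by_cases hq2 : q ∈ S \ S'
    · rw [Set.indicator_of_mem hq2, Set.indicator_of_mem hq2, Pi.one_apply, mul_one]
      exact hq hq2
    · rw [Set.indicator_of_notMem hq2, Set.indicator_of_notMem hq2, mul_zero]
  set N := numForm ((S \ S').indicator 1) ψ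
  set H₀ := (∫⁻ q in A, ‖h' q‖ₑ ^ 2).toReal
  have hH0 : 0 ≤ H₀ := ENNReal.toReal_nonneg
  -- Weak coupling gives ⟨ψ, Fψ⟩² ≤ 4(rN/2)(τ‖ψ‖²), where F stands for the new field term, and 4xy ≤
  -- (x + y)².
  have e5 : (⟪ψ, F⟫_ℂ).re ^ 2 ≤ (r / 2 * N + τ * ‖ψ‖ ^ 2) ^ 2 := by
    have e6 := mul_le_mul_of_nonneg_right hτ (mul_nonneg hn (sq_nonneg ‖ψ‖))
    nlinarith [sq_nonneg (r / 2 * N - τ * ‖ψ‖ ^ 2)]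
  have e6 := (abs_le.1 (abs_le_of_sq_le_sq e5 (by positivity))).1
  rw [e1, inner_add_right, Complex.add_re, e3]
  linarith

theorem nonneg_of_quadratic {a b : ℝ} (h : ∀ t : ℝ, 0 < t → 0 ≤ a + 2 * t * b) : 0 ≤ b := by
  by_contra hb
  push Not at hb
  have h1 := h ((|a| + 1) / -b) (div_pos (by positivity) (by linarith))
  have h2 : 2 * ((|a| + 1) / -b) * b = -2 * (|a| + 1) := by
    have := hb.ne
    field_simp
  rw [h2] at h1
  linarith [le_abs_self a, abs_nonneg a]

/-- Photons in `S` not interacting with the rest only increase the energy. -/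
theorem lower_of_sector {e : ℝ} (hS : MeasurableSet S) (hSh : ∀ q ∈ S, h q = 0)
    (base : ∀ ψ χ : AtomPhoton A, (∀ i, InSector S 0 (ψ i)) → IsHam h dispersion ψ χ →
      e * ‖ψ‖ ^ 2 ≤ (⟪ψ, χ⟫_ℂ).re) (H : IsHam h dispersion ψ χ) :
    e * ‖ψ‖ ^ 2 + numForm (S.indicator dispersion) ψ ≤ (⟪ψ, χ⟫_ℂ).re := by
  have hψ := H.freeDomain
  obtain ⟨d, hd⟩ := hψ.exists_isMul₂ (relBounded_dispersion.indicator hS)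
  have hw : ∀ q ∈ S, ‖q‖ - S.indicator dispersion q = 0 := fun q hq => by
    rw [Set.indicator_of_mem hq, sub_self]
  have H0 := H.sub_isMul₂ hd
  rw [numForm, hd.mulForm_eq]
  -- The form bound is traded for norm bounds ‖(H - e + t)η‖ ≥ t‖η‖, because squared norms are what
  -- `all_sectors_lower_bound` transports between sectors.
  have key : ∀ t : ℝ, 0 < t → t ^ 2 * ‖ψ‖ ^ 2 ≤ ‖χ - d + ((t - e : ℝ) : ℂ) • ψ‖ ^ 2 := by
    intro t ht
    have h1 := all_sectors_lower_bound (u := dispersion) (s := ((t - e : ℝ) : ℂ))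
      (τ := ENNReal.ofReal (t ^ 2)) hS hSh hw (fun η ξ _ hη hH => ?_) ψ (χ - d) hψ H0
    · rw [enorm_sq_eq_ofReal, enorm_sq_eq_ofReal, ← ENNReal.ofReal_mul (sq_nonneg t)] at h1
      exact (ENNReal.ofReal_le_ofReal_iff (sq_nonneg _)).1 h1
    · have h2 : IsMul₂ (dCoeff (S.indicator dispersion)) η 0 :=
        IsMul₂.inSector_zero (fun q hq => Set.indicator_of_notMem hq _) hη
      have h3 : IsHam h dispersion η ξ := by
        have h4 := hH.add_isMul₂ h2
        simp only [sub_add_cancel, add_zero] at h4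
        exact h4
      have h4 := base η ξ hη h3
      rw [enorm_sq_eq_ofReal, enorm_sq_eq_ofReal, ← ENNReal.ofReal_mul (sq_nonneg t)]
      refine ENNReal.ofReal_le_ofReal ?_
      rw [← mul_pow]
      refine pow_le_pow_left₀ (by positivity) ?_ 2
      have h5 : (⟪η, ξ + ((t - e : ℝ) : ℂ) • η⟫_ℂ).re = (⟪η, ξ⟫_ℂ).re + (t - e) * ‖η‖ ^ 2 := by
        rw [inner_add_right, inner_smul_right, Complex.add_re, Complex.re_ofReal_mul,
          re_inner_self_eq]
      have h6 : (⟪η, ξ + ((t - e : ℝ) : ℂ) • η⟫_ℂ).re ≤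
          ‖η‖ * ‖ξ + ((t - e : ℝ) : ℂ) • η‖ :=
        re_inner_le_norm (𝕜 := ℂ) η (ξ + ((t - e : ℝ) : ℂ) • η)
      rcases (norm_nonneg η).eq_or_lt with h7 | h7
      · rw [← h7, mul_zero]
        exact norm_nonneg _
      · nlinarith
  -- Expanding the square, t²‖ψ‖² cancels. The remaining inequality is affine in t with slope twice
  -- the form of H - dΓ(1_S ω) - e, and it holds for all t > 0.
  have h1 : 0 ≤ (⟪ψ, χ - d - (e : ℂ) • ψ⟫_ℂ).re := by
    refine nonneg_of_quadratic (a := ‖χ - d - (e : ℂ) • ψ‖ ^ 2) fun t ht => ?_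
    have h2 := key t ht
    have h3 : χ - d + ((t - e : ℝ) : ℂ) • ψ = (t : ℂ) • ψ + (χ - d - (e : ℂ) • ψ) := by
      rw [Complex.ofReal_sub, sub_smul]
      abel
    have h4 : ‖(t : ℂ) • ψ + (χ - d - (e : ℂ) • ψ)‖ ^ 2 = t ^ 2 * ‖ψ‖ ^ 2 +
        2 * t * (⟪ψ, χ - d - (e : ℂ) • ψ⟫_ℂ).re + ‖χ - d - (e : ℂ) • ψ‖ ^ 2 := by
      have h5 := norm_add_sq (𝕜 := ℂ) ((t : ℂ) • ψ) (χ - d - (e : ℂ) • ψ)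
      rw [h5, norm_smul, mul_pow, inner_smul_left, Complex.conj_ofReal]
      have h6 : RCLike.re ((t : ℂ) * ⟪ψ, χ - d - (e : ℂ) • ψ⟫_ℂ) =
          t * (⟪ψ, χ - d - (e : ℂ) • ψ⟫_ℂ).re := Complex.re_ofReal_mul _ _
      rw [h6, Complex.norm_real, Real.norm_eq_abs, sq_abs]
      ring
    rw [h3, h4] at h2
    linarith
  rw [inner_sub_right, inner_sub_right, inner_smul_right, Complex.sub_re, Complex.sub_re,
    Complex.re_ofReal_mul, re_inner_self_eq] at h1
  linarith

end Induction

end SpinBoson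
end

open MeasureTheory Complex
open scoped ENNReal InnerProductSpace
noncomputable section
namespace SpinBoson

/-! ### Switching on one shell: eigenvector, gap and new induction data -/

section Step

variable {A S S' : Set Momentum} {ψ χ φ : AtomPhoton A} {h h' : Momentum → ℂ}

/-- The operator with an additional energy `r` for the vectors with photons in `S`. -/
def sectorPerturb (A : Set Momentum) (h : Momentum → ℂ) (S : Set Momentum) (r : ℝ) :
    AtomPhoton A →ₗ.[ℂ] AtomPhoton A :=
  perturb (spinBoson A h dispersion) ((r : ℂ) • (1 - sectorProj A S))

theorem exists_isHam_sectorPerturb {r : ℝ} (ψ : (sectorPerturb A h S r).domain) :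
    ∃ χ, IsHam h dispersion (ψ : AtomPhoton A) χ ∧
      sectorPerturb A h S r ψ = χ + (r : ℂ) • ((ψ : AtomPhoton A) - sectorProj A S ψ) :=
  ⟨_, isHam_spinBoson (show (spinBoson A h dispersion).domain from ψ),
    perturb_apply (T := spinBoson A h dispersion) ((r : ℂ) • (1 - sectorProj A S)) ψ⟩

theorem IsHam.exists_sectorPerturb {r : ℝ} (H : IsHam h dispersion ψ χ) :
    ∃ hψ : ψ ∈ (sectorPerturb A h S r).domain, sectorPerturb A h S r ⟨ψ, hψ⟩ =
      χ + (r : ℂ) • (ψ - sectorProj A S ψ) := by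
  obtain ⟨hψ, rfl⟩ := H.exists_mem
  exact ⟨hψ, rfl⟩

theorem re_inner_sectorPerturb (hS : MeasurableSet S) (r : ℝ) (ψ χ : AtomPhoton A) :
    (⟪ψ, χ + (r : ℂ) • (ψ - sectorProj A S ψ)⟫_ℂ).re =
      (⟪ψ, χ⟫_ℂ).re + r * (‖ψ‖ ^ 2 - ‖sectorProj A S ψ‖ ^ 2) := by
  rw [inner_add_right, inner_smul_right, inner_sub_right, Complex.add_re, Complex.re_ofReal_mul,
    Complex.sub_re, re_inner_self_eq, norm_sq_sectorProj hS]

theorem indicator_dispersion_nonneg (S : Set Momentum) (q : Momentum) :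
    0 ≤ S.indicator dispersion q := Set.indicator_nonneg (fun _ _ => norm_nonneg _) q

variable {m₀ r τ δ e : ℝ}

theorem Shell.lower_bound_of_groundData (Z : Shell A S S' h' m₀ r τ) (G : GroundData h S δ e φ)
    (hh : MemLp h 2 (volume.restrict A)) (H : IsHam (fun q => h q + h' q) dispersion ψ χ) :
    (e - τ) * ‖ψ‖ ^ 2 ≤ (⟪ψ, χ⟫_ℂ).re := by
  have hψ := H.freeDomain
  have h1 := relBounded_one Z.cutoff_pos Z.cutoff_le
  obtain ⟨η, hη⟩ := hψ.exists_isHam h1 hh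
  have e1 := Z.lower_bound hη H
  have e2 := G.lower _ _ hη
  have e3 := hψ.numForm_nonneg (h1.indicator_one (Z.measurableSet.diff Z.measurableSet'))
    (indicator_one_nonneg _)
  have e4 := hψ.numForm_nonneg (relBounded_dispersion.indicator Z.measurableSet')
    (indicator_dispersion_nonneg S')
  nlinarith [mul_nonneg Z.energy_pos.le e3]

/-- The gap of the old operator contributes (r/2)P_S, and the remaining shell energy (r/2)N.
Together they dominate (r/2)P_{S'}, and the penalty r(1 - P_{S'}) covers the complement. -/
theorem Shell.perturbed_lower_bound (Z : Shell A S S' h' m₀ r τ) (G : GroundData h S δ e φ)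
    (hh : MemLp h 2 (volume.restrict A)) (hδ : r ≤ 2 * δ)
    (H : IsHam (fun q => h q + h' q) dispersion ψ χ) :
    (e - τ + r / 2) * ‖ψ‖ ^ 2 ≤ (⟪ψ, χ⟫_ℂ).re + r * (‖ψ‖ ^ 2 - ‖sectorProj A S' ψ‖ ^ 2) +
      r / 2 * ‖⟪φ, ψ⟫_ℂ‖ ^ 2 := by
  have hψ := H.freeDomain
  have h1 := relBounded_one Z.cutoff_pos Z.cutoff_le
  have hr := Z.energy_pos
  obtain ⟨η, hη⟩ := hψ.exists_isHam h1 hh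
  have e1 := Z.lower_bound hη H
  have e2 := G.gap_of_le (by linarith : 0 ≤ r / 2) (by linarith) hη
  have e3 := norm_sq_sectorProj_le Z.measurableSet Z.measurableSet' hψ h1
  have e4 := hψ.numForm_nonneg (relBounded_dispersion.indicator Z.measurableSet')
    (indicator_dispersion_nonneg S')
  have e5 := norm_sq_sub_sectorProj Z.measurableSet' ψ
  nlinarith [sq_nonneg ‖ψ - sectorProj A S' ψ‖]

/-- The old ground state has no photons in the shell, so the new field term has zero expectation in
it. -/
theorem Shell.re_inner_groundState (Z : Shell A S S' h' m₀ r τ) (G : GroundData h S δ e φ)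
    (H : IsHam (fun q => h q + h' q) dispersion φ χ) : (⟪φ, χ⟫_ℂ).re = e := by
  have hφ := G.eigen.freeDomain
  have h1 := relBounded_one Z.cutoff_pos Z.cutoff_le
  have hsh := Z.measurableSet.diff Z.measurableSet'
  obtain ⟨F, hF⟩ := hφ.exists_isField h1 Z.memLp
  have h2 : IsMul₂ (dCoeff ((S \ S').indicator 1)) φ 0 :=
    IsMul₂.inSector_zero (fun q hq => Set.indicator_of_notMem (fun h3 => hq h3.1) _) G.sector
  have h3 := hF.re_inner_sq_le Z.memLp hsh Z.support ⟨0, h2⟩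
  rw [numForm, h2.mulForm_eq, inner_zero_right, Complex.zero_re, mul_zero, zero_mul] at h3
  have h4 : (⟪φ, F⟫_ℂ).re = 0 := pow_eq_zero_iff two_ne_zero |>.1 (le_antisymm h3 (sq_nonneg _))
  rw [H.unique (G.eigen.add_isField hF), inner_add_right, Complex.add_re, h4, inner_smul_right,
    Complex.re_ofReal_mul, re_inner_self_eq, G.norm_eq]
  ring

theorem Shell.isSelfAdj_sectorPerturb (Z : Shell A S S' h' m₀ r τ) (G : GroundData h S δ e φ)
    (hh : MemLp h 2 (volume.restrict A)) :
    IsSelfAdj (sectorPerturb A (fun q => h q + h' q) S' r) := by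
  refine (isSelfAdj_spinBoson Z.cutoff_pos Z.cutoff_le (hh.add Z.memLp)).perturb (c := e - τ)
    (fun ψ => Z.lower_bound_of_groundData G hh (isHam_spinBoson ψ)) fun ψ η => ?_
  change ⟪(r : ℂ) • (ψ - sectorProj A S' ψ), η⟫_ℂ = ⟪ψ, (r : ℂ) • (η - sectorProj A S' η)⟫_ℂ
  rw [inner_smul_left, inner_smul_right, inner_sub_left, inner_sub_right,
    inner_sectorProj Z.measurableSet', Complex.conj_ofReal]

/-- `exists_hasGroundState` with χ the old ground state, which is also the trial vector of energy e,
and threshold c = e - τ + r/2. The trial energy is below c precisely because τ < r/2. -/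
theorem Shell.exists_groundState_sectorPerturb (Z : Shell A S S' h' m₀ r τ)
    (G : GroundData h S δ e φ) (hh : MemLp h 2 (volume.restrict A)) (hδ : r ≤ 2 * δ)
    (hτ : τ < r / 2) :
    ∃ e' ≤ e, ∃ φ', HasGroundState (sectorPerturb A (fun q => h q + h' q) S' r) e'
      (e - τ + r / 2 - e') φ' := by
  have hr := Z.energy_pos
  have h1 := relBounded_one Z.cutoff_pos Z.cutoff_le
  obtain ⟨χ, hχ⟩ := G.eigen.freeDomain.exists_isHam h1 (hh.add Z.memLp)
  have hχ' : IsHam (fun q => h q + h' q) dispersion φ χ := hχ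
  obtain ⟨hφ, hφχ⟩ := hχ'.exists_sectorPerturb (S := S') (r := r)
  refine exists_hasGroundState (Z.isSelfAdj_sectorPerturb G hh) (χ := φ) (t := r / 2)
    (by linarith) (fun ψ => ?_) ⟨φ, hφ⟩ (fun h0 => ?_) ?_ (by linarith)
  · obtain ⟨η, hη, hM⟩ := exists_isHam_sectorPerturb ψ
    rw [hM, re_inner_sectorPerturb Z.measurableSet']
    exact Z.perturbed_lower_bound G hh hδ hη
  · have h2 := G.norm_eq
    have h3 : φ = 0 := h0
    rw [h3, norm_zero] at h2
    exact zero_ne_one h2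
  · rw [hφχ]
    change (⟪φ, _⟫_ℂ).re ≤ e * ‖φ‖ ^ 2
    rw [re_inner_sectorPerturb Z.measurableSet', Z.re_inner_groundState G hχ',
      sectorProj_eq Z.measurableSet' fun i => (G.sector i).mono_zero Z.subset, G.norm_eq]
    linarith

theorem sub_eq_smul_sub_of_add_smul_eq {E : Type*} [AddCommGroup E] [Module ℂ E] {x y u p : E}
    {a b : ℝ} (h : x + (b : ℂ) • (u - p) = (a : ℂ) • u) (hy : y = (a : ℂ) • p) :
    x - y = ((a - b : ℝ) : ℂ) • (u - p) := by
  rw [hy, eq_sub_of_add_eq h, sub_right_comm, ← smul_sub, ← sub_smul, ← Complex.ofReal_sub]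

-- The penalty r(1 - P_{S'}) vanishes on vectors without photons in S'. So once the eigenvector of
-- the penalized operator is known to be of this kind, it is an eigenvector of H', and the gap
-- persists on such vectors.
set_option maxHeartbeats 800000 in
theorem Shell.exists_eigenvector (Z : Shell A S S' h' m₀ r τ) (G : GroundData h S δ e φ)
    (hh : MemLp h 2 (volume.restrict A)) (hhS : ∀ q ∈ S', h q = 0) (hδ : r ≤ 2 * δ)
    (hτ : τ ≤ r / 4) :
    ∃ (e' : ℝ) (u : AtomPhoton A), e - τ ≤ e' ∧ e' ≤ e ∧ ‖u‖ = 1 ∧ sectorProj A S' u = u ∧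
      IsHam (fun q => h q + h' q) dispersion u ((e' : ℂ) • u) ∧
      ∀ ψ χ : AtomPhoton A, sectorProj A S' ψ = ψ →
        IsHam (fun q => h q + h' q) dispersion ψ χ →
        e' * ‖ψ‖ ^ 2 + (e - τ + r / 2 - e') * (‖ψ‖ ^ 2 - ‖⟪u, ψ⟫_ℂ‖ ^ 2) ≤ (⟪ψ, χ⟫_ℂ).re := by
  have hr := Z.energy_pos
  have hS' := Z.measurableSet'
  have hv : ∀ q ∈ S', h q + h' q = 0 := fun q hq => by
    rw [hhS q hq, Z.support q fun h1 => h1.2 hq, add_zero]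
  obtain ⟨e', he', φ', hG⟩ := Z.exists_groundState_sectorPerturb G hh hδ (by linarith)
  obtain ⟨χ, hχ, hM⟩ := exists_isHam_sectorPerturb φ'
  obtain ⟨u, hu⟩ : ∃ u : AtomPhoton A, (φ' : AtomPhoton A) = u := ⟨_, rfl⟩
  have hnorm : ‖u‖ = 1 := hu ▸ hG.norm_eq
  rw [hu] at hχ hM
  have heig : χ + (r : ℂ) • (u - sectorProj A S' u) = (e' : ℂ) • u := by
    rw [← hM, ← hu]
    exact hG.eigen
  have hlow : e - τ ≤ e' := by
    have e1 := Z.lower_bound_of_groundData G hh hχ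
    have e2 := congrArg (fun x => (⟪u, x⟫_ℂ).re) heig
    rw [re_inner_sectorPerturb hS', inner_smul_right, Complex.re_ofReal_mul, re_inner_self_eq,
      hnorm] at e2
    rw [hnorm] at e1
    have e3 := norm_sq_sub_sectorProj hS' u
    rw [hnorm] at e3
    nlinarith [sq_nonneg ‖u - sectorProj A S' u‖]
  -- The projection P_{S'} commutes with H', so the component of u with photons in S' is an
  -- eigenvector of H' for e' - r unless it is zero. That value is below the lower bound e - τ.
  have hsec : u - sectorProj A S' u = 0 := by
    have h1 : sectorProj A S' χ = (e' : ℂ) • sectorProj A S' u := by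
      have h2 := congrArg (sectorProj A S') heig
      rwa [map_add, map_smul, map_sub, sectorProj_sectorProj hS', sub_self, smul_zero, add_zero,
        map_smul] at h2
    have h2 := hχ.sub (hχ.map_sectorProj hS' hv)
    have h3 := Z.lower_bound_of_groundData G hh h2
    have h4 : χ - sectorProj A S' χ = ((e' - r : ℝ) : ℂ) • (u - sectorProj A S' u) :=
      sub_eq_smul_sub_of_add_smul_eq heig h1
    rw [h4, inner_smul_right, Complex.re_ofReal_mul, re_inner_self_eq] at h3
    have h5 : ‖u - sectorProj A S' u‖ ^ 2 ≤ 0 := by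
      by_contra h6
      push Not at h6
      nlinarith
    exact norm_eq_zero.1 (pow_eq_zero_iff two_ne_zero |>.1 (le_antisymm h5 (sq_nonneg _)))
  have hχe : χ = (e' : ℂ) • u := by
    rwa [hsec, smul_zero, add_zero] at heig
  have hPu : sectorProj A S' u = u := (sub_eq_zero.1 hsec).symm
  rw [hχe] at hχ
  refine ⟨e', u, hlow, he', hnorm, hPu, hχ, fun ψ χ hψ H => ?_⟩
  obtain ⟨hd, hdχ⟩ := H.exists_sectorPerturb (S := S') (r := r)
  have h1 := hG.gap ⟨ψ, hd⟩
  rw [hdχ, hu] at h1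
  have h2 : ψ - sectorProj A S' ψ = 0 := by rw [hψ, sub_self]
  rw [h2, smul_zero, add_zero] at h1
  exact h1

/-- The gap on vectors without photons in S' is e - τ + r/2 - e' ≥ r/2 - τ ≥ r/4. For general
vectors, this gap is used on P_{S'}ψ and `lower_of_sector` on the rest; no cross terms arise because
H' commutes with P_{S'}. -/
theorem Shell.exists_groundData (Z : Shell A S S' h' m₀ r τ) (G : GroundData h S δ e φ)
    (hh : MemLp h 2 (volume.restrict A)) (hhS : ∀ q ∈ S', h q = 0) (hδ : r ≤ 2 * δ)
    (hτ : τ ≤ r / 4) :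
    ∃ e' φ', e - τ ≤ e' ∧ e' ≤ e ∧ GroundData (A := A) (fun q => h q + h' q) S' (r / 4) e' φ' := by
  have hr := Z.energy_pos
  have hS' := Z.measurableSet'
  have hv : ∀ q ∈ S', h q + h' q = 0 := fun q hq => by
    rw [hhS q hq, Z.support q fun h1 => h1.2 hq, add_zero]
  obtain ⟨e', u, hlow, he', hnorm, hPu, hue, hgapS⟩ := Z.exists_eigenvector G hh hhS hδ hτ
  have hcs : ∀ ψ : AtomPhoton A, ‖⟪u, ψ⟫_ℂ‖ ^ 2 ≤ ‖ψ‖ ^ 2 := fun ψ => by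
    have h1 := norm_inner_le_norm (𝕜 := ℂ) u ψ
    rw [hnorm, one_mul] at h1
    exact pow_le_pow_left₀ (norm_nonneg _) h1 2
  have hlower : ∀ ψ χ : AtomPhoton A, IsHam (fun q => h q + h' q) dispersion ψ χ →
      e' * ‖ψ‖ ^ 2 + numForm (S'.indicator dispersion) ψ ≤ (⟪ψ, χ⟫_ℂ).re := fun ψ χ H =>
    lower_of_sector hS' hv (fun ψ χ hψ H => by
      have h1 := hgapS ψ χ (sectorProj_eq hS' hψ) H
      nlinarith [hcs ψ]) H
  refine ⟨e', u, hlow, he', hnorm, hue, fun i => ?_, hlower, fun ψ χ H => ?_⟩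
  · rw [← hPu]
    exact inSector_sectorProj hS' u i
  · obtain ⟨d, hd⟩ := H.freeDomain.exists_isMul₂ (relBounded_dispersion.indicator hS')
    have hP := H.map_sectorProj hS' hv
    have h1 := hgapS _ _ (sectorProj_sectorProj hS' ψ) hP
    have h2 := hlower _ _ (H.sub hP)
    rw [numForm_sub_sectorProj hS' (fun q hq => Set.indicator_of_notMem hq _) hd] at h2
    rw [re_inner_split hS' ψ χ, norm_sq_sub_sectorProj hS' ψ]
    have h3 : ⟪u, sectorProj A S' ψ⟫_ℂ = ⟪u, ψ⟫_ℂ := by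
      rw [← inner_sectorProj hS', hPu]
    have h4 := hcs (sectorProj A S' ψ)
    rw [h3] at h1 h4
    nlinarith

end Step

end SpinBoson
end

open MeasureTheory Complex
open scoped ENNReal InnerProductSpace
noncomputable section
namespace SpinBoson

section Vacuum

variable {A S : Set Momentum} {ψ χ φ : AtomPhoton A}

/-! ### The decoupled system -/

/-- The coefficient of the projection onto the vacuum. -/
def vacuumCoeff (ℓ : ℕ) (_ : Fin ℓ → Momentum) : ℝ := if ℓ = 0 then 1 else 0

/-- The configuration space of zero momenta is a single point with Dirac measure, so the vacuum is
the constant 1 there and ⟨Ω, ψ⟩ is the value of ψ at that point. -/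
theorem exists_vacuum (A : Set Momentum) : ∃ Ω : Fock A, ‖Ω‖ = 1 ∧
    (∀ ℓ, wave Ω ℓ =ᵐ[configMeasure A ℓ] fun k => (vacuumCoeff ℓ k : ℂ)) ∧
    ∀ ψ : Fock A, IsMul vacuumCoeff ψ (⟪Ω, ψ⟫_ℂ • Ω) := by
  have hdirac : configMeasure A 0 = Measure.dirac (fun i => i.elim0) := Measure.pi_of_empty _ _
  have hmass : mass A (fun ℓ k => (vacuumCoeff ℓ k : ℂ)) = 1 := by
    rw [mass, tsum_eq_single 0]
    · simp [vacuumCoeff, hdirac]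
    · intro ℓ hℓ
      simp [vacuumCoeff, hℓ]
  obtain ⟨Ω, hΩ⟩ := exists_fock (A := A) (F := fun ℓ k => (vacuumCoeff ℓ k : ℂ))
    (fun ℓ => aestronglyMeasurable_const (b := (((if ℓ = 0 then 1 else 0 : ℝ)) : ℂ))) (fun ℓ σ => by filter_upwards with k; rfl)
    (by rw [hmass]; exact ENNReal.one_ne_top)
  refine ⟨Ω, ?_, hΩ, fun ψ ℓ => ?_⟩
  · have h1 := enorm_sq_eq_mass Ω
    rw [mass_congr hΩ, hmass, enorm_sq_eq_ofReal, ENNReal.ofReal_eq_one] at h1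
    exact (pow_eq_one_iff_of_nonneg (norm_nonneg _) two_ne_zero).1 h1
  · filter_upwards [hΩ ℓ, wave_smul ⟪Ω, ψ⟫_ℂ Ω ℓ] with k h1 h2
    rw [h2, Pi.smul_apply, h1, smul_eq_mul]
    rcases Nat.eq_zero_or_pos ℓ with rfl | hℓ
    · have h3 := hasSum_inner_wave Ω ψ
      have h4 : ∀ m ≠ 0, ∫ k, ⟪wave Ω m k, wave ψ m k⟫_ℂ ∂configMeasure A m = 0 := fun m hm => by
        rw [integral_congr_ae (g := fun _ => 0), integral_zero]
        filter_upwards [hΩ m] with k hk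
        rw [hk]
        simp [vacuumCoeff, hm]
      have h5 : ∫ k, ⟪wave Ω 0 k, wave ψ 0 k⟫_ℂ ∂configMeasure A 0 = wave ψ 0 k := by
        rw [integral_congr_ae (g := fun _ => wave ψ 0 k), hdirac, integral_const]
        · simp
        · filter_upwards [hΩ 0] with k' hk
          rw [hk, Subsingleton.elim k' k]
          simp [vacuumCoeff]
      rw [h3.unique (hasSum_single 0 h4), h5, mul_comm]
    · simp [vacuumCoeff, hℓ.ne']

theorem isField_zero (ψ : AtomPhoton A) : IsField (fun _ => 0) ψ 0 := by
  refine ⟨fun _ => 0, fun _ => 0, fun i => ⟨wave_zero A 0, fun ℓ => ?_⟩, fun i ℓ => ?_,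
    fun i => (add_zero _).symm⟩
  · filter_upwards [wave_zero A (ℓ + 1)] with k hk
    simp [hk]
  · filter_upwards [wave_zero A ℓ] with k hk
    simp [hk]

theorem IsHam.re_inner_decoupled (H : IsHam (fun _ => 0) dispersion ψ χ) :
    (⟪ψ, χ⟫_ℂ).re = 2 * ‖ψ 0‖ ^ 2 + numForm dispersion ψ := by
  obtain ⟨F, d, hF, hd, rfl⟩ := H
  rw [hF.unique (isField_zero ψ), add_zero, inner_add_right, Complex.add_re, numForm, hd.mulForm_eq,
    re_inner_atomPhoton ψ (matrixOp A atomMatrix ψ)]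
  simp only [atomMatrix_apply, Fin.sum_univ_two, inner_smul_right]
  have h1 : atomMatrix 0 0 = ((2 : ℝ) : ℂ) := by simp [atomMatrix]
  have h2 : atomMatrix 1 1 = 0 := by simp [atomMatrix]
  rw [h1, h2, zero_mul, Complex.zero_re, add_zero, Complex.re_ofReal_mul, inner_self_eq_norm_sq_to_K]
  norm_cast

-- The ground state is the lower atomic level times the vacuum, with energy 0. An excited atom costs
-- 2 ≥ δ, and in a state without photons in S any photon costs at least δ.
set_option maxHeartbeats 800000 in
theorem exists_groundData_decoupled (hS : MeasurableSet S) {δ : ℝ} (hδ0 : 0 ≤ δ) (hδ : δ ≤ 2)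
    (hA : ∀ᵐ q ∂(volume.restrict A : Measure Momentum), q ∉ S → δ ≤ ‖q‖) :
    ∃ φ : AtomPhoton A, GroundData (fun _ => 0) S δ 0 φ := by
  obtain ⟨Ω, hΩ1, hΩ, hvac⟩ := exists_vacuum A
  have hΩs : InSector Set.univ 0 Ω := inSector_of fun ℓ => by
    filter_upwards [hΩ ℓ] with k h1 h2
    rw [Nat.cast_zero, Ne, dCoeff_indicator_eq_zero_iff] at h2
    push Not at h2
    obtain ⟨i, -⟩ := h2
    rw [h1, vacuumCoeff, if_neg, Complex.ofReal_zero]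
    rintro rfl
    exact i.elim0
  have h0s : InSector Set.univ 0 (0 : Fock A) := inSector_of fun ℓ => by
    filter_upwards [wave_zero A ℓ] with k h1 _
    exact h1
  set φ : AtomPhoton A := WithLp.toLp 2 ![0, Ω]
  have hφ0 : φ 0 = 0 := rfl
  have hφ1 : φ 1 = Ω := rfl
  have hsec : ∀ i, InSector Set.univ 0 (φ i) := by
    intro i
    fin_cases i
    · exact h0s
    · exact hΩs
  refine ⟨φ, ?_, ⟨0, 0, isField_zero φ, ?_, ?_⟩, fun i => (hsec i).mono_zero (Set.subset_univ S),
    fun ψ χ H => ?_, fun ψ χ H => ?_⟩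
  · have h1 : ‖φ‖ ^ 2 = 1 := by
      rw [norm_sq_atomPhoton, Fin.sum_univ_two, hφ0, hφ1, hΩ1]
      simp
    exact (pow_eq_one_iff_of_nonneg (norm_nonneg _) two_ne_zero).1 h1
  · exact IsMul₂.inSector_zero (fun q hq => absurd (Set.mem_univ q) hq) hsec
  · ext1 i
    rw [add_zero, add_zero, Complex.ofReal_zero, zero_smul, atomMatrix_apply]
    fin_cases i
    · exact (smul_zero _).symm
    · have h2 : atomMatrix 1 1 = 0 := by simp [atomMatrix]
      change 0 = atomMatrix 1 1 • φ 1
      rw [h2, zero_smul]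
  · rw [H.re_inner_decoupled, zero_mul, zero_add]
    have h1 := H.freeDomain.numForm_mono (relBounded_dispersion.indicator hS) relBounded_dispersion
      (by
        filter_upwards with q
        exact Set.indicator_le_self' (fun _ _ => norm_nonneg _) q)
    linarith [sq_nonneg ‖ψ 0‖]
  · have hψ := H.freeDomain
    have hb := (relBounded_dispersion (A := A)).indicator hS.compl
    obtain ⟨d, hd⟩ := hψ.exists_isMul₂ hb
    have h1 : numForm dispersion ψ =
        numForm (S.indicator dispersion) ψ + numForm (Sᶜ.indicator dispersion) ψ := by
      rw [← hψ.numForm_add (relBounded_dispersion.indicator hS) hb]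
      congr 1
      funext q
      exact (Set.indicator_self_add_compl_apply S dispersion q).symm
    have h2 : numForm (Sᶜ.indicator dispersion) ψ = (⟪ψ 0, d 0⟫_ℂ).re + (⟪ψ 1, d 1⟫_ℂ).re := by
      rw [numForm, hd.mulForm_eq, re_inner_atomPhoton, Fin.sum_univ_two]
    have h3 : 0 ≤ (⟪ψ 0, d 0⟫_ℂ).re := ((hd 0).ofReal_inner fun ℓ => by
      filter_upwards with k
      exact dCoeff_nonneg (indicator_dispersion_nonneg _) ℓ k).1
    have h4 : ‖sectorProj A S ψ‖ ^ 2 =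
        (⟪ψ 0, sectorProj A S ψ 0⟫_ℂ).re + (⟪ψ 1, sectorProj A S ψ 1⟫_ℂ).re := by
      rw [norm_sq_sectorProj hS, re_inner_atomPhoton, Fin.sum_univ_two]
    have h5 : (⟪ψ 0, sectorProj A S ψ 0⟫_ℂ).re ≤ ‖ψ 0‖ ^ 2 := by
      have h6 := (isMul₂_sectorProj hS ψ 0).re_inner_le (isMul_one (ψ 0)) fun ℓ => by
        filter_upwards with k
        exact sectorCoeff_zero_le_one S ℓ k
      rw [inner_self_eq_norm_sq_to_K] at h6
      exact_mod_cast h6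
    have h6 : ⟪φ, ψ⟫_ℂ = ⟪Ω, ψ 1⟫_ℂ := by
      rw [inner_atomPhoton, Fin.sum_univ_two, hφ0, hφ1, inner_zero_left, zero_add]
    -- Pointwise comparison of multiplication operators: a configuration without photons in S is
    -- either empty, where the vacuum term gives δ, or contains a photon outside S of energy at
    -- least δ.
    have h7 : δ * (⟪ψ 1, sectorProj A S ψ 1⟫_ℂ).re ≤
        (⟪ψ 1, d 1⟫_ℂ).re + δ * ‖⟪Ω, ψ 1⟫_ℂ‖ ^ 2 := by
      have h8 := ((isMul₂_sectorProj hS ψ 1).smul_coeff δ).re_inner_le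
        ((hd 1).add_coeff ((hvac (ψ 1)).smul_coeff δ)) fun ℓ => by
          filter_upwards [ae_forall_apply (ℓ := ℓ) hA] with k hk
          have h9 := dCoeff_nonneg (indicator_dispersion_nonneg Sᶜ) ℓ k
          rcases Nat.eq_zero_or_pos ℓ with rfl | hℓ
          · have h10 : vacuumCoeff 0 k = 1 := if_pos rfl
            rw [h10]
            nlinarith [sectorCoeff_zero_le_one S 0 k]
          · have h10 : vacuumCoeff ℓ k = 0 := if_neg hℓ.ne'
            rw [h10, mul_zero, add_zero]
            by_cases hkS : ∀ i, k i ∉ S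
            · rw [sectorCoeff_zero_eq_one hkS, mul_one]
              have h11 := Finset.single_le_sum (f := fun i => Sᶜ.indicator dispersion (k i))
                (fun i _ => indicator_dispersion_nonneg Sᶜ (k i))
                (Finset.mem_univ (⟨0, hℓ⟩ : Fin ℓ))
              have h12 : Sᶜ.indicator dispersion (k ⟨0, hℓ⟩) = ‖k ⟨0, hℓ⟩‖ :=
                Set.indicator_of_mem (hkS _) _
              rw [h12] at h11
              exact (hk _ (hkS _)).trans h11
            · push Not at hkS
              obtain ⟨i, hi⟩ := hkS
              rw [sectorCoeff_zero_eq_zero hi, mul_zero]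
              exact h9
      rw [inner_smul_right, Complex.re_ofReal_mul, inner_add_right, Complex.add_re,
        inner_smul_right, Complex.re_ofReal_mul, inner_smul_right, ← inner_conj_symm (ψ 1) Ω,
        Complex.mul_conj, Complex.normSq_eq_norm_sq, Complex.ofReal_re] at h8
      exact h8
    rw [H.re_inner_decoupled, h1, h2, h4, h6]
    have h8 := mul_le_mul_of_nonneg_left h5 hδ0
    have h9 := mul_le_mul_of_nonneg_right hδ (sq_nonneg ‖ψ 0‖)
    rw [zero_mul, zero_add, mul_sub, mul_add]
    linarith

end Vacuum

/-! ### From the induction data to a spectral gap on the whole space -/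

section GroundState

variable {A S : Set Momentum} {ψ χ φ : AtomPhoton A} {h : Momentum → ℂ}

/-- If the photons in S have energy at least r, then dΓ(1_S ω) ≥ rN_S, and 1 ≤ P_S + N_S extends the
gap r/2 to vectors with photons in S. -/
theorem GroundData.exists_hasGroundState {m₀ δ e r : ℝ} (G : GroundData h S δ e φ)
    (hS : MeasurableSet S) (hm : 0 < m₀)
    (hA : ∀ᵐ q ∂(volume.restrict A : Measure Momentum), m₀ ≤ ‖q‖) (hr0 : 0 < r) (hrδ : r ≤ 2 * δ)
    (hr : ∀ᵐ q ∂(volume.restrict A : Measure Momentum), q ∈ S → r ≤ ‖q‖) :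
    ∃ φ' : (spinBoson A h dispersion).domain,
      HasGroundState (spinBoson A h dispersion) e (r / 2) φ' := by
  obtain ⟨hφ, hφe⟩ := G.eigen.exists_mem
  have h1 := relBounded_one hm hA
  refine ⟨⟨φ, hφ⟩, G.norm_eq, hφe, fun ψ => ?_⟩
  have H := isHam_spinBoson ψ
  have hψ := H.freeDomain
  have e1 := G.gap_of_le (by linarith : 0 ≤ r / 2) (by linarith) H
  have e2 : r * numForm (S.indicator 1) (ψ : AtomPhoton A) ≤
      numForm (S.indicator dispersion) (ψ : AtomPhoton A) := by
    rw [← hψ.numForm_const_mul (h1.indicator_one hS)]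
    refine hψ.numForm_mono ((h1.indicator_one hS).const_mul r)
      (relBounded_dispersion.indicator hS) ?_
    filter_upwards [hr] with q hq
    by_cases hq2 : q ∈ S
    · rw [Set.indicator_of_mem hq2, Set.indicator_of_mem hq2, Pi.one_apply, mul_one]
      exact hq hq2
    · rw [Set.indicator_of_notMem hq2, Set.indicator_of_notMem hq2, mul_zero]
  -- Taken with S' empty, for which the projection is the identity.
  have e3 := norm_sq_sectorProj_le hS MeasurableSet.empty hψ h1
  rw [Set.sdiff_empty, sectorProj_eq MeasurableSet.empty fun i => inSector_of fun ℓ => by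
    filter_upwards with k hk
    refine absurd ?_ hk
    rw [Nat.cast_zero, dCoeff_indicator_eq_zero_iff]
    exact fun i => Set.notMem_empty _] at e3
  have e4 := norm_sq_sub_sectorProj hS (ψ : AtomPhoton A)
  have e5 := mul_le_mul_of_nonneg_left e3 hr0.le
  have e6 := mul_nonneg hr0.le (sq_nonneg ‖(ψ : AtomPhoton A) - sectorProj A S ψ‖)
  change e * ‖(ψ : AtomPhoton A)‖ ^ 2 +
    r / 2 * (‖(ψ : AtomPhoton A)‖ ^ 2 - ‖⟪φ, (ψ : AtomPhoton A)⟫_ℂ‖ ^ 2) ≤ _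
  nlinarith

end GroundState

end SpinBoson
end

open MeasureTheory Complex
open scoped ENNReal InnerProductSpace
noncomputable section
namespace SpinBoson

/-! ### Norms of the coupling functions -/

/-- In polar coordinates the Jacobian r² beats the singularity 1/r, giving 4π ∫₀^R r dr. -/
theorem lintegral_inv_norm_lt {R : ℝ} (hR : 0 ≤ R) :
    ∫⁻ k : Momentum, ENNReal.ofReal ((Set.Iio R).indicator (fun x => x⁻¹) ‖k‖) =
      ENNReal.ofReal (2 * Real.pi * R ^ 2) := by
  have hfin : Module.finrank ℝ Momentum - 1 = 2 := by simp
  have hcongr : Set.EqOn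
      (fun y : ℝ => y ^ (Module.finrank ℝ Momentum - 1) • (Set.Iio R).indicator (fun x => x⁻¹) y)
      ((Set.Iio R).indicator fun y => y) (Set.Ioi 0) := fun y hy => by
    have hy0 : y ≠ 0 := (Set.mem_Ioi.1 hy).ne'
    simp only [hfin, smul_eq_mul]
    by_cases hyR : y ∈ Set.Iio R
    · rw [Set.indicator_of_mem hyR, Set.indicator_of_mem hyR, sq, mul_assoc, mul_inv_cancel₀ hy0,
        mul_one]
    · rw [Set.indicator_of_notMem hyR, Set.indicator_of_notMem hyR, mul_zero]
  have hset : Set.Ioi (0 : ℝ) ∩ Set.Iio R = Set.Ioo 0 R := Set.Ioi_inter_Iio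
  have hint : Integrable (fun k : Momentum => (Set.Iio R).indicator (fun x => x⁻¹) ‖k‖) := by
    rw [integrable_fun_norm_addHaar volume (f := (Set.Iio R).indicator fun x => x⁻¹),
      integrableOn_congr_fun hcongr measurableSet_Ioi, IntegrableOn,
      integrable_indicator_iff measurableSet_Iio, IntegrableOn,
      Measure.restrict_restrict measurableSet_Iio, Set.inter_comm, hset]
    exact (continuous_id.integrableOn_Icc (a := 0) (b := R)).mono_set Set.Ioo_subset_Icc_self
  rw [← ofReal_integral_eq_lintegral_ofReal hint]
  · congr 1
    rw [integral_fun_norm_addHaar volume ((Set.Iio R).indicator fun x => x⁻¹),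
      setIntegral_congr_fun measurableSet_Ioi hcongr, setIntegral_indicator measurableSet_Iio, hset,
      ← integral_Ioc_eq_integral_Ioo, ← intervalIntegral.integral_of_le hR, integral_id,
      Measure.real, EuclideanSpace.volume_ball_fin_three]
    simp only [finrank_euclideanSpace, Fintype.card_fin, ENNReal.ofReal_one, one_pow, one_mul,
      nsmul_eq_mul, smul_eq_mul]
    rw [ENNReal.toReal_ofReal (by positivity)]
    push_cast
    ring
  · filter_upwards with k
    exact Set.indicator_apply_nonneg fun _ => inv_nonneg.2 (norm_nonneg k)

section Coupling

variable {A s : Set Momentum} {κ g R : ℝ} {f : Momentum → ℝ}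

theorem aestronglyMeasurable_coupling (κ g : ℝ) (hf : AEStronglyMeasurable f volume) :
    AEStronglyMeasurable (coupling κ g f) volume := by
  have h1 : MeasurableSet {k : Momentum | ‖k‖ < κ} :=
    measurableSet_lt measurable_norm measurable_const
  have h2 : Measurable fun k : Momentum =>
      g * ({k : Momentum | ‖k‖ < κ}.indicator 1 k / (4 * Real.pi * Real.sqrt ‖k‖)) :=
    ((measurable_one.indicator h1).div (measurable_norm.sqrt.const_mul _)).const_mul g
  exact Complex.continuous_ofReal.comp_aestronglyMeasurable (h2.aestronglyMeasurable.mul hf)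

theorem enorm_sq_coupling_le (κ g : ℝ) {k : Momentum} (hk : |f k| ≤ 1) :
    ‖coupling κ g f k‖ₑ ^ 2 ≤ ENNReal.ofReal (g ^ 2 / (16 * Real.pi ^ 2) * ‖k‖⁻¹) := by
  rw [enorm_sq_eq_ofReal]
  refine ENNReal.ofReal_le_ofReal ?_
  rw [coupling, Complex.norm_real, Real.norm_eq_abs, sq_abs, mul_pow, mul_pow, div_pow, mul_pow,
    Real.sq_sqrt (norm_nonneg k)]
  have h1 : f k ^ 2 ≤ 1 := (sq_le_one_iff_abs_le_one _).2 hk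
  have h2 : ({k : Momentum | ‖k‖ < κ}.indicator (1 : Momentum → ℝ) k) ^ 2 ≤ 1 := by
    by_cases h : k ∈ {k : Momentum | ‖k‖ < κ}
    · simp [Set.indicator_of_mem h]
    · simp [Set.indicator_of_notMem h]
  have h3 : 0 ≤ (4 * Real.pi) ^ 2 * ‖k‖ := by positivity
  calc _ ≤ g ^ 2 * (1 / ((4 * Real.pi) ^ 2 * ‖k‖)) * 1 := by
        refine mul_le_mul (mul_le_mul_of_nonneg_left ?_ (sq_nonneg g)) h1 (sq_nonneg _)
          (by positivity)
        exact div_le_div_of_nonneg_right h2 h3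
    _ = _ := by
        rw [one_div, mul_inv]
        ring

theorem lintegral_indicator_coupling_le (κ g : ℝ) (hf1 : ∀ᵐ k ∂(volume : Measure Momentum), |f k| ≤ 1)
    (hR : 0 ≤ R) (hs : ∀ q ∈ s, ‖q‖ < R) :
    ∫⁻ q in A, ‖s.indicator (coupling κ g f) q‖ₑ ^ 2 ≤
      ENNReal.ofReal (g ^ 2 * R ^ 2 / (8 * Real.pi)) := by
  have hc : 0 ≤ g ^ 2 / (16 * Real.pi ^ 2) := by positivity
  calc ∫⁻ q in A, ‖s.indicator (coupling κ g f) q‖ₑ ^ 2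
      ≤ ∫⁻ q, ‖s.indicator (coupling κ g f) q‖ₑ ^ 2 := lintegral_mono' Measure.restrict_le_self le_rfl
    _ ≤ ∫⁻ q : Momentum, ENNReal.ofReal (g ^ 2 / (16 * Real.pi ^ 2)) *
          ENNReal.ofReal ((Set.Iio R).indicator (fun x => x⁻¹) ‖q‖) := by
        refine lintegral_mono_ae ?_
        filter_upwards [hf1] with q hq
        by_cases hqs : q ∈ s
        · rw [Set.indicator_of_mem hqs, Set.indicator_of_mem (Set.mem_Iio.2 (hs q hqs)),
            ← ENNReal.ofReal_mul hc]
          exact enorm_sq_coupling_le κ g hq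
        · rw [Set.indicator_of_notMem hqs]
          simp
    _ = _ := by
        rw [lintegral_const_mul' _ _ ENNReal.ofReal_ne_top, lintegral_inv_norm_lt hR,
          ← ENNReal.ofReal_mul hc]
        congr 1
        field_simp
        ring

theorem memLp_indicator_coupling (g : ℝ) (hκ : 0 ≤ κ) (hf : AEStronglyMeasurable f volume)
    (hf1 : ∀ᵐ k ∂(volume : Measure Momentum), |f k| ≤ 1) (hs : MeasurableSet s) :
    MemLp (s.indicator (coupling κ g f)) 2 (volume.restrict A) := by
  refine ⟨((aestronglyMeasurable_coupling κ g hf).indicator hs).restrict, ?_⟩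
  -- The coupling vanishes for |k| ≥ κ, so s may be replaced by a subset of the ball of radius κ,
  -- where the integral bound applies.
  have h1 : s.indicator (coupling κ g f) = (s ∩ {k | ‖k‖ < κ}).indicator (coupling κ g f) := by
    funext q
    by_cases hq : q ∈ s
    · by_cases hq2 : ‖q‖ < κ
      · rw [Set.indicator_of_mem hq,
          Set.indicator_of_mem (show q ∈ s ∩ {k : Momentum | ‖k‖ < κ} from ⟨hq, hq2⟩)]
      · rw [Set.indicator_of_mem hq, Set.indicator_of_notMem fun h => hq2 h.2]
        simp [coupling, hq2]
    · rw [Set.indicator_of_notMem hq, Set.indicator_of_notMem fun h => hq h.1]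
  have h2 := lintegral_indicator_coupling_le (A := A) (s := s ∩ {k | ‖k‖ < κ}) κ g hf1 hκ
    fun q hq => hq.2
  rw [← h1, lintegral_enorm_sq] at h2
  by_contra h3
  rw [not_lt, top_le_iff] at h3
  rw [h3] at h2
  simp at h2

end Coupling

/-! ### The induction over the infrared cutoffs -/

section Hamiltonians

variable {κ γ g : ℝ} {f : Momentum → ℝ}

/-- The coupling function of the Hamiltonian with infrared cutoff `ρ_n`. -/
abbrev cutoffCoupling (κ γ g : ℝ) (f : Momentum → ℝ) (n : ℕ) : Momentum → ℂ :=
  (irBall κ γ n)ᶜ.indicator (coupling κ g f)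

theorem measurableSet_irBall (κ γ : ℝ) (n : ℕ) : MeasurableSet (irBall κ γ n) :=
  measurableSet_lt measurable_norm measurable_const

theorem rho_pos (hκ0 : 0 < κ) (hγ0 : 0 < γ) (n : ℕ) : 0 < rho κ γ n :=
  mul_pos hκ0 (pow_pos hγ0 n)

theorem rho_succ (κ γ : ℝ) (n : ℕ) : rho κ γ (n + 1) = γ * rho κ γ n := by
  rw [rho, rho, pow_succ]
  ring

theorem irBall_succ_subset (hκ0 : 0 < κ) (hγ0 : 0 < γ) (hγ1 : γ < 1 / 2) (n : ℕ) :
    irBall κ γ (n + 1) ⊆ irBall κ γ n := fun k hk => by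
  have h1 : ‖k‖ < rho κ γ (n + 1) := hk
  have h2 := rho_pos hκ0 hγ0 n
  change ‖k‖ < rho κ γ n
  rw [rho_succ] at h1
  nlinarith

theorem ae_rho_le (κ γ : ℝ) (n : ℕ) :
    ∀ᵐ q ∂(volume.restrict (irBall κ γ n)ᶜ : Measure Momentum), rho κ γ n ≤ ‖q‖ := by
  filter_upwards [ae_restrict_mem (measurableSet_irBall κ γ n).compl] with q hq
  exact not_lt.1 hq

theorem hamiltonian_eq_spinBoson (κ γ g : ℝ) (f : Momentum → ℝ) (n : ℕ) :
    hamiltonian κ γ g f n =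
      spinBoson (irBall κ γ n)ᶜ (cutoffCoupling κ γ g f n) dispersion := by
  have hae : (irBall κ γ n)ᶜ.indicator dispersion =ᵐ[volume.restrict (irBall κ γ n)ᶜ]
      dispersion := by
    filter_upwards [ae_restrict_mem (measurableSet_irBall κ γ n).compl] with q hq
    exact Set.indicator_of_mem hq _
  refine LinearPMap.eq_of_eq_graph (Submodule.ext fun ⟨ψ, χ⟩ => ?_)
  change (ψ, χ) ∈ (spinBoson (irBall κ γ n)ᶜ (cutoffCoupling κ γ g f n)
    ((irBall κ γ n)ᶜ.indicator dispersion)).graph ↔ _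
  rw [mem_graph_spinBoson, mem_graph_spinBoson]
  exact ⟨fun H => H.congr_dispersion hae, fun H => H.congr_dispersion hae.symm⟩

/-- H̃_n and H_{n+1} act on the same space with the same free energy and differ only in the
coupling. The domains agree because a vector in the domain of dΓ(ω) is in the domain of each of its
two partial field energies. -/
theorem hamiltonianTilde_eq_spinBoson (κ γ g : ℝ) (f : Momentum → ℝ) (n : ℕ) :
    hamiltonianTilde κ γ g f n =
      spinBoson (irBall κ γ (n + 1))ᶜ (cutoffCoupling κ γ g f n) dispersion := by
  have hmeas := (measurableSet_irBall κ γ n).diff (measurableSet_irBall κ γ (n + 1))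
  have hae : (fun q => (irBall κ γ n)ᶜ.indicator dispersion q +
      (irBall κ γ n \ irBall κ γ (n + 1)).indicator dispersion q)
      =ᵐ[volume.restrict (irBall κ γ (n + 1))ᶜ] dispersion := by
    filter_upwards [ae_restrict_mem (measurableSet_irBall κ γ (n + 1)).compl] with q hq
    by_cases hq2 : q ∈ irBall κ γ n
    · rw [Set.indicator_of_notMem (Set.notMem_compl_iff.2 hq2),
        Set.indicator_of_mem (show q ∈ irBall κ γ n \ irBall κ γ (n + 1) from ⟨hq2, hq⟩), zero_add]
    · rw [Set.indicator_of_mem hq2, Set.indicator_of_notMem fun h => hq2 h.1, add_zero]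
  have hae' : (fun q => dispersion q -
      (irBall κ γ n \ irBall κ γ (n + 1)).indicator dispersion q)
      =ᵐ[volume.restrict (irBall κ γ (n + 1))ᶜ] (irBall κ γ n)ᶜ.indicator dispersion := by
    filter_upwards [hae] with q hq
    rw [← hq]
    ring
  refine LinearPMap.eq_of_eq_graph (Submodule.ext fun ⟨ψ, χ⟩ => ?_)
  change (ψ, χ) ∈ (spinBoson (irBall κ γ (n + 1))ᶜ (cutoffCoupling κ γ g f n)
    ((irBall κ γ n)ᶜ.indicator dispersion) + photonOp _ (dGamma _
      ((irBall κ γ n \ irBall κ γ (n + 1)).indicator dispersion))).graph ↔ _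
  rw [mem_graph_add]
  simp only [mem_graph_spinBoson, mem_graph_photonOp_dGamma]
  constructor
  · rintro ⟨a, b, ha, hb, rfl⟩
    exact (ha.add_isMul₂ hb).congr_dispersion hae
  · intro H
    obtain ⟨d, hd⟩ := H.freeDomain.exists_isMul₂ (relBounded_dispersion.indicator hmeas)
    exact ⟨_, d, (H.sub_isMul₂ hd).congr_dispersion hae', hd, (sub_add_cancel _ _).symm⟩

variable {A : Set Momentum} {m₀ : ℝ}

/-- The step with r = ρ_{n+1} and τ = ρ_{n+1}/16. The requirement r ≤ 2δ is ρ_{n+1} ≤ ρ_n/2, that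
is, γ < 1/2. The choice of τ keeps the energy shift at half of the contour radius ρ_{n+1}/8. -/
theorem exists_groundData_succ (hκ0 : 0 < κ) (hγ0 : 0 < γ) (hγ1 : γ < 1 / 2) (hg0 : 0 < g)
    (hg1 : g < γ / 64) (hf : AEStronglyMeasurable f volume)
    (hf1 : ∀ᵐ k ∂(volume : Measure Momentum), |f k| ≤ 1) (hm : 0 < m₀)
    (hA : ∀ᵐ q ∂(volume.restrict A : Measure Momentum), m₀ ≤ ‖q‖) {n : ℕ} {e : ℝ}
    {φ : AtomPhoton A}
    (G : GroundData (cutoffCoupling κ γ g f n) (irBall κ γ n) (rho κ γ n / 4) e φ) :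
    ∃ e' φ', e - rho κ γ (n + 1) / 16 ≤ e' ∧ e' ≤ e ∧ GroundData (A := A)
      (cutoffCoupling κ γ g f (n + 1)) (irBall κ γ (n + 1)) (rho κ γ (n + 1) / 4) e' φ' := by
  have hS := measurableSet_irBall κ γ n
  have hS' := measurableSet_irBall κ γ (n + 1)
  have hsub := irBall_succ_subset hκ0 hγ0 hγ1 n
  have hρ := rho_pos hκ0 hγ0 n
  have hρ' := rho_pos hκ0 hγ0 (n + 1)
  have hbound := lintegral_indicator_coupling_le (A := A)
    (s := irBall κ γ n \ irBall κ γ (n + 1)) κ g hf1 hρ.le fun q hq => hq.1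
  have hc : (fun q => cutoffCoupling κ γ g f n q +
      (irBall κ γ n \ irBall κ γ (n + 1)).indicator (coupling κ g f) q) =
      cutoffCoupling κ γ g f (n + 1) := by
    funext q
    by_cases hq : q ∈ irBall κ γ n
    · by_cases hq2 : q ∈ irBall κ γ (n + 1)
      · simp [cutoffCoupling, hq, hq2]
      · simp [cutoffCoupling, hq, hq2]
    · have hq2 : q ∉ irBall κ γ (n + 1) := fun h => hq (hsub h)
      simp [cutoffCoupling, hq, hq2]
  have Z : Shell A (irBall κ γ n) (irBall κ γ (n + 1))
      ((irBall κ γ n \ irBall κ γ (n + 1)).indicator (coupling κ g f)) m₀ (rho κ γ (n + 1))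
      (rho κ γ (n + 1) / 16) := by
    refine ⟨hm, hA, hS, hS', hsub, memLp_indicator_coupling g hκ0.le hf hf1 (hS.diff hS'),
      fun q hq => Set.indicator_of_notMem hq _, hρ', ?_, ?_⟩
    · filter_upwards with q hq
      exact not_lt.1 hq.2
    · have h1 : (∫⁻ q in A, ‖(irBall κ γ n \ irBall κ γ (n + 1)).indicator (coupling κ g f) q‖ₑ ^ 2).toReal
          ≤ g ^ 2 * rho κ γ n ^ 2 / (8 * Real.pi) :=
        ENNReal.toReal_le_of_le_ofReal (by positivity) hbound
      -- The target ρ_{n+1}²/32 is τr/2 for these values; since ρ_{n+1} = γρ_n, the assumption g <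
      -- γ/64 is more than sufficient.
      have h2 : g ^ 2 * rho κ γ n ^ 2 / (8 * Real.pi) ≤ rho κ γ (n + 1) ^ 2 / 32 := by
        rw [rho_succ, mul_pow, div_le_div_iff₀ (by positivity) (by norm_num)]
        have h3 : g ^ 2 ≤ γ ^ 2 := pow_le_pow_left₀ hg0.le (by linarith) 2
        have h4 := Real.pi_gt_three
        have h5 : 0 < rho κ γ n ^ 2 := by positivity
        have h6 : 64 * g ^ 2 ≤ γ ^ 2 := by nlinarith
        have h7 : g ^ 2 * 32 ≤ γ ^ 2 * (8 * Real.pi) := by nlinarith [sq_nonneg γ]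
        nlinarith
      linarith
  have h1 := Z.exists_groundData G (memLp_indicator_coupling g hκ0.le hf hf1 hS.compl)
    (fun q hq => Set.indicator_of_notMem (Set.notMem_compl_iff.2 (hsub hq)) _)
    (by rw [rho_succ]; nlinarith) (by linarith)
  rw [hc] at h1
  exact h1

theorem exists_groundData (hκ0 : 0 < κ) (hκ1 : κ < 1) (hγ0 : 0 < γ) (hγ1 : γ < 1 / 2) (hg0 : 0 < g)
    (hg1 : g < γ / 64) (hf : AEStronglyMeasurable f volume)
    (hf1 : ∀ᵐ k ∂(volume : Measure Momentum), |f k| ≤ 1) (hm : 0 < m₀)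
    (hA : ∀ᵐ q ∂(volume.restrict A : Measure Momentum), m₀ ≤ ‖q‖) (n : ℕ) :
    ∃ e φ, GroundData (A := A) (cutoffCoupling κ γ g f n) (irBall κ γ n) (rho κ γ n / 4) e φ := by
  induction n with
  | zero =>
    have h0 : rho κ γ 0 = κ := by rw [rho, pow_zero, mul_one]
    -- As ρ_0 = κ, the ultraviolet and infrared cutoffs coincide and leave no interaction.
    have hc : cutoffCoupling κ γ g f 0 = fun _ => 0 := by
      funext q
      by_cases hq : ‖q‖ < κ <;> simp [cutoffCoupling, irBall, h0, coupling, hq]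
    rw [hc]
    refine ⟨0, exists_groundData_decoupled (measurableSet_irBall κ γ 0) ?_ ?_ ?_⟩
    · rw [h0]
      linarith
    · rw [h0]
      linarith
    · filter_upwards with q hq
      have h1 : rho κ γ 0 ≤ ‖q‖ := not_lt.1 hq
      rw [h0] at h1 ⊢
      linarith
  | succ n ih =>
    obtain ⟨e, φ, G⟩ := ih
    obtain ⟨e', φ', -, -, G'⟩ :=
      exists_groundData_succ hκ0 hγ0 hγ1 hg0 hg1 hf hf1 hm hA G
    exact ⟨e', φ', G'⟩

end Hamiltonians

end SpinBoson
end

open MeasureTheory Complex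
open scoped ENNReal InnerProductSpace
noncomputable section
namespace SpinBoson

/-! ### Ground states, contours and projections of H_n and H̃_n -/

section GroundStates

variable {κ γ g : ℝ} {f : Momentum → ℝ}

theorem isSelfAdj_hamiltonian (hκ0 : 0 < κ) (hγ0 : 0 < γ) (g : ℝ)
    (hf : AEStronglyMeasurable f volume) (hf1 : ∀ᵐ k ∂(volume : Measure Momentum), |f k| ≤ 1)
    (n : ℕ) : IsSelfAdj (hamiltonian κ γ g f n) := by
  rw [hamiltonian_eq_spinBoson]
  exact isSelfAdj_spinBoson (rho_pos hκ0 hγ0 n) (ae_rho_le κ γ n)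
    (memLp_indicator_coupling g hκ0.le hf hf1 (measurableSet_irBall κ γ n).compl)

theorem isSelfAdj_hamiltonianTilde (hκ0 : 0 < κ) (hγ0 : 0 < γ) (g : ℝ)
    (hf : AEStronglyMeasurable f volume) (hf1 : ∀ᵐ k ∂(volume : Measure Momentum), |f k| ≤ 1)
    (n : ℕ) : IsSelfAdj (hamiltonianTilde κ γ g f n) := by
  rw [hamiltonianTilde_eq_spinBoson]
  exact isSelfAdj_spinBoson (rho_pos hκ0 hγ0 (n + 1)) (ae_rho_le κ γ (n + 1))
    (memLp_indicator_coupling g hκ0.le hf hf1 (measurableSet_irBall κ γ n).compl)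

theorem GroundData.hamiltonian (hκ0 : 0 < κ) (hγ0 : 0 < γ) {n : ℕ} {e : ℝ}
    {φ : AtomPhoton (irBall κ γ n)ᶜ}
    (G : GroundData (cutoffCoupling κ γ g f n) (irBall κ γ n) (rho κ γ n / 4) e φ) :
    ∃ φ', HasGroundState (hamiltonian κ γ g f n) e (rho κ γ n / 4) φ' := by
  have hρ := rho_pos hκ0 hγ0 n
  -- Here B_n is disjoint from the momentum set, so the energy condition on photons in B_n is
  -- harmless, and r takes the largest value allowed by r ≤ 2δ with δ = ρ_n/4.
  have h1 := G.exists_hasGroundState (r := rho κ γ n / 2) (measurableSet_irBall κ γ n) hρ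
    (ae_rho_le κ γ n) (by linarith) (by linarith) (by
      filter_upwards [ae_rho_le κ γ n] with q hq _
      linarith)
  rw [hamiltonian_eq_spinBoson]
  rwa [show rho κ γ n / 2 / 2 = rho κ γ n / 4 by ring] at h1

/-- The free photons in B_n \ B_{n+1} have energy at least ρ_{n+1}, which limits the gap to half of
that instead of ρ_n/4. -/
theorem GroundData.hamiltonianTilde (hκ0 : 0 < κ) (hγ0 : 0 < γ) (hγ1 : γ < 1 / 2) {n : ℕ} {e : ℝ}
    {φ : AtomPhoton (irBall κ γ (n + 1))ᶜ}
    (G : GroundData (cutoffCoupling κ γ g f n) (irBall κ γ n) (rho κ γ n / 4) e φ) :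
    ∃ φ', HasGroundState (hamiltonianTilde κ γ g f n) e (rho κ γ (n + 1) / 2) φ' := by
  have hρ := rho_pos hκ0 hγ0 n
  have hρ' := rho_pos hκ0 hγ0 (n + 1)
  rw [hamiltonianTilde_eq_spinBoson]
  refine G.exists_hasGroundState (measurableSet_irBall κ γ n) hρ'
    (ae_rho_le κ γ (n + 1)) hρ' ?_ ?_
  · rw [rho_succ]
    nlinarith
  · filter_upwards [ae_rho_le κ γ (n + 1)] with q hq _
    exact hq

theorem energy_eq (hκ0 : 0 < κ) (hγ0 : 0 < γ) (hf : AEStronglyMeasurable f volume)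
    (hf1 : ∀ᵐ k ∂(volume : Measure Momentum), |f k| ≤ 1) {n : ℕ} {e : ℝ}
    {φ : (hamiltonian κ γ g f n).domain}
    (h : HasGroundState (hamiltonian κ γ g f n) e (rho κ γ n / 4) φ) : energy κ γ g f n = e :=
  h.spectralInf_eq (isSelfAdj_hamiltonian hκ0 hγ0 g hf hf1 n) (by
    linarith [rho_pos hκ0 hγ0 n])

theorem commutesWith_hamiltonian (κ γ g : ℝ) (f : Momentum → ℝ) (n : ℕ) :
    CommutesWith (symmetryOp (irBall κ γ n)ᶜ) (hamiltonian κ γ g f n) :=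
  commutesWith_symmetryOp (hamiltonian_eq_spinBoson κ γ g f n)

theorem commutesWith_hamiltonianTilde (κ γ g : ℝ) (f : Momentum → ℝ) (n : ℕ) :
    CommutesWith (symmetryOp (irBall κ γ (n + 1))ᶜ) (hamiltonianTilde κ γ g f n) :=
  commutesWith_symmetryOp (hamiltonianTilde_eq_spinBoson κ γ g f n)

theorem projP_properties (hκ0 : 0 < κ) (hκ1 : κ < 1) (hγ0 : 0 < γ) (hγ1 : γ < 1 / 2) (hg0 : 0 < g)
    (hg1 : g < γ / 64) (hf : AEStronglyMeasurable f volume)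
    (hf1 : ∀ᵐ k ∂(volume : Measure Momentum), |f k| ≤ 1) (n : ℕ) :
    contour κ γ g f n ⊆ resolventSet (hamiltonian κ γ g f n) ∧
    IsRankOneProjection (projP κ γ g f n) ∧
    projP κ γ g f n ∘L sigma1Op κ γ n ∘L projP κ γ g f n = 0 := by
  have hρ := rho_pos hκ0 hγ0 n
  obtain ⟨e, φ, G⟩ := exists_groundData hκ0 hκ1 hγ0 hγ1 hg0 hg1 hf hf1 hρ (ae_rho_le κ γ n) n
  obtain ⟨φ', hφ'⟩ := G.hamiltonian hκ0 hγ0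
  have hE := energy_eq hκ0 hγ0 hf hf1 hφ'
  obtain ⟨h1, h2⟩ := hφ'.rieszProjection_eq (isSelfAdj_hamiltonian hκ0 hγ0 g hf hf1 n)
    (c₀ := e) (r := rho κ γ n / 8) (by rw [sub_self, abs_zero]; linarith) (by linarith)
  have h3 : projP κ γ g f n = rankOneOp 1 (φ' : HilbertN κ γ n) := by
    rw [projP, hE, h2]
  rw [contour, hE, h3]
  exact ⟨h1, hφ'.isRankOneProjection, hφ'.projection_comp_eq_zero (by linarith)
    (commutesWith_hamiltonian κ γ g f n) inner_symmetryOp symmetryOp_sigma1⟩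

/-- Running the induction on the Fock space over the complement of B_{n+1} gives both the ground
state energy e of H̃_n and the energy e' of H_{n+1}, with e - ρ_{n+1}/16 ≤ e' ≤ e. The circle of
radius ρ_{n+1}/8 about e' therefore encloses e and stays below e + ρ_{n+1}/2. -/
theorem projPTilde_properties (hκ0 : 0 < κ) (hκ1 : κ < 1) (hγ0 : 0 < γ) (hγ1 : γ < 1 / 2)
    (hg0 : 0 < g) (hg1 : g < γ / 64) (hf : AEStronglyMeasurable f volume)
    (hf1 : ∀ᵐ k ∂(volume : Measure Momentum), |f k| ≤ 1) (n : ℕ) :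
    contour κ γ g f (n + 1) ⊆ resolventSet (hamiltonianTilde κ γ g f n) ∧
    IsRankOneProjection (projPTilde κ γ g f n) ∧
    projPTilde κ γ g f n ∘L sigma1Op κ γ (n + 1) ∘L projPTilde κ γ g f n = 0 := by
  have hρ := rho_pos hκ0 hγ0 (n + 1)
  obtain ⟨e, φ, G⟩ :=
    exists_groundData hκ0 hκ1 hγ0 hγ1 hg0 hg1 hf hf1 hρ (ae_rho_le κ γ (n + 1)) n
  obtain ⟨e', φ', he', he, G'⟩ :=
    exists_groundData_succ hκ0 hγ0 hγ1 hg0 hg1 hf hf1 hρ (ae_rho_le κ γ (n + 1)) G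
  obtain ⟨u, hu⟩ := G.hamiltonianTilde hκ0 hγ0 hγ1
  obtain ⟨u', hu'⟩ := G'.hamiltonian hκ0 hγ0
  have hE := energy_eq hκ0 hγ0 hf hf1 hu'
  obtain ⟨h1, h2⟩ := hu.rieszProjection_eq (isSelfAdj_hamiltonianTilde hκ0 hγ0 g hf hf1 n)
    (c₀ := e') (r := rho κ γ (n + 1) / 8) (by rw [abs_of_nonneg] <;> linarith) (by linarith)
  have h3 : projPTilde κ γ g f n = rankOneOp 1 (u : HilbertN κ γ (n + 1)) := by
    rw [projPTilde, hE, h2]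
  rw [contour, hE, h3]
  exact ⟨h1, hu.isRankOneProjection, hu.projection_comp_eq_zero (by linarith)
    (commutesWith_hamiltonianTilde κ γ g f n) inner_symmetryOp symmetryOp_sigma1⟩

end GroundStates

end SpinBoson
end

theorem mainTheorem4 (κ γ g : ℝ) (f : Momentum → ℝ)
    (hκ0 : 0 < κ) (hκ1 : κ < 1) (hγ0 : 0 < γ) (hγ1 : γ < 1 / 2)
    (hg0 : 0 < g) (hg1 : g < γ / 64)
    (hf : AEStronglyMeasurable f volume) (hf1 : ∀ᵐ k ∂(volume : Measure Momentum), |f k| ≤ 1)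
    (n : ℕ) :
    CommutesWith (symmetryOp (irBall κ γ n)ᶜ) (hamiltonian κ γ g f n) ∧
    (∀ ψ : HilbertN κ γ n,
      symmetryOp _ (sigma1Op κ γ n ψ) = -(sigma1Op κ γ n (symmetryOp _ ψ))) ∧
    contour κ γ g f n ⊆ resolventSet (hamiltonian κ γ g f n) ∧
    IsRankOneProjection (projP κ γ g f n) ∧
    contour κ γ g f (n + 1) ⊆ resolventSet (hamiltonianTilde κ γ g f n) ∧
    IsRankOneProjection (projPTilde κ γ g f n) ∧
    projP κ γ g f n ∘L sigma1Op κ γ n ∘L projP κ γ g f n = 0 ∧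
    projPTilde κ γ g f n ∘L sigma1Op κ γ (n + 1) ∘L projPTilde κ γ g f n = 0 := by
  obtain ⟨h1, h2, h3⟩ := projP_properties hκ0 hκ1 hγ0 hγ1 hg0 hg1 hf hf1 n
  obtain ⟨h4, h5, h6⟩ := projPTilde_properties hκ0 hκ1 hγ0 hγ1 hg0 hg1 hf hf1 n
  exact ⟨commutesWith_hamiltonian κ γ g f n, symmetryOp_sigma1, h1, h2, h4, h5, h3, h6⟩
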